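/- All scalars are real. Let $F$ be a separable reflexive Banach space and $\mu$ a $\sigma$-finite Borel measure on $F$. Suppose there is a dense linear subspace $F_0\subset F$ such that, for every $v\in F_0$, $\mu$ and its translate by $v$ are mutually absolutely continuous. For measurable sets $A,B\subset F$ of positive measure let $\rho(A,B)$ be the supremum of $\inf_{x\in A',\,y\in B'}\|x-y\|$ over all measurable $A',B'$ which differ from $A,B$ by null sets. For $f\in L^\infty(F)=L^\infty(F,\mu)$ let $\rho_f(A,B)$ be the distance in $\mathbb R$ between the essential ranges of $f|_A$ and $f|_B$, let $L(f)=\sup\{\rho_f(A,B)/\rho(A,B) : \rho(A,B)>0\}$, and let $\mathrm{Lip}(F)=\{f\in L^\infty(F): L(f)<\infty\}$ with norm $\|f\|_L=\max(L(f),\|f\|_\infty)$. This is a dual Banach space, whose weak* topology agrees on the unit ball with the weak* topology of $L^\infty(F)=L^1(F)'$. Let $\mathcal X(F)$ be the $L^\infty(F)$-module of all bounded weak*-continuous linear maps $\delta:\mathrm{Lip}(F)\to L^\infty(F)$ satisfying $\delta(fg)=f\,\delta(g)+\delta(f)\,g$, with the operator norm and the action $(a\delta)(f)=a\,\delta(f)$.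 Let $L^\infty(F,F)$ be the $L^\infty(F)$-module of bounded measurable functions from $F$ to $F$ modulo null sets, with the essential supremum norm. Then $\mathcal X(F)\cong L^\infty(F,F)$. More precisely, there is a surjective linear isometry $T:L^\infty(F,F)\to\mathcal X(F)$ which is $L^\infty(F)$-linear and which sends the constant vector field with value $v\in F_0$ to the generator of translation along $v$: for every $f\in\mathrm{Lip}(F)$, $$T(v\cdot 1_F)(f)=\lim_{t\to 0}\frac{f-\alpha_{tv}f}{t}\quad\text{weak* in }L^\infty(F),\qquad (\alpha_{tv}f)(x)=f(x-tv).$$ -/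

import Mathlib

open MeasureTheory Set Filter Topology
open scoped ENNReal NNReal

set_option linter.unusedSectionVars false

noncomputable section

namespace Weaver

section Metric

variable {M : Type*} [MetricSpace M] [MeasurableSpace M]

/-- `inf {d(x, y) : x ∈ A, y ∈ B}`. -/
def setDist (A B : Set M) : ℝ≥0∞ := ⨅ x ∈ A, ⨅ y ∈ B, edist x y

/-- The measurable metric on (positive measure) sets induced by the metric of `M`: the supremum of
the pointwise distances between all measurable modifications of the two sets on null sets. -/
def measDist (μ : Measure M) (A B : Set M) : ℝ≥0∞ :=
  ⨆ (A' : Set M) (B' : Set M) (_ : MeasurableSet A') (_ : MeasurableSet B')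
    (_ : A' =ᵐ[μ] A) (_ : B' =ᵐ[μ] B), setDist A' B'

/-- The essential range of the restriction of `f` to `A`. -/
def essRange (μ : Measure M) (f : M → ℝ) (A : Set M) : Set ℝ :=
  {a | ∀ U ∈ 𝓝 a, 0 < μ (A ∩ f ⁻¹' U)}

/-- The distance in `ℝ` between the essential ranges of `f|_A` and `f|_B`. -/
def essDist (μ : Measure M) (f : M → ℝ) (A B : Set M) : ℝ≥0∞ :=
  ⨅ a ∈ essRange μ f A, ⨅ b ∈ essRange μ f B, edist a b

/-- The Lipschitz number of `f`: the supremum of `ρ_f(A, B) / ρ(A, B)` over all measurable sets `A`,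
`B` of positive measure with `ρ(A, B) > 0`. -/
def lipNumber (μ : Measure M) (f : M → ℝ) : ℝ≥0∞ :=
  ⨆ (A : Set M) (B : Set M) (_ : MeasurableSet A) (_ : MeasurableSet B)
    (_ : 0 < μ A) (_ : 0 < μ B) (_ : 0 < measDist μ A B), essDist μ f A B / measDist μ A B

variable {μ : Measure M}

theorem essRange_mono {f : M → ℝ} {A B : Set M} (h : A ⊆ B) : essRange μ f A ⊆ essRange μ f B :=
  fun _ ha U hU => (ha U hU).trans_le (measure_mono (inter_subset_inter_left _ h))

theorem essRange_nonempty {f : M → ℝ} (hf : Measurable f) {A : Set M}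
    (hA : 0 < μ A) : (essRange μ f A).Nonempty := by
  by_contra hne
  rw [not_nonempty_iff_eq_empty] at hne
  have hz : ((μ.restrict A).map f) univ = 0 := by
    refine measure_null_of_locally_null _ fun a _ => ?_
    have ha : a ∉ essRange μ f A := by simp [hne]
    simp only [essRange, mem_ofPred_eq, not_forall, not_lt, nonpos_iff_eq_zero] at ha
    obtain ⟨U, hU, hU0⟩ := ha
    obtain ⟨V, hVU, hV, haV⟩ := mem_nhds_iff.1 hU
    refine ⟨V, by simpa using hV.mem_nhds haV, ?_⟩
    rw [Measure.map_apply hf hV.measurableSet, Measure.restrict_apply (hf hV.measurableSet),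
      inter_comm]
    exact measure_mono_null (inter_subset_inter_right _ (preimage_mono hVU)) hU0
  rw [Measure.map_apply hf MeasurableSet.univ] at hz
  simp at hz
  simp [hz] at hA

theorem measDist_anti {A B A' B' : Set M} (hA' : MeasurableSet A') (hB' : MeasurableSet B')
    (hA : A' ⊆ A) (hB : B' ⊆ B) : measDist μ A B ≤ measDist μ A' B' := by
  refine iSup_le fun A₁ => iSup_le fun B₁ => iSup_le fun hA₁ => iSup_le fun hB₁ =>
    iSup_le fun eA => iSup_le fun eB => ?_
  have key : ∀ {S S' T : Set M}, S' ⊆ S → T =ᵐ[μ] S → (T ∩ S' : Set M) =ᵐ[μ] S' := by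
    intro S S' T hS hT
    have h2 : (T ∩ S' : Set M) =ᵐ[μ] (S ∩ S' : Set M) := hT.inter (ae_eq_refl S')
    rwa [inter_eq_right.2 hS] at h2
  have h1 : setDist A₁ B₁ ≤ setDist (A₁ ∩ A') (B₁ ∩ B') :=
    le_iInf₂ fun x hx => le_iInf₂ fun y hy => iInf₂_le_of_le x hx.1 (iInf₂_le y hy.1)
  refine h1.trans ?_
  exact le_iSup_of_le (A₁ ∩ A') <| le_iSup_of_le (B₁ ∩ B') <| le_iSup_of_le (hA₁.inter hA') <|
    le_iSup_of_le (hB₁.inter hB') <| le_iSup_of_le (key hA eA) <|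
    le_iSup_of_le (key hB eB) le_rfl

theorem measDist_le {A B : Set M} (hA : 0 < μ A) (hB : 0 < μ B) {r : ℝ≥0∞}
    (h : ∀ x ∈ A, ∀ y ∈ B, edist x y ≤ r) : measDist μ A B ≤ r := by
  refine iSup_le fun A₁ => iSup_le fun B₁ => iSup_le fun hA₁ => iSup_le fun hB₁ =>
    iSup_le fun eA => iSup_le fun eB => ?_
  have key : ∀ {S T : Set M}, 0 < μ S → T =ᵐ[μ] S → (T ∩ S).Nonempty := by
    intro S T hS hT
    have h2 : (T ∩ S : Set M) =ᵐ[μ] (S ∩ S : Set M) := hT.inter (ae_eq_refl S)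
    rw [inter_self] at h2
    refine nonempty_of_measure_ne_zero (μ := μ) ?_
    rw [measure_congr h2]
    exact hS.ne'
  obtain ⟨x, hx⟩ := key hA eA
  obtain ⟨y, hy⟩ := key hB eB
  exact iInf₂_le_of_le x hx.1 (iInf₂_le_of_le y hy.1 (h x hx.2 y hy.2))

theorem essDist_le_of_lipNumber {f : M → ℝ} {A B : Set M} (hA : MeasurableSet A)
    (hB : MeasurableSet B) (hA0 : 0 < μ A) (hB0 : 0 < μ B) (hr : 0 < measDist μ A B)
    (hr' : measDist μ A B ≠ ∞) : essDist μ f A B ≤ lipNumber μ f * measDist μ A B := by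
  rw [← ENNReal.div_le_iff hr.ne' hr']
  exact le_iSup_of_le A <| le_iSup_of_le B <| le_iSup_of_le hA <| le_iSup_of_le hB <|
    le_iSup_of_le hA0 <| le_iSup_of_le hB0 <| le_iSup_of_le hr le_rfl

variable [TopologicalSpace.SeparableSpace M] [OpensMeasurableSpace M]

/-- Two positive measure sets contain points, at nearly the distance of the sets, all of whose
neighbourhoods meet the sets in positive measure. -/
theorem exists_points {A B : Set M} (hA : MeasurableSet A) (hB : MeasurableSet B)
    (hr : measDist μ A B ≠ ∞) {ε : ℝ≥0∞} (hε : 0 < ε) :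
    ∃ x y, (∀ U ∈ 𝓝 x, 0 < μ (A ∩ U)) ∧ (∀ U ∈ 𝓝 y, 0 < μ (B ∩ U)) ∧
      edist x y < measDist μ A B + ε := by
  have := UniformSpace.secondCountable_of_separable M
  have key : ∀ {S : Set M}, MeasurableSet S → ∃ S' : Set M, MeasurableSet S' ∧ S' =ᵐ[μ] S ∧
      ∀ x ∈ S', ∀ U ∈ 𝓝 x, 0 < μ (S ∩ U) := by
    intro S hS
    set O : Set M := {x | ∃ U ∈ 𝓝 x, μ (S ∩ U) = 0} with hO
    have hOo : IsOpen O := by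
      rw [isOpen_iff_mem_nhds]
      rintro x ⟨U, hU, hU0⟩
      filter_upwards [eventually_mem_nhds_iff.2 hU] with z hz
      exact ⟨U, hz, hU0⟩
    have hO0 : (μ.restrict S) O = 0 := by
      refine measure_null_of_locally_null _ ?_
      rintro x ⟨U, hU, hU0⟩
      obtain ⟨V, hVU, hV, hxV⟩ := mem_nhds_iff.1 hU
      refine ⟨V, mem_nhdsWithin_of_mem_nhds (hV.mem_nhds hxV), ?_⟩
      rw [Measure.restrict_apply hV.measurableSet, inter_comm]
      exact measure_mono_null (inter_subset_inter_right _ hVU) hU0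
    rw [Measure.restrict_apply hOo.measurableSet] at hO0
    refine ⟨S \ O, hS.diff hOo.measurableSet, ?_, ?_⟩
    · rw [← sdiff_inter_self_eq_sdiff]
      exact sdiff_null_ae_eq_self hO0
    · rintro x ⟨-, hx⟩ U hU
      refine pos_iff_ne_zero.2 fun h0 => hx ⟨U, hU, h0⟩
  obtain ⟨A', hA', eA, pA⟩ := key hA
  obtain ⟨B', hB', eB, pB⟩ := key hB
  have h1 : setDist A' B' ≤ measDist μ A B :=
    le_iSup_of_le A' <| le_iSup_of_le B' <| le_iSup_of_le hA' <|
      le_iSup_of_le hB' <| le_iSup_of_le eA <| le_iSup_of_le eB le_rfl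
  have h2 : setDist A' B' < measDist μ A B + ε :=
    h1.trans_lt (ENNReal.lt_add_right hr hε.ne')
  simp only [setDist, iInf_lt_iff] at h2
  obtain ⟨x, hx, y, hy, hxy⟩ := h2
  exact ⟨x, y, pA x hx, pB y hy, hxy⟩

theorem exists_shrink {S : Set M} (hS : MeasurableSet S) {x : M} {f g : M → ℝ}
    (hf : Measurable f) (hg : Measurable g) (hx : ∀ U ∈ 𝓝 x, 0 < μ (S ∩ U)) {ε : ℝ≥0∞}
    (hε : 0 < ε) : ∃ S' ⊆ S, MeasurableSet S' ∧ 0 < μ S' ∧ (∀ z ∈ S', edist z x ≤ ε) ∧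
      (∀ z ∈ S', ∀ w ∈ S', edist (f z) (f w) ≤ ε + ε) ∧
      (∀ z ∈ S', ∀ w ∈ S', edist (g z) (g w) ≤ ε + ε) := by
  have h1 := hx _ (Metric.eball_mem_nhds x hε)
  obtain ⟨a, ha⟩ := essRange_nonempty hf h1
  have h2 := ha _ (Metric.eball_mem_nhds a hε)
  obtain ⟨c, hc⟩ := essRange_nonempty hg h2
  have h3 := hc _ (Metric.eball_mem_nhds c hε)
  refine ⟨_, fun z hz => hz.1.1.1, ?_, h3, fun z hz => le_of_lt hz.1.1.2, ?_, ?_⟩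
  · exact (((hS.inter Metric.isOpen_eball.measurableSet).inter
      (hf Metric.isOpen_eball.measurableSet)).inter (hg Metric.isOpen_eball.measurableSet))
  · intro z hz w hw
    exact (edist_triangle_right _ _ a).trans (add_le_add (le_of_lt hz.1.2) (le_of_lt hw.1.2))
  · intro z hz w hw
    exact (edist_triangle_right _ _ c).trans (add_le_add (le_of_lt hz.2) (le_of_lt hw.2))

theorem exists_near {f : M → ℝ} {S G : Set M} (hG : μ Gᶜ = 0) {p : ℝ} (hp : p ∈ essRange μ f S)
    {ε : ℝ≥0∞} (hε : 0 < ε) : ∃ z ∈ S, z ∈ G ∧ edist p (f z) ≤ ε := by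
  have h1 := hp _ (Metric.eball_mem_nhds p hε)
  rw [← measure_inter_conull hG] at h1
  obtain ⟨z, hz⟩ := nonempty_of_measure_ne_zero h1.ne'
  exact ⟨z, hz.1.1, hz.2, by rw [edist_comm]; exact le_of_lt hz.1.2⟩

theorem edist_le_of_lipNumber {f : M → ℝ} {A B : Set M}
    (hA : MeasurableSet A) (hB : MeasurableSet B) (hA0 : 0 < μ A) (hB0 : 0 < μ B)
    (hr : 0 < measDist μ A B) (hr' : measDist μ A B ≠ ∞) (hL : lipNumber μ f ≠ ∞) {ε : ℝ≥0∞}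
    (hε : 0 < ε) (oA : ∀ z ∈ A, ∀ w ∈ A, edist (f z) (f w) ≤ ε + ε)
    (oB : ∀ z ∈ B, ∀ w ∈ B, edist (f z) (f w) ≤ ε + ε) {x y : M} (hx : x ∈ A) (hy : y ∈ B) :
    edist (f x) (f y) ≤ lipNumber μ f * measDist μ A B + 7 * ε := by
  have h1 : essDist μ f A B < lipNumber μ f * measDist μ A B + ε :=
    (essDist_le_of_lipNumber hA hB hA0 hB0 hr hr').trans_lt
      (ENNReal.lt_add_right (ENNReal.mul_ne_top hL hr') hε.ne')
  simp only [essDist, iInf_lt_iff] at h1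
  obtain ⟨p, hp, q, hq, hpq⟩ := h1
  obtain ⟨z, hzA, -, hz⟩ := exists_near (G := univ) (by simp) hp hε
  obtain ⟨w, hwB, -, hw⟩ := exists_near (G := univ) (by simp) hq hε
  calc edist (f x) (f y)
      ≤ edist (f x) (f z) + edist (f z) p + edist p q + edist q (f w) + edist (f w) (f y) := by
        refine (edist_triangle _ (f w) _).trans (add_le_add_left ?_ _)
        refine (edist_triangle _ q _).trans (add_le_add_left ?_ _)
        refine (edist_triangle _ p _).trans (add_le_add_left ?_ _)
        exact edist_triangle _ (f z) _
    _ ≤ (ε + ε) + ε + (lipNumber μ f * measDist μ A B + ε) + ε + (ε + ε) := by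
        gcongr
        · exact oA _ hx _ hzA
        · rwa [edist_comm]
        · exact oB _ hwB _ hy
    _ = lipNumber μ f * measDist μ A B + 7 * ε := by ring

/-- Chain estimate for Lipschitz numbers; it yields stability of `Lip` under sums, scalar multiples
and products. -/
theorem lipNumber_le_of {f g h : M → ℝ} (hf : Measurable f) (hg : Measurable g) (hh : Measurable h)
    (hLf : lipNumber μ f ≠ ∞) (hLg : lipNumber μ g ≠ ∞) {α β : ℝ≥0} {G : Set M}
    (hG : μ Gᶜ = 0)
    (H : ∀ x ∈ G, ∀ y ∈ G,
      edist (h x) (h y) ≤ α * edist (f x) (f y) + β * edist (g x) (g y)) :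
    lipNumber μ h ≤ α * lipNumber μ f + β * lipNumber μ g := by
  refine iSup_le fun A => iSup_le fun B => iSup_le fun hA => iSup_le fun hB =>
    iSup_le fun hA0 => iSup_le fun hB0 => iSup_le fun hr => ?_
  by_cases hr' : measDist μ A B = ∞
  · simp [hr']
  rw [ENNReal.div_le_iff hr.ne' hr']
  set r := measDist μ A B with hrdef
  set K := lipNumber μ f with hK
  set K' := lipNumber μ g with hK'
  set C : ℝ≥0∞ := 2 * (1 + 2 * (α + β)) + α * (3 * K + 7) + β * (3 * K' + 7) with hC
  have hCtop : C ≠ ∞ := by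
    rw [hC]
    finiteness
  have main : ∀ ε : ℝ≥0∞, 0 < ε → ε ≠ ∞ →
      essDist μ h A B ≤ (α * K + β * K') * r + ε * C := by
    intro ε hε hε'
    obtain ⟨x, y, px, py, hxy⟩ := exists_points hA hB hr' hε
    obtain ⟨A', sA, mA, A0, dA, fA, gA⟩ := exists_shrink hA hf hg px hε
    obtain ⟨B', sB, mB, B0, dB, fB, gB⟩ := exists_shrink hB hf hg py hε
    have rle : measDist μ A' B' ≤ r + 3 * ε := by
      refine measDist_le A0 B0 fun z hz w hw => ?_
      calc edist z w ≤ edist z x + edist x y + edist y w := by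
            refine (edist_triangle _ y _).trans (add_le_add_left ?_ _)
            exact edist_triangle _ x _
        _ ≤ ε + (r + ε) + ε := by
            gcongr
            · exact dA z hz
            · rw [edist_comm]; exact dB w hw
        _ = r + 3 * ε := by ring
    have rpos : 0 < measDist μ A' B' := hr.trans_le (measDist_anti mA mB sA sB)
    have rtop : measDist μ A' B' ≠ ∞ :=
      ne_top_of_le_ne_top (by finiteness) rle
    obtain ⟨p, hp⟩ := essRange_nonempty hh A0
    obtain ⟨q, hq⟩ := essRange_nonempty hh B0
    obtain ⟨x₀, hx₀, gx₀, dx₀⟩ := exists_near hG hp hε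
    obtain ⟨y₀, hy₀, gy₀, dy₀⟩ := exists_near hG hq hε
    have ef := edist_le_of_lipNumber mA mB A0 B0 rpos rtop hLf hε fA fB hx₀ hy₀
    have eg := edist_le_of_lipNumber mA mB A0 B0 rpos rtop hLg hε gA gB hx₀ hy₀
    calc essDist μ h A B ≤ edist p q :=
          iInf₂_le_of_le p (essRange_mono sA hp) (iInf₂_le q (essRange_mono sB hq))
      _ ≤ edist p (h x₀) + edist (h x₀) (h y₀) + edist (h y₀) q := by
          refine (edist_triangle _ (h y₀) _).trans (add_le_add_left ?_ _)
          exact edist_triangle _ (h x₀) _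
      _ ≤ ε + (α * (K * (r + 3 * ε) + 7 * ε) + β * (K' * (r + 3 * ε) + 7 * ε)) + ε := by
          gcongr
          · refine (H _ gx₀ _ gy₀).trans ?_
            gcongr
            · exact ef.trans (by gcongr)
            · exact eg.trans (by gcongr)
          · rwa [edist_comm]
      _ = (α * K + β * K') * r + ε * (2 + α * (3 * K + 7) + β * (3 * K' + 7)) := by ring
      _ ≤ (α * K + β * K') * r + ε * C := by
          rw [hC]
          gcongr
          exact le_mul_of_one_le_right (by simp) (by simp)
  have lim : Tendsto (fun ε : ℝ≥0∞ => (α * K + β * K') * r + ε * C) (𝓝[>] 0)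
      (𝓝 ((α * K + β * K') * r + 0 * C)) := by
    refine Tendsto.const_add _ ?_
    exact (ENNReal.Tendsto.mul_const tendsto_id (Or.inr hCtop)).mono_left nhdsWithin_le_nhds
  rw [zero_mul, add_zero] at lim
  refine ge_of_tendsto lim ?_
  have hlt : ∀ᶠ ε : ℝ≥0∞ in 𝓝[>] 0, ε < ∞ :=
    nhdsWithin_le_nhds (Iio_mem_nhds ENNReal.zero_lt_top)
  filter_upwards [hlt, self_mem_nhdsWithin] with ε h1 h2
  exact main ε h2 h1.ne

theorem lipNumber_const {c : ℝ} {h : M → ℝ} (hc : h =ᵐ[μ] fun _ => c) :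
    lipNumber μ h = 0 := by
  refine le_antisymm ?_ bot_le
  refine iSup_le fun A => iSup_le fun B => iSup_le fun hA => iSup_le fun hB =>
    iSup_le fun hA0 => iSup_le fun hB0 => iSup_le fun hr => ?_
  have key : ∀ S : Set M, 0 < μ S → c ∈ essRange μ h S := by
    intro S hS U hU
    rw [← measure_inter_conull (t := {x | h x = c}) hc] at hS
    exact hS.trans_le (measure_mono fun z hz => ⟨hz.1, by
      have h1 : h z = c := hz.2
      simpa [h1] using mem_of_mem_nhds hU⟩)
  have h0 : essDist μ h A B ≤ 0 :=
    (iInf₂_le_of_le c (key A hA0) (iInf₂_le c (key B hB0))).trans (by simp)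
  rw [nonpos_iff_eq_zero.1 h0]
  simp

end Metric

theorem measurable_coe {M : Type*} [MeasurableSpace M] {μ : Measure M} (f : Lp ℝ ∞ μ) : Measurable (f : M → ℝ) :=
  (Lp.stronglyMeasurable f).measurable

theorem ae_norm_le_norm {M : Type*} [MeasurableSpace M] {μ : Measure M} (f : Lp ℝ ∞ μ) : ∀ᵐ x ∂μ, ‖f x‖ ≤ ‖f‖ := by
  have h1 := ae_le_eLpNormEssSup (f := (f : M → ℝ)) (μ := μ)
  filter_upwards [h1] with x hx
  rw [Lp.norm_def, eLpNorm_exponent_top, ← toReal_enorm]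
  refine ENNReal.toReal_mono ?_ hx
  rw [← eLpNorm_exponent_top]
  exact (Lp.memLp f).2.ne

section Lip

variable {M : Type*} [MetricSpace M] [MeasurableSpace M] [TopologicalSpace.SeparableSpace M]
  [OpensMeasurableSpace M]

theorem lipNumber_add_le {μ : Measure M} {f g : Lp ℝ ∞ μ} (hf : lipNumber μ f ≠ ∞)
    (hg : lipNumber μ g ≠ ∞) :
    lipNumber μ ((f + g : Lp ℝ ∞ μ)) ≤ lipNumber μ f + lipNumber μ g := by
  have h := lipNumber_le_of (measurable_coe f) (measurable_coe g) (measurable_coe (f + g)) hf hg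
    (α := 1) (β := 1) (G := {x | (f + g : Lp ℝ ∞ μ) x = f x + g x}) (Lp.coeFn_add f g) (by
      intro x hx y hy
      rw [mem_ofPred_eq] at hx hy
      rw [hx, hy]
      simpa using edist_add_add_le (f x) (g x) (f y) (g y))
  simpa using h

theorem lipNumber_smul_le {μ : Measure M} (c : ℝ) {f : Lp ℝ ∞ μ} (hf : lipNumber μ f ≠ ∞) :
    lipNumber μ ((c • f : Lp ℝ ∞ μ)) ≤ ‖c‖₊ * lipNumber μ f := by
  have h := lipNumber_le_of (measurable_coe f) (measurable_coe f) (measurable_coe (c • f)) hf hf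
    (α := ‖c‖₊) (β := 0) (G := {x | (c • f : Lp ℝ ∞ μ) x = c • f x}) (Lp.coeFn_smul c f) (by
      intro x hx y hy
      rw [mem_ofPred_eq] at hx hy
      rw [hx, hy, edist_smul₀]
      simp [ENNReal.smul_def])
  simpa using h

theorem lipNumber_mul_lt_top {μ : Measure M} {f g : Lp ℝ ∞ μ} (hf : lipNumber μ f ≠ ∞)
    (hg : lipNumber μ g ≠ ∞) : lipNumber μ ((f • g : Lp ℝ ∞ μ)) ≠ ∞ := by
  set G : Set M := {x | (f • g : Lp ℝ ∞ μ) x = f x * g x ∧ ‖f x‖ ≤ ‖f‖ ∧ ‖g x‖ ≤ ‖g‖} with hG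
  have hG0 : μ Gᶜ = 0 := by
    have h1 : (f • g : Lp ℝ ∞ μ) =ᵐ[μ] (f : M → ℝ) • (g : M → ℝ) := Lp.coeFn_lpSMul f g
    have h2 : ∀ᵐ x ∂μ, x ∈ G := by
      filter_upwards [h1, ae_norm_le_norm f, ae_norm_le_norm g] with x a b c
      exact ⟨by simpa using a, b, c⟩
    exact h2
  have h := lipNumber_le_of (measurable_coe f) (measurable_coe g) (measurable_coe (f • g)) hf hg
    (α := ‖g‖₊) (β := ‖f‖₊) hG0 (by
      rintro x ⟨hx, hfx, hgx⟩ y ⟨hy, hfy, hgy⟩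
      rw [hx, hy]
      simp only [edist_dist]
      have e1 : ∀ u : Lp ℝ ∞ μ, (‖u‖₊ : ℝ≥0∞) = ENNReal.ofReal ‖u‖ := fun u => by
        rw [← coe_nnnorm, ENNReal.ofReal_coe_nnreal]
      rw [e1, e1,
        ← ENNReal.ofReal_mul (norm_nonneg _), ← ENNReal.ofReal_mul (norm_nonneg _),
        ← ENNReal.ofReal_add (by positivity) (by positivity)]
      refine ENNReal.ofReal_le_ofReal ?_
      rw [Real.dist_eq, Real.dist_eq, Real.dist_eq]
      have e : f x * g x - f y * g y = g x * (f x - f y) + f y * (g x - g y) := by ring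
      rw [e]
      refine (abs_add_le _ _).trans ?_
      rw [abs_mul, abs_mul]
      exact add_le_add (mul_le_mul_of_nonneg_right hgx (abs_nonneg _))
        (mul_le_mul_of_nonneg_right hfy (abs_nonneg _)))
  refine ne_top_of_le_ne_top ?_ h
  finiteness

/-- The elements of `L^∞(M)` with finite Lipschitz number. -/
def lipSubmodule (μ : Measure M) : Submodule ℝ (Lp ℝ ∞ μ) where
  carrier := {f | lipNumber μ f ≠ ∞}
  add_mem' {f g} hf hg := ne_top_of_le_ne_top (ENNReal.add_ne_top.2 ⟨hf, hg⟩)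
    (lipNumber_add_le hf hg)
  zero_mem' := by
    have h := lipNumber_const (Lp.coeFn_zero ℝ ∞ μ)
    simp only [mem_ofPred_eq, h]
    simp
  smul_mem' c f hf := ne_top_of_le_ne_top (ENNReal.mul_ne_top (by simp) hf)
    (lipNumber_smul_le c hf)

/-- The space `Lip(M)`. -/
def Lip (μ : Measure M) : Type _ := lipSubmodule μ

namespace Lip

variable {μ : Measure M}

instance instAddCommGroup : AddCommGroup (Lip μ) := inferInstanceAs (AddCommGroup (lipSubmodule μ))

instance instModule : Module ℝ (Lip μ) := inferInstanceAs (Module ℝ (lipSubmodule μ))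

/-- The inclusion of `Lip(M)` in `L^∞(M)`. -/
def toLinf : Lip μ →ₗ[ℝ] Lp ℝ ∞ μ := (lipSubmodule μ).subtype

theorem lipNumber_ne_top (f : Lip μ) : lipNumber μ (toLinf f) ≠ ∞ := f.2

theorem toLinf_injective : Function.Injective (toLinf : Lip μ → Lp ℝ ∞ μ) :=
  Subtype.val_injective

/-- `Lip(M)` is closed under products. -/
instance instMul : Mul (Lip μ) where
  mul f g := ⟨(toLinf f • toLinf g : Lp ℝ ∞ μ),
    lipNumber_mul_lt_top (lipNumber_ne_top f) (lipNumber_ne_top g)⟩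

theorem toLinf_mul (f g : Lip μ) : toLinf (f * g) = (toLinf f • toLinf g : Lp ℝ ∞ μ) := rfl

theorem lipNumber_smul_toReal_le (c : ℝ) (f : Lip μ) :
    (lipNumber μ (toLinf (c • f))).toReal ≤ ‖c‖ * (lipNumber μ (toLinf f)).toReal := by
  rw [map_smul]
  have h := ENNReal.toReal_mono (ENNReal.mul_ne_top (by simp) (lipNumber_ne_top f))
    (lipNumber_smul_le c (lipNumber_ne_top f))
  simpa using h

/-- The norm `‖f‖_L = max (L(f)) ‖f‖_∞`. -/
instance instNormedAddCommGroup : NormedAddCommGroup (Lip μ) :=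
  AddGroupNorm.toNormedAddCommGroup
    { toFun := fun f => max (lipNumber μ (toLinf f)).toReal ‖toLinf f‖
      map_zero' := by
        have h := lipNumber_const (Lp.coeFn_zero ℝ ∞ μ)
        simp only [map_zero, h]
        simp
      add_le' := fun f g => by
        rw [map_add]
        refine max_le ?_ ?_
        · refine (ENNReal.toReal_mono (ENNReal.add_ne_top.2
            ⟨lipNumber_ne_top f, lipNumber_ne_top g⟩)
            (lipNumber_add_le (lipNumber_ne_top f) (lipNumber_ne_top g))).trans ?_
          rw [ENNReal.toReal_add (lipNumber_ne_top f) (lipNumber_ne_top g)]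
          exact add_le_add (le_max_left _ _) (le_max_left _ _)
        · exact (norm_add_le _ _).trans (add_le_add (le_max_right _ _) (le_max_right _ _))
      neg' := fun f => by
        have h1 : ∀ f : Lip μ, (lipNumber μ (toLinf (-f))).toReal ≤
            (lipNumber μ (toLinf f)).toReal := fun f => by
          have h := lipNumber_smul_toReal_le (-1) f
          simpa using h
        have h2 : (lipNumber μ (toLinf (-f))).toReal = (lipNumber μ (toLinf f)).toReal :=
          le_antisymm (h1 f) (by simpa using h1 (-f))
        rw [h2, map_neg, norm_neg]
      eq_zero_of_map_eq_zero' := fun f hf => by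
        have h1 : ‖toLinf f‖ ≤ 0 := (le_max_right _ _).trans hf.le
        exact toLinf_injective (by simpa using h1) }

theorem norm_def (f : Lip μ) : ‖f‖ = max (lipNumber μ (toLinf f)).toReal ‖toLinf f‖ := rfl

theorem norm_toLinf_le (f : Lip μ) : ‖toLinf f‖ ≤ ‖f‖ := le_max_right _ _

instance instNormedSpace : NormedSpace ℝ (Lip μ) where
  norm_smul_le c f := by
    rw [norm_def, norm_def, mul_max_of_nonneg _ _ (norm_nonneg c)]
    refine max_le_max (lipNumber_smul_toReal_le c f) ?_
    rw [map_smul]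
    exact norm_smul_le _ _

end Lip

/-- The weak* topology of `L^∞(M)`, as the dual of `L^1(M)`. -/
@[reducible]
def weakStar (μ : Measure M) : TopologicalSpace (Lp ℝ ∞ μ) :=
  ⨅ g : Lp ℝ 1 μ, TopologicalSpace.induced (fun f : Lp ℝ ∞ μ => ∫ x, f x * g x ∂μ) inferInstance

/-- The predual of `Lip(M)`: the bounded linear functionals on `Lip(M)` whose restriction to the
unit ball is continuous for the weak* topology of `L^∞(M)`. -/
def lipPredual (μ : Measure M) : Set (Lip μ →L[ℝ] ℝ) :=
  {l | @ContinuousOn _ _ (TopologicalSpace.induced (Lip.toLinf (μ := μ)) (weakStar μ)) _ l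
    {f | ‖f‖ ≤ 1}}

/-- The weak* topology of `Lip(M)`, as the dual of its predual. -/
@[reducible]
def lipWeakStar (μ : Measure M) : TopologicalSpace (Lip μ) :=
  ⨅ l ∈ lipPredual μ, TopologicalSpace.induced (fun f : Lip μ => l f) inferInstance

/-- A metric derivation: a bounded, weak*-continuous linear map `δ : Lip(M) → L^∞(M)` with
`δ(fg) = f δ(g) + δ(f) g`. -/
def IsMetricDerivation {μ : Measure M} (δ : Lip μ →L[ℝ] Lp ℝ ∞ μ) : Prop :=
  @Continuous _ _ (lipWeakStar μ) (weakStar μ) δ ∧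
    ∀ f g : Lip μ, δ (f * g) =
      (Lip.toLinf f • δ g : Lp ℝ ∞ μ) + (δ f • Lip.toLinf g : Lp ℝ ∞ μ)

theorem integrable_mul {μ : Measure M} (f : Lp ℝ ∞ μ) (g : Lp ℝ 1 μ) :
    Integrable (fun x => f x * g x) μ := by
  have h := (L1.integrable_coeFn g).bdd_mul (Lp.aestronglyMeasurable f) (ae_norm_le_norm f)
  exact h

theorem continuous_weakStar_iff {μ : Measure M} {X : Type*} {t : TopologicalSpace X}
    {u : X → Lp ℝ ∞ μ} : @Continuous _ _ t (weakStar μ) u ↔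
      ∀ g : Lp ℝ 1 μ, @Continuous _ _ t _ fun z => ∫ x, u z x * g x ∂μ := by
  rw [weakStar, continuous_iInf_rng]
  exact forall_congr' fun g => continuous_induced_rng

theorem continuous_weakStar_add {μ : Measure M} {X : Type*} {t : TopologicalSpace X}
    {u v : X → Lp ℝ ∞ μ} (hu : @Continuous _ _ t (weakStar μ) u)
    (hv : @Continuous _ _ t (weakStar μ) v) : @Continuous _ _ t (weakStar μ) (fun z => u z + v z) := by
  refine continuous_weakStar_iff.2 fun g => ?_
  refine ((continuous_weakStar_iff.1 hu g).add (continuous_weakStar_iff.1 hv g)).congr fun f => ?_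
  rw [Pi.add_apply, ← integral_add (integrable_mul _ _) (integrable_mul _ _)]
  refine integral_congr_ae ?_
  filter_upwards [Lp.coeFn_add (u f) (v f)] with x hx
  rw [hx, Pi.add_apply]
  ring

theorem continuous_weakStar_mul {μ : Measure M} {X : Type*} {t : TopologicalSpace X}
    {u : X → Lp ℝ ∞ μ} (hu : @Continuous _ _ t (weakStar μ) u) (a : Lp ℝ ∞ μ) :
    @Continuous _ _ t (weakStar μ) (fun z => (a • u z : Lp ℝ ∞ μ)) := by
  refine continuous_weakStar_iff.2 fun g => ?_
  refine (continuous_weakStar_iff.1 hu (a • g : Lp ℝ 1 μ)).congr fun f => ?_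
  refine integral_congr_ae ?_
  have e1 : (a • g : Lp ℝ 1 μ) =ᵐ[μ] (a : M → ℝ) • (g : M → ℝ) := Lp.coeFn_lpSMul a g
  have e2 : (a • u f : Lp ℝ ∞ μ) =ᵐ[μ] (a : M → ℝ) • (u f : M → ℝ) := Lp.coeFn_lpSMul a (u f)
  filter_upwards [e1, e2] with x h1 h2
  rw [h1, h2]
  simp only [Pi.smul_apply', smul_eq_mul]
  ring

theorem continuous_weakStar_const_smul {μ : Measure M} {X : Type*} {t : TopologicalSpace X}
    {u : X → Lp ℝ ∞ μ} (hu : @Continuous _ _ t (weakStar μ) u) (c : ℝ) :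
    @Continuous _ _ t (weakStar μ) (fun z => c • u z) := by
  refine continuous_weakStar_iff.2 fun g => ?_
  refine ((continuous_weakStar_iff.1 hu g).const_mul c).congr fun f => ?_
  rw [← integral_const_mul]
  refine integral_congr_ae ?_
  filter_upwards [Lp.coeFn_smul c (u f)] with x hx
  rw [hx, Pi.smul_apply, smul_eq_mul]
  ring

/-- Multiplication of functions in `L^∞(M)` by `a`, as a bounded operator. -/
def mulLinf {μ : Measure M} (a : Lp ℝ ∞ μ) : Lp ℝ ∞ μ →L[ℝ] Lp ℝ ∞ μ :=
  LinearMap.mkContinuous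
    { toFun := fun f => (a • f : Lp ℝ ∞ μ)
      map_add' := fun f g => Lp.add_smul a f g
      map_smul' := fun c f => (Lp.smul_comm c a f).symm } ‖a‖ fun f => Lp.norm_smul_le a f

theorem IsMetricDerivation.mulLinf_comp {μ : Measure M} {δ : Lip μ →L[ℝ] Lp ℝ ∞ μ}
    (h : IsMetricDerivation δ) (a : Lp ℝ ∞ μ) : IsMetricDerivation ((mulLinf a).comp δ) := by
  refine ⟨continuous_weakStar_mul h.1 a, fun f g => ?_⟩
  · change (a • δ (f * g) : Lp ℝ ∞ μ) = (Lip.toLinf f • (a • δ g : Lp ℝ ∞ μ) : Lp ℝ ∞ μ) +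
      ((a • δ f : Lp ℝ ∞ μ) • Lip.toLinf g : Lp ℝ ∞ μ)
    rw [h.2, Lp.add_smul]
    have key : ∀ u v : Lp ℝ ∞ μ, (u • v : Lp ℝ ∞ μ) =ᵐ[μ] (u : M → ℝ) • (v : M → ℝ) :=
      fun u v => Lp.coeFn_lpSMul u v
    congr 1
    · refine Lp.ext ?_
      filter_upwards [key a (Lip.toLinf f • δ g : Lp ℝ ∞ μ), key (Lip.toLinf f) (δ g),
        key (Lip.toLinf f) (a • δ g : Lp ℝ ∞ μ), key a (δ g)] with x h1 h2 h3 h4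
      simp only [h1, h2, h3, h4, Pi.smul_apply', smul_eq_mul]
      ring
    · refine Lp.ext ?_
      filter_upwards [key a (δ f • Lip.toLinf g : Lp ℝ ∞ μ), key (δ f) (Lip.toLinf g),
        key (a • δ f : Lp ℝ ∞ μ) (Lip.toLinf g), key a (δ f)] with x h1 h2 h3 h4
      simp only [h1, h2, h3, h4, Pi.smul_apply', smul_eq_mul]
      ring

/-- The space `𝒳(M)` of measurable vector fields: all metric derivations from `Lip(M)` into
`L^∞(M)`, with the operator norm. -/
def VectorFields (μ : Measure M) : Submodule ℝ (Lip μ →L[ℝ] Lp ℝ ∞ μ) where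
  carrier := {δ | IsMetricDerivation δ}
  add_mem' {δ ε} hδ hε := by
    refine ⟨continuous_weakStar_add hδ.1 hε.1, fun f g => ?_⟩
    · simp only [_root_.add_apply, hδ.2, hε.2, Lp.smul_add, Lp.add_smul]
      abel
  zero_mem' := by
    refine ⟨@continuous_const _ _ (lipWeakStar μ) (weakStar μ) 0, fun f g => ?_⟩
    · change (0 : Lp ℝ ∞ μ) = (Lip.toLinf f • (0 : Lp ℝ ∞ μ) : Lp ℝ ∞ μ) +
        ((0 : Lp ℝ ∞ μ) • Lip.toLinf g : Lp ℝ ∞ μ)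
      rw [Lp.smul_zero, Lp.zero_smul, add_zero]
  smul_mem' c δ hδ := by
    refine ⟨continuous_weakStar_const_smul hδ.1 c, fun f g => ?_⟩
    · change c • δ (f * g) = (Lip.toLinf f • (c • δ g) : Lp ℝ ∞ μ) +
        ((c • δ f) • Lip.toLinf g : Lp ℝ ∞ μ)
      rw [hδ.2, smul_add, Lp.smul_comm, Lp.smul_assoc]

/-- The action `(a • δ)(f) = a δ(f)` of `L^∞(M)` on `𝒳(M)`. -/
instance instSMulVectorFields {μ : Measure M} : SMul (Lp ℝ ∞ μ) (VectorFields μ) where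
  smul a δ := ⟨(mulLinf a).comp δ.1, IsMetricDerivation.mulLinf_comp δ.2 a⟩

theorem vectorFields_smul_apply {μ : Measure M} (a : Lp ℝ ∞ μ) (δ : VectorFields μ) (f : Lip μ) :
    (a • δ : VectorFields μ).1 f = (a • δ.1 f : Lp ℝ ∞ μ) := rfl

end Lip

section Translation

variable {F : Type*} [NormedAddCommGroup F] [NormedSpace ℝ F] [MeasurableSpace F] [BorelSpace F]

/-- `μ` and its translate by `v` are mutually absolutely continuous for every `v ∈ F₀`. -/
def QuasiInvariant (μ : Measure F) (F₀ : Submodule ℝ F) : Prop :=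
  ∀ v ∈ F₀, μ.map (fun x => x + v) ≪ μ ∧ μ ≪ μ.map (fun x => x + v)

theorem QuasiInvariant.quasiMeasurePreserving_sub {μ : Measure F} {F₀ : Submodule ℝ F}
    (h : QuasiInvariant μ F₀) (v : F₀) :
    Measure.QuasiMeasurePreserving (fun x => x - (v : F)) μ μ := by
  refine ⟨(continuous_id.sub continuous_const).measurable, ?_⟩
  have h1 := (h (-(v : F)) (F₀.neg_mem v.2)).1
  simpa [sub_eq_add_neg] using h1

/-- Translation by `v ∈ F₀` on `L^∞(F)`: `(α_v f)(x) = f(x - v)`. -/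
def translate {μ : Measure F} {F₀ : Submodule ℝ F} (h : QuasiInvariant μ F₀) (v : F₀)
    (f : Lp ℝ ∞ μ) : Lp ℝ ∞ μ :=
  MemLp.toLp (fun x => f (x - (v : F))) <| by
    have hq := h.quasiMeasurePreserving_sub v
    refine memLp_top_of_bound ((Lp.aestronglyMeasurable f).comp_quasiMeasurePreserving hq) ‖f‖ ?_
    exact hq.ae (ae_norm_le_norm f)

/-- `f` lies in the domain of the generator `f ↦ lim_{t → 0} (f - α_{tv} f) / t` of the group of
translations along `v`, the limit being taken in the weak* topology, and this generator maps `f`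
to `k`. -/
def IsGeneratorValue {μ : Measure F} {F₀ : Submodule ℝ F} [TopologicalSpace.SeparableSpace F]
    (h : QuasiInvariant μ F₀) (v : F₀) (f k : Lp ℝ ∞ μ) : Prop :=
  Tendsto (fun t : ℝ => t⁻¹ • (f - translate h (t • v) f)) (𝓝[≠] 0) (@nhds _ (weakStar μ) k)

/-- The constant vector field with value `v`, as an element of `L^∞(F, F)`. -/
def constField (μ : Measure F) (v : F) : Lp F ∞ μ := MemLp.toLp (fun _ => v) (memLp_top_const v)

end Translation

end Weaver

end

noncomputable section

namespace Weaver

/-! ### The norm of `L^∞` as an essential bound -/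

section EssSup

variable {M E : Type*} [MeasurableSpace M] {μ : Measure M} [NormedAddCommGroup E]

/-! The isometry `T` sends a field `Φ` to the operator `f ↦ (x ↦ lineDeriv ℝ f.rep x (Φ x))`. Every
`f` in `Lip μ` has a genuine Lipschitz representative `f.rep` (`exists_lipschitzWith_ae_eq`). Unless
`μ = 0`, quasi-invariance gives nonempty open sets positive measure, so this representative is
unique and compatible with the algebra operations.

For `T Φ` to be a metric derivation, two facts are needed. First, a Lipschitz function is Gateaux
differentiable almost everywhere (`ae_exists_clm_hasLineDerivAt`): Rademacher's theorem holds on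
planes spanned by vectors of `F₀`, Fubini and quasi-invariance carry it to `μ`, and density of `F₀`
does the rest. Second, differentiation is weak* continuous. On the unit ball this may be tested on
pointwise convergent sequences (`mem_lipPredual_of_tendsto`), and there it follows from integration
by parts on lines (`tendsto_integral_lineDeriv_field`). Clearly `‖T Φ‖ ≤ ‖Φ‖`; truncations of a
norming sequence of functionals `φ n` give the reverse inequality.

For surjectivity, let `δ` be a metric derivation. It is local: `δ |f| = sign f · δ f` (`abs_ae_eq`),
hence `δ f = 0` almost everywhere on `{f = 0}`. So the values of `δ` on truncations of `φ n` glue to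
one function `d n`, and locality also bounds rational combinations of the `d n x` by `‖δ‖` times the
norm of the same combination of the `φ n` (`ae_abs_sum_le`). By Hahn–Banach and reflexivity there is
a vector `Φ x` with `φ n (Φ x) = d n x`, and it depends measurably on `x`. Now `δ - T Φ` annihilates
all truncated `φ n`. Its kernel is stable under lattice operations and bounded pointwise limits. The
norm is the supremum of the `φ n`, and a `K`-Lipschitz function is the infimum of its cones `f y + K
‖x - y‖`; therefore the difference vanishes (`eq_zero_of_norming`). -/

theorem Lp_top_ae_norm_le (f : Lp E ∞ μ) : ∀ᵐ x ∂μ, ‖f x‖ ≤ ‖f‖ := by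
  filter_upwards [ae_le_eLpNormEssSup (f := (f : M → E)) (μ := μ)] with x hx
  rw [Lp.norm_def, eLpNorm_exponent_top, ← toReal_enorm]
  refine ENNReal.toReal_mono ?_ hx
  rw [← eLpNorm_exponent_top]
  exact (Lp.memLp f).2.ne

theorem Lp_top_norm_le {f : Lp E ∞ μ} {C : ℝ} (hC : 0 ≤ C) (h : ∀ᵐ x ∂μ, ‖f x‖ ≤ C) :
    ‖f‖ ≤ C := by
  rw [Lp.norm_def, eLpNorm_exponent_top]
  exact ENNReal.toReal_le_of_le_ofReal hC (eLpNormEssSup_le_of_ae_bound h)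

end EssSup

/-! ### Lipschitz representatives of elements of `Lip` -/

section Representative

variable {M : Type*} [MetricSpace M] [MeasurableSpace M] {μ : Measure M}

theorem essRange_congr {f g : M → ℝ} (h : f =ᵐ[μ] g) (A : Set M) :
    essRange μ f A = essRange μ g A := by
  have key : ∀ U : Set ℝ, μ (A ∩ f ⁻¹' U) = μ (A ∩ g ⁻¹' U) := fun U => by
    refine measure_congr ?_
    filter_upwards [h] with x hx
    apply propext
    change (x ∈ A ∧ f x ∈ U) ↔ (x ∈ A ∧ g x ∈ U)
    rw [hx]
  simp only [essRange, key]

variable [TopologicalSpace.SeparableSpace M] [OpensMeasurableSpace M]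

/-- At the points supplied by `exists_points` every neighbourhood meets the set in positive measure,
so by continuity the values of `g` there lie in the essential ranges. -/
theorem lipNumber_le_of_lipschitzWith {f g : M → ℝ} {K : ℝ≥0} (hg : LipschitzWith K g)
    (h : f =ᵐ[μ] g) : lipNumber μ f ≤ K := by
  refine iSup_le fun A => iSup_le fun B => iSup_le fun hA => iSup_le fun hB =>
    iSup_le fun hA0 => iSup_le fun hB0 => iSup_le fun hr => ?_
  by_cases hr' : measDist μ A B = ∞
  · simp [hr']
  rw [ENNReal.div_le_iff hr.ne' hr']
  have main : ∀ ε : ℝ≥0∞, 0 < ε → essDist μ f A B ≤ K * (measDist μ A B + ε) := by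
    intro ε hε
    obtain ⟨x, y, px, py, hxy⟩ := exists_points hA hB hr' hε
    have mem : ∀ {S : Set M} {z : M}, (∀ U ∈ 𝓝 z, 0 < μ (S ∩ U)) → g z ∈ essRange μ f S := by
      intro S z hz
      rw [essRange_congr h]
      exact fun U hU => hz _ (hg.continuous.continuousAt hU)
    exact (iInf₂_le_of_le (g x) (mem px) (iInf₂_le (g y) (mem py))).trans
      ((hg x y).trans (by gcongr))
  have lim : Tendsto (fun ε : ℝ≥0∞ => K * (measDist μ A B + ε)) (𝓝[>] 0)
      (𝓝 (K * (measDist μ A B + 0))) :=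
    (ENNReal.Tendsto.const_mul (tendsto_const_nhds.add tendsto_id)
      (Or.inr ENNReal.coe_ne_top)).mono_left nhdsWithin_le_nhds
  rw [add_zero] at lim
  refine ge_of_tendsto lim ?_
  filter_upwards [self_mem_nhdsWithin] with ε hε
  exact main ε hε

theorem le_measDist {A B : Set M} (hA : MeasurableSet A) (hB : MeasurableSet B) {r : ℝ≥0∞}
    (h : ∀ x ∈ A, ∀ y ∈ B, r ≤ edist x y) : r ≤ measDist μ A B :=
  le_iSup_of_le A <| le_iSup_of_le B <| le_iSup_of_le hA <| le_iSup_of_le hB <|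
    le_iSup_of_le (ae_eq_refl A) <| le_iSup_of_le (ae_eq_refl B) <|
    le_iInf₂ fun x hx => le_iInf₂ fun y hy => h x hx y hy

/-- Almost every point of the graph of `f` lies in the support of the image of `μ` under `x ↦ (x, f
x)`. Around two such points there are arbitrarily small sets of positive measure on which `f` is
nearly constant, and the Lipschitz number compares them. So `f` is already Lipschitz on a conull set
and can be extended from it. -/
theorem exists_lipschitzWith_ae_eq {f : M → ℝ} (hf : Measurable f) (hL : lipNumber μ f ≠ ∞) :
    ∃ g : M → ℝ, LipschitzWith (lipNumber μ f).toNNReal g ∧ f =ᵐ[μ] g := by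
  have := UniformSpace.secondCountable_of_separable M
  have hgr : Measurable fun x => (x, f x) := measurable_id.prodMk hf
  set ν := μ.map fun x => (x, f x) with hν
  set G : Set M := {x | (x, f x) ∈ ν.support} with hGdef
  have hG : ∀ᵐ x ∂μ, x ∈ G :=
    ae_of_ae_map hgr.aemeasurable (p := fun z => z ∈ ν.support) Measure.support_mem_ae
  have hGpos : ∀ x ∈ G, ∀ ε : ℝ≥0∞, 0 < ε →
      0 < μ (Metric.eball x ε ∩ f ⁻¹' Metric.eball (f x) ε) := by
    intro x hx ε hε
    have h1 := (Measure.mem_support_iff_forall (x, f x)).1 hx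
      (Metric.eball x ε ×ˢ Metric.eball (f x) ε)
      (prod_mem_nhds (Metric.eball_mem_nhds x hε) (Metric.eball_mem_nhds _ hε))
    rwa [hν, Measure.map_apply hgr
      (Metric.isOpen_eball.measurableSet.prod Metric.isOpen_eball.measurableSet)] at h1
  have hlip : LipschitzOnWith (lipNumber μ f).toNNReal f G := by
    intro x hx y hy
    rw [ENNReal.coe_toNNReal hL]
    rcases eq_or_ne x y with rfl | hxy
    · simp
    have hd : 0 < edist x y := edist_pos.2 hxy
    have main : ∀ ε : ℝ≥0∞, 0 < ε → ε + ε < edist x y →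
        edist (f x) (f y) ≤ lipNumber μ f * (edist x y + 2 * ε) + 7 * ε := by
      intro ε hε hε2
      have mS : ∀ z, MeasurableSet (Metric.eball z ε ∩ f ⁻¹' Metric.eball (f z) ε) := fun z =>
        Metric.isOpen_eball.measurableSet.inter (hf Metric.isOpen_eball.measurableSet)
      have osc : ∀ z, ∀ a ∈ Metric.eball z ε ∩ f ⁻¹' Metric.eball (f z) ε,
          ∀ b ∈ Metric.eball z ε ∩ f ⁻¹' Metric.eball (f z) ε, edist (f a) (f b) ≤ ε + ε :=
        fun z a ha b hb => (edist_triangle_right _ _ (f z)).trans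
          (add_le_add (le_of_lt ha.2) (le_of_lt hb.2))
      have hpos : 0 < measDist μ (Metric.eball x ε ∩ f ⁻¹' Metric.eball (f x) ε)
          (Metric.eball y ε ∩ f ⁻¹' Metric.eball (f y) ε) := by
        refine (tsub_pos_of_lt hε2).trans_le (le_measDist (mS x) (mS y) fun a ha b hb => ?_)
        rw [tsub_le_iff_right]
        calc edist x y ≤ edist x a + edist a b + edist b y :=
              (edist_triangle _ b _).trans (add_le_add_left (edist_triangle _ _ _) _)
          _ ≤ ε + edist a b + ε := by
              gcongr
              · rw [edist_comm]; exact le_of_lt ha.1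
              · exact le_of_lt hb.1
          _ = edist a b + (ε + ε) := by ring
      have hle : measDist μ (Metric.eball x ε ∩ f ⁻¹' Metric.eball (f x) ε)
          (Metric.eball y ε ∩ f ⁻¹' Metric.eball (f y) ε) ≤ edist x y + 2 * ε := by
        refine measDist_le (hGpos x hx ε hε) (hGpos y hy ε hε) fun a ha b hb => ?_
        calc edist a b ≤ edist a x + edist x y + edist y b :=
              (edist_triangle _ y _).trans (add_le_add_left (edist_triangle _ _ _) _)
          _ ≤ ε + edist x y + ε := by
              gcongr
              · exact le_of_lt ha.1
              · rw [edist_comm]; exact le_of_lt hb.1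
          _ = edist x y + 2 * ε := by ring
      have hεtop : ε ≠ ∞ := by
        rintro rfl
        simp at hε2
      have htop := ne_top_of_le_ne_top (by finiteness [edist_ne_top x y]) hle
      refine (edist_le_of_lipNumber (mS x) (mS y) (hGpos x hx ε hε) (hGpos y hy ε hε) hpos htop hL
        hε (osc x) (osc y) (x := x) (y := y) ?_ ?_).trans (by gcongr)
      · exact ⟨Metric.mem_eball_self hε, Metric.mem_eball_self hε⟩
      · exact ⟨Metric.mem_eball_self hε, Metric.mem_eball_self hε⟩
    have lim : Tendsto (fun ε : ℝ≥0∞ => lipNumber μ f * (edist x y + 2 * ε) + 7 * ε) (𝓝[>] 0)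
        (𝓝 (lipNumber μ f * (edist x y + 2 * 0) + 7 * 0)) := by
      refine Tendsto.mono_left ?_ nhdsWithin_le_nhds
      refine Tendsto.add ?_ (ENNReal.Tendsto.const_mul tendsto_id (Or.inr (by simp)))
      refine ENNReal.Tendsto.const_mul (Tendsto.add tendsto_const_nhds ?_) (Or.inr hL)
      exact ENNReal.Tendsto.const_mul tendsto_id (Or.inr (by simp))
    rw [mul_zero, mul_zero, add_zero, add_zero] at lim
    refine ge_of_tendsto lim ?_
    have hlt : ∀ᶠ ε : ℝ≥0∞ in 𝓝[>] 0, ε + ε < edist x y := by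
      refine nhdsWithin_le_nhds ?_
      have : Tendsto (fun ε : ℝ≥0∞ => ε + ε) (𝓝 0) (𝓝 (0 + 0)) := tendsto_id.add tendsto_id
      rw [add_zero] at this
      exact this.eventually (gt_mem_nhds hd)
    filter_upwards [hlt, self_mem_nhdsWithin] with ε h1 h2
    exact main ε h2 h1
  obtain ⟨g, hg, hfg⟩ := hlip.extend_real
  refine ⟨g, hg, ?_⟩
  filter_upwards [hG] with x hx
  exact hfg hx

namespace Lip

/-- The Lipschitz representative of an element of `Lip(M)`. -/
def rep (f : Lip μ) : M → ℝ :=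
  (exists_lipschitzWith_ae_eq (measurable_coe (toLinf f)) (lipNumber_ne_top f)).choose

theorem lipschitzWith_rep (f : Lip μ) :
    LipschitzWith (lipNumber μ (toLinf f)).toNNReal (rep f) :=
  (exists_lipschitzWith_ae_eq (measurable_coe (toLinf f)) (lipNumber_ne_top f)).choose_spec.1

theorem rep_ae_eq (f : Lip μ) : (toLinf f : M → ℝ) =ᵐ[μ] rep f :=
  (exists_lipschitzWith_ae_eq (measurable_coe (toLinf f)) (lipNumber_ne_top f)).choose_spec.2

theorem lipschitzWith_rep_of_norm_le {f : Lip μ} {C : ℝ≥0} (h : ‖f‖ ≤ C) :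
    LipschitzWith C (rep f) := by
  refine (lipschitzWith_rep f).weaken ?_
  rw [← NNReal.coe_le_coe]
  exact (le_max_left _ _).trans h

theorem continuous_rep (f : Lip μ) : Continuous (rep f) := (lipschitzWith_rep f).continuous

theorem memLp_top_of_lipschitzWith {g : M → ℝ} {K : ℝ≥0} (hg : LipschitzWith K g) {R : ℝ}
    (hR : ∀ x, |g x| ≤ R) : MemLp g ∞ μ := by
  have := UniformSpace.secondCountable_of_separable M
  exact memLp_top_of_bound hg.continuous.aestronglyMeasurable R (.of_forall hR)

/-- A bounded Lipschitz function, as an element of `Lip(M)`. -/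
def mk (g : M → ℝ) {K : ℝ≥0} (hg : LipschitzWith K g) {R : ℝ} (hR : ∀ x, |g x| ≤ R) : Lip μ :=
  ⟨(memLp_top_of_lipschitzWith hg hR).toLp g, ne_top_of_le_ne_top ENNReal.coe_ne_top
    (lipNumber_le_of_lipschitzWith hg (memLp_top_of_lipschitzWith hg hR).coeFn_toLp)⟩

theorem toLinf_mk_ae_eq (g : M → ℝ) {K : ℝ≥0} (hg : LipschitzWith K g) {R : ℝ}
    (hR : ∀ x, |g x| ≤ R) : (toLinf (mk g hg hR : Lip μ) : M → ℝ) =ᵐ[μ] g :=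
  (memLp_top_of_lipschitzWith hg hR).coeFn_toLp

theorem norm_le_of_ae {f : Lip μ} {g : M → ℝ} {K : ℝ≥0} (hg : LipschitzWith K g)
    (h : (toLinf f : M → ℝ) =ᵐ[μ] g) {R : ℝ} (hR : ∀ x, |g x| ≤ R) (hR0 : 0 ≤ R) :
    ‖f‖ ≤ max (K : ℝ) R := by
  rw [norm_def]
  refine max_le_max ?_ ?_
  · exact ENNReal.toReal_mono ENNReal.coe_ne_top (lipNumber_le_of_lipschitzWith hg h)
  · refine Lp_top_norm_le hR0 ?_
    filter_upwards [h] with x hx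
    rw [hx]
    exact hR x

variable [μ.IsOpenPosMeasure]

/-- Continuous functions that agree almost everywhere are equal once nonempty open sets have
positive measure. All the algebraic identities for `rep` come from this. -/
theorem rep_eq_of_ae_eq {f : Lip μ} {g : M → ℝ} (hg : Continuous g)
    (h : (toLinf f : M → ℝ) =ᵐ[μ] g) : rep f = g :=
  ((continuous_rep f).ae_eq_iff_eq μ hg).1 ((rep_ae_eq f).symm.trans h)

theorem ext_rep {f g : Lip μ} (h : rep f = rep g) : f = g := by
  refine toLinf_injective (Lp.ext ?_)
  exact (rep_ae_eq f).trans (h ▸ (rep_ae_eq g).symm)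

theorem rep_mk (g : M → ℝ) {K : ℝ≥0} (hg : LipschitzWith K g) {R : ℝ} (hR : ∀ x, |g x| ≤ R) :
    rep (mk g hg hR : Lip μ) = g :=
  rep_eq_of_ae_eq hg.continuous (toLinf_mk_ae_eq g hg hR)

theorem rep_add (f g : Lip μ) : rep (f + g) = rep f + rep g := by
  refine rep_eq_of_ae_eq ((continuous_rep f).add (continuous_rep g)) ?_
  rw [map_add]
  filter_upwards [Lp.coeFn_add (toLinf f) (toLinf g), rep_ae_eq f, rep_ae_eq g] with x h1 h2 h3
  rw [h1, Pi.add_apply, h2, h3, Pi.add_apply]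

theorem rep_smul (c : ℝ) (f : Lip μ) : rep (c • f) = c • rep f := by
  refine rep_eq_of_ae_eq ((continuous_rep f).const_smul c) ?_
  rw [map_smul]
  filter_upwards [Lp.coeFn_smul c (toLinf f), rep_ae_eq f] with x h1 h2
  rw [h1, Pi.smul_apply, h2, Pi.smul_apply]

theorem rep_mul (f g : Lip μ) : rep (f * g) = rep f * rep g := by
  refine rep_eq_of_ae_eq ((continuous_rep f).mul (continuous_rep g)) ?_
  rw [toLinf_mul]
  have h : (toLinf f • toLinf g : Lp ℝ ∞ μ) =ᵐ[μ] (toLinf f : M → ℝ) • (toLinf g : M → ℝ) :=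
    Lp.coeFn_lpSMul _ _
  filter_upwards [h, rep_ae_eq f, rep_ae_eq g] with x h1 h2 h3
  rw [h1, Pi.smul_apply', h2, h3, Pi.mul_apply, smul_eq_mul]

theorem rep_sub (f g : Lip μ) : rep (f - g) = rep f - rep g := by
  have h := rep_add f ((-1 : ℝ) • g)
  rw [rep_smul, neg_one_smul, neg_one_smul, ← sub_eq_add_neg, ← sub_eq_add_neg] at h
  exact h

theorem abs_rep_le (f : Lip μ) (x : M) : |rep f x| ≤ ‖f‖ := by
  have h : ∀ᵐ x ∂μ, |rep f x| ≤ ‖f‖ := by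
    filter_upwards [rep_ae_eq f, ae_norm_le_norm (toLinf f)] with x h1 h2
    rw [← h1]
    exact h2.trans (norm_toLinf_le f)
  have hc : IsClosed {x | |rep f x| ≤ ‖f‖} :=
    isClosed_le (continuous_rep f).abs continuous_const
  have hd := (Measure.dense_of_ae h).closure_eq
  rw [hc.closure_eq] at hd
  exact hd.ge (mem_univ x)

theorem norm_le_of_rep {f : Lip μ} {K : ℝ≥0} (hK : LipschitzWith K (rep f)) {R : ℝ}
    (hR : ∀ x, |rep f x| ≤ R) (hR0 : 0 ≤ R) : ‖f‖ ≤ max (K : ℝ) R :=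
  norm_le_of_ae hK (rep_ae_eq f) hR hR0

end Lip

end Representative

/-! ### Convergence and separation in the weak* topology of `L^∞` -/

section WeakStar

variable {M : Type*} [MeasurableSpace M] {μ : Measure M}

theorem tendsto_nhds_weakStar {ι : Type*} {l : Filter ι} {u : ι → Lp ℝ ∞ μ} {k : Lp ℝ ∞ μ} :
    Tendsto u l (@nhds _ (weakStar μ) k) ↔
      ∀ g : Lp ℝ 1 μ, Tendsto (fun i => ∫ x, u i x * g x ∂μ) l (𝓝 (∫ x, k x * g x ∂μ)) := by
  simp only [nhds_iInf, tendsto_iInf, nhds_induced, tendsto_comap_iff]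
  rfl

theorem eq_of_forall_integral_mul_eq [SigmaFinite μ] {f g : Lp ℝ ∞ μ}
    (h : ∀ k : Lp ℝ 1 μ, ∫ x, f x * k x ∂μ = ∫ x, g x * k x ∂μ) : f = g := by
  refine Lp.ext ?_
  refine ae_eq_of_forall_setIntegral_eq_of_sigmaFinite ?_ ?_ ?_
  · intro s hs hμ
    have : IsFiniteMeasure (μ.restrict s) := ⟨by simpa using hμ⟩
    exact ((Lp.memLp f).restrict s).integrable le_top
  · intro s hs hμ
    have : IsFiniteMeasure (μ.restrict s) := ⟨by simpa using hμ⟩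
    exact ((Lp.memLp g).restrict s).integrable le_top
  · intro s hs hμ
    have key : ∀ f : Lp ℝ ∞ μ, ∫ x, f x * (indicatorConstLp 1 hs hμ.ne (1 : ℝ) : Lp ℝ 1 μ) x ∂μ =
        ∫ x in s, f x ∂μ := by
      intro f
      rw [← integral_indicator hs]
      refine integral_congr_ae ?_
      filter_upwards [indicatorConstLp_coeFn (p := 1) (hs := hs) (hμs := hμ.ne) (c := (1 : ℝ))]
        with x hx
      rw [hx]
      by_cases hxs : x ∈ s <;> simp [hxs]
    rw [← key, ← key, h]

end WeakStar

/-! ### The weak* topology of `Lip` and pointwise convergence -/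

section LipWeakStar

variable {M : Type*} [MetricSpace M] [MeasurableSpace M] [TopologicalSpace.SeparableSpace M]
  [OpensMeasurableSpace M] {μ : Measure M}

theorem tendsto_integral_mul_of_rep {u : ℕ → Lip μ} {f : Lip μ} {C : ℝ} (hu : ∀ k, ‖u k‖ ≤ C)
    (h : ∀ x, Tendsto (fun k => (u k).rep x) atTop (𝓝 (f.rep x))) (g : Lp ℝ 1 μ) :
    Tendsto (fun k => ∫ x, Lip.toLinf (u k) x * g x ∂μ) atTop
      (𝓝 (∫ x, Lip.toLinf f x * g x ∂μ)) := by
  refine tendsto_integral_of_dominated_convergence (fun x => C * ‖g x‖)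
    (fun k => (integrable_mul _ g).aestronglyMeasurable) ((L1.integrable_coeFn g).norm.const_mul C)
    (fun k => ?_) ?_
  · filter_upwards [ae_norm_le_norm (Lip.toLinf (u k))] with x hx
    rw [norm_mul]
    gcongr
    exact hx.trans ((Lip.norm_toLinf_le _).trans (hu k))
  · filter_upwards [ae_all_iff.2 fun k => (u k).rep_ae_eq, f.rep_ae_eq] with x h1 h2
    simp only [h1, h2]
    exact (h x).mul_const _

theorem tendsto_of_mem_lipPredual {l : Lip μ →L[ℝ] ℝ} (hl : l ∈ lipPredual μ) {u : ℕ → Lip μ}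
    {f : Lip μ} {C : ℝ} (hu : ∀ k, ‖u k‖ ≤ C)
    (h : ∀ x, Tendsto (fun k => (u k).rep x) atTop (𝓝 (f.rep x))) :
    Tendsto (fun k => l (u k)) atTop (𝓝 (l f)) := by
  -- Dividing by `D` moves the sequence and its limit into the unit ball, where `l` is continuous;
  -- adding 1 keeps `D` positive.
  set D : ℝ := max C ‖f‖ + 1 with hD
  have hD0 : 0 < D := by
    have := (norm_nonneg f).trans (le_max_right C ‖f‖)
    positivity
  have hball : ∀ g : Lip μ, ‖g‖ ≤ max C ‖f‖ → D⁻¹ • g ∈ {f : Lip μ | ‖f‖ ≤ 1} := by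
    intro g hg
    rw [mem_ofPred_eq, norm_smul, norm_inv, Real.norm_of_nonneg hD0.le, inv_mul_le_one₀ hD0]
    linarith
  have h1 : Tendsto l (@nhdsWithin _ (TopologicalSpace.induced (Lip.toLinf (μ := μ)) (weakStar μ))
      (D⁻¹ • f) {f | ‖f‖ ≤ 1}) (𝓝 (l (D⁻¹ • f))) := hl _ (hball f (le_max_right _ _))
  have h2 : Tendsto (fun k => D⁻¹ • u k) atTop
      (@nhdsWithin _ (TopologicalSpace.induced (Lip.toLinf (μ := μ)) (weakStar μ))
      (D⁻¹ • f) {f | ‖f‖ ≤ 1}) := by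
    refine tendsto_inf.2 ⟨?_, tendsto_principal.2
      (.of_forall fun k => hball _ ((hu k).trans (le_max_left _ _)))⟩
    rw [@nhds_induced _ _ (weakStar μ), tendsto_comap_iff]
    refine tendsto_nhds_weakStar.2 fun g => ?_
    have key : ∀ f : Lip μ, ∫ x, Lip.toLinf (D⁻¹ • f) x * g x ∂μ =
        D⁻¹ * ∫ x, Lip.toLinf f x * g x ∂μ := by
      intro f
      rw [← integral_const_mul, map_smul]
      refine integral_congr_ae ?_
      filter_upwards [Lp.coeFn_smul D⁻¹ (Lip.toLinf f)] with x hx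
      rw [hx, Pi.smul_apply, smul_eq_mul, mul_assoc]
    simp only [Function.comp_apply, key]
    exact (tendsto_integral_mul_of_rep hu h g).const_mul _
  have h3 := (h1.comp h2).const_mul D
  simpa [Function.comp_def, ← mul_assoc, hD0.ne'] using h3

/-- A metric derivation is continuous along norm bounded, pointwise convergent sequences. -/
theorem IsMetricDerivation.tendsto_integral_mul {δ : Lip μ →L[ℝ] Lp ℝ ∞ μ}
    (hδ : IsMetricDerivation δ) {u : ℕ → Lip μ} {f : Lip μ} {C : ℝ} (hu : ∀ k, ‖u k‖ ≤ C)
    (h : ∀ x, Tendsto (fun k => (u k).rep x) atTop (𝓝 (f.rep x))) (g : Lp ℝ 1 μ) :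
    Tendsto (fun k => ∫ x, δ (u k) x * g x ∂μ) atTop (𝓝 (∫ x, δ f x * g x ∂μ)) := by
  have h1 := continuous_weakStar_iff.1 hδ.1 g
  have h2 : Tendsto u atTop (@nhds _ (lipWeakStar μ) f) := by
    simp only [nhds_iInf, tendsto_iInf, nhds_induced, tendsto_comap_iff]
    exact fun l hl => tendsto_of_mem_lipPredual hl hu h
  exact (@Continuous.tendsto _ _ (lipWeakStar μ) _ _ h1 f).comp h2

variable [SigmaFinite μ] [μ.IsOpenPosMeasure]

/-- Members of the unit ball are 1-Lipschitz, so evaluation at `x` is, uniformly on the ball, within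
`ε / 2` of the mean over a set of finite positive measure in `ball x (ε / 2)`. Such a mean is a
weak* continuous functional. -/
theorem continuousOn_rep_apply (x : M) :
    @ContinuousOn _ _ (TopologicalSpace.induced (Lip.toLinf (μ := μ)) (weakStar μ)) _
      (fun f : Lip μ => f.rep x) {f | ‖f‖ ≤ 1} := by
  let _ : TopologicalSpace (Lip μ) := TopologicalSpace.induced (Lip.toLinf (μ := μ)) (weakStar μ)
  refine continuousOn_of_uniform_approx_of_continuousOn fun U hU => ?_
  obtain ⟨ε, hε, hεU⟩ := Metric.mem_uniformity_dist.1 hU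
  have hpos : 0 < μ (Metric.ball x (ε / 2)) := Metric.measure_ball_pos μ x (half_pos hε)
  obtain ⟨S, hS, hSb, hS0, hStop⟩ :=
    Measure.exists_subset_measure_lt_top Metric.isOpen_ball.measurableSet hpos
  set c : ℝ := (μ.real S)⁻¹ with hc
  have hreal : 0 < μ.real S := ENNReal.toReal_pos hS0.ne' hStop.ne
  set g : Lp ℝ 1 μ := indicatorConstLp 1 hS hStop.ne c with hg
  refine ⟨fun f => ∫ y, Lip.toLinf f y * g y ∂μ, ?_, fun f hf => hεU ?_⟩
  · have hw : @Continuous _ _ (weakStar μ) _ fun f : Lp ℝ ∞ μ => ∫ y, f y * g y ∂μ :=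
      continuous_weakStar_iff.1 (@continuous_id _ (weakStar μ)) g
    exact (@Continuous.comp _ _ _ _ (weakStar μ) _ _ _ hw continuous_induced_dom).continuousOn
  · have hlip : LipschitzWith 1 f.rep := Lip.lipschitzWith_rep_of_norm_le (by simpa using hf)
    have h1 : ∫ y, Lip.toLinf f y * g y ∂μ = ∫ y in S, c * f.rep y ∂μ := by
      rw [← integral_indicator hS]
      refine integral_congr_ae ?_
      filter_upwards [indicatorConstLp_coeFn (p := 1) (hs := hS) (hμs := hStop.ne) (c := c),
        f.rep_ae_eq] with y h1 h2
      rw [hg, h1, h2]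
      by_cases hy : y ∈ S <;> simp [hy, mul_comm]
    have h2 : f.rep x = ∫ y in S, c * f.rep x ∂μ := by
      rw [setIntegral_const, smul_eq_mul, hc, mul_inv_cancel_left₀ hreal.ne']
    have hfin : IsFiniteMeasure (μ.restrict S) := ⟨by simpa using hStop⟩
    have hint : Integrable (fun y => c * f.rep y) (μ.restrict S) := by
      have := UniformSpace.secondCountable_of_separable M
      exact (Integrable.of_bound f.continuous_rep.aestronglyMeasurable ‖f‖
        (.of_forall fun y => f.abs_rep_le y)).const_mul c
    beta_reduce
    rw [h1, Real.dist_eq]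
    nth_rw 1 [h2]
    rw [← integral_sub (integrable_const _) hint, ← Real.norm_eq_abs]
    refine (norm_setIntegral_le_of_norm_le_const (C := c * (ε / 2)) hStop
      fun y hy => ?_).trans_lt ?_
    · rw [← mul_sub, norm_mul, Real.norm_of_nonneg (by positivity : 0 ≤ c)]
      gcongr
      rw [← dist_eq_norm]
      refine (hlip.dist_le_mul x y).trans ?_
      rw [NNReal.coe_one, one_mul, dist_comm]
      exact (Metric.mem_ball.1 (hSb hy)).le
    · rw [hc, mul_assoc, mul_comm, mul_assoc, mul_inv_cancel₀ hreal.ne', mul_one]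
      linarith

/-- On the unit ball of `Lip(M)`, the weak* topology is metrizable, and it is the topology of
pointwise convergence. -/
theorem mem_lipPredual_of_tendsto {l : Lip μ →L[ℝ] ℝ}
    (h : ∀ (u : ℕ → Lip μ) (f : Lip μ), (∀ k, ‖u k‖ ≤ 1) → ‖f‖ ≤ 1 →
      (∀ x, Tendsto (fun k => (u k).rep x) atTop (𝓝 (f.rep x))) →
      Tendsto (fun k => l (u k)) atTop (𝓝 (l f))) : l ∈ lipPredual μ := by
  intro f hf
  rcases isEmpty_or_nonempty M with hM | hM
  · have : ∀ g : Lip μ, g = f := fun g => Lip.ext_rep (funext fun x => hM.elim x)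
    have hc : (l : Lip μ → ℝ) = fun _ => l f := funext fun g => by rw [this g]
    rw [hc]
    exact @continuousWithinAt_const _ _ (_) _ _ _ _
  set e : Lip μ → ℕ → ℝ := fun g n => g.rep (TopologicalSpace.denseSeq M n) with he
  have h1 : @nhdsWithin _ (TopologicalSpace.induced (Lip.toLinf (μ := μ)) (weakStar μ))
      f {f | ‖f‖ ≤ 1} ≤ comap e (𝓝 (e f)) ⊓ 𝓟 {f | ‖f‖ ≤ 1} := by
    refine le_inf ?_ inf_le_right
    rw [← tendsto_iff_comap, tendsto_pi_nhds]
    exact fun n => continuousOn_rep_apply _ f hf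
  refine Tendsto.mono_left ?_ h1
  -- The comparison filter is pulled back from countably many evaluations, hence countably
  -- generated, and sequences suffice. They lie in the ball only eventually, whence the shift by
  -- `N`.
  refine tendsto_of_seq_tendsto fun u hu => ?_
  rw [tendsto_inf, tendsto_principal, tendsto_comap_iff, tendsto_pi_nhds] at hu
  obtain ⟨hu1, hu2⟩ := hu
  obtain ⟨N, hN⟩ := eventually_atTop.1 hu2
  rw [← tendsto_add_atTop_iff_nat N]
  refine h (fun k => u (k + N)) f (fun k => hN _ (Nat.le_add_left _ _)) hf fun x => ?_
  rw [tendsto_add_atTop_iff_nat (f := fun k => (u k).rep x) N]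
  rw [Metric.tendsto_atTop]
  intro ε hε
  -- Since all functions in the ball are 1-Lipschitz, convergence on a dense sequence forces
  -- convergence at every point.
  obtain ⟨n, hn⟩ := (TopologicalSpace.denseRange_denseSeq M).exists_dist_lt x
    (by positivity : 0 < ε / 3)
  obtain ⟨K, hK⟩ := Metric.tendsto_atTop.1 (hu1 n) (ε / 3) (by positivity)
  refine ⟨max K N, fun k hk => ?_⟩
  have hl : ∀ g : Lip μ, ‖g‖ ≤ 1 →
      dist (g.rep x) (g.rep (TopologicalSpace.denseSeq M n)) < ε / 3 := fun g hg => by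
    have := (Lip.lipschitzWith_rep_of_norm_le (C := 1) (by simpa using hg)).dist_le_mul x
      (TopologicalSpace.denseSeq M n)
    rw [NNReal.coe_one, one_mul] at this
    exact this.trans_lt hn
  have a1 := hl (u k) (hN k ((le_max_right _ _).trans hk))
  have a2 := hl f hf
  have a3 := hK k ((le_max_left _ _).trans hk)
  rw [dist_comm] at a2
  calc dist ((u k).rep x) (f.rep x) ≤ _ := dist_triangle4 _ _ _ _
    _ < ε / 3 + ε / 3 + ε / 3 := add_lt_add (add_lt_add a1 a3) a2
    _ = ε := by ring

end LipWeakStar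

/-! ### Null sets under quasi-invariance -/

section QuasiInvariance

variable {F : Type*} [NormedAddCommGroup F] [NormedSpace ℝ F] [MeasurableSpace F] [BorelSpace F]
  {μ : Measure F} {F₀ : Submodule ℝ F}

theorem QuasiInvariant.quasiMeasurePreserving_add (h : QuasiInvariant μ F₀) {v : F} (hv : v ∈ F₀) :
    Measure.QuasiMeasurePreserving (fun x => x + v) μ μ :=
  ⟨(continuous_id.add continuous_const).measurable, (h v hv).1⟩

theorem QuasiInvariant.measure_preimage_add_eq_zero (h : QuasiInvariant μ F₀) {v : F}
    (hv : v ∈ F₀) {s : Set F} : μ ((fun x => x + v) ⁻¹' s) = 0 ↔ μ s = 0 := by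
  refine ⟨fun h0 => ?_, fun h0 => (h.quasiMeasurePreserving_add hv).preimage_null h0⟩
  have h1 := (h.quasiMeasurePreserving_add (F₀.neg_mem hv)).preimage_null h0
  simpa [← preimage_comp, Function.comp_def] using h1

variable [TopologicalSpace.SeparableSpace F]

/-- If a nonempty open set were null, so would be its translates by `F₀`. By density these cover the
space, and by the Lindelöf property countably many of them do. -/
theorem QuasiInvariant.isOpenPosMeasure (h : QuasiInvariant μ F₀) (hd : Dense (F₀ : Set F))
    (hμ : μ ≠ 0) : μ.IsOpenPosMeasure := by
  have := UniformSpace.secondCountable_of_separable F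
  refine ⟨fun U hU ⟨x, hx⟩ h0 => hμ ?_⟩
  have hcover : (⋃ v : F₀, (fun y => y + (v : F)) ⁻¹' U) = univ := by
    refine eq_univ_of_forall fun y => mem_iUnion.2 ?_
    have hO : IsOpen ((fun w => y + w) ⁻¹' U) := hU.preimage (by fun_prop)
    obtain ⟨w, hw, hwF⟩ := hd.inter_open_nonempty _ hO ⟨x - y, by simpa using hx⟩
    exact ⟨⟨w, hwF⟩, hw⟩
  obtain ⟨T, hT, hTU⟩ := TopologicalSpace.isOpen_iUnion_countable
    (fun v : F₀ => (fun y => y + (v : F)) ⁻¹' U) fun v => hU.preimage (by fun_prop)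
  rw [hcover] at hTU
  rw [← Measure.measure_univ_eq_zero, ← hTU]
  exact (measure_biUnion_null_iff hT).2 fun v _ => (h.measure_preimage_add_eq_zero v.2).2 h0

variable [SFinite μ]

/-- If almost all translates of every point by vectors in `F₀` avoid `s`, then `s` is null. -/
theorem QuasiInvariant.measure_eq_zero_of_ae_translate (h : QuasiInvariant μ F₀) {E : Type*}
    [MeasurableSpace E] {ν : Measure E} [SFinite ν] (hν : ν ≠ 0) {A : E → F} (hA : Measurable A)
    (hAF : ∀ w, A w ∈ F₀) {s : Set F} (hs : MeasurableSet s)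
    (hsν : ∀ᵐ x ∂μ, ∀ᵐ w ∂ν, x + A w ∉ s) : μ s = 0 := by
  have := UniformSpace.secondCountable_of_separable F
  have hm : MeasurableSet {z : F × E | z.1 + A z.2 ∉ s} := by
    have : Measurable fun z : F × E => z.1 + A z.2 := by fun_prop
    exact this hs.compl
  -- Fubini exchanges the quantifiers: one fixed vector `A w` then moves almost every `x` out of
  -- `s`, and quasi-invariance under this single translation applies.
  rw [Measure.ae_ae_comm hm] at hsν
  have : (ae ν).NeBot := ae_neBot.2 hν
  obtain ⟨w, hw⟩ := hsν.exists
  rw [← h.measure_preimage_add_eq_zero (hAF w)]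
  simpa [ae_iff, preimage] using hw

theorem QuasiInvariant.ae_of_ae_translate (h : QuasiInvariant μ F₀) {E : Type*}
    [MeasurableSpace E] {ν : Measure E} [SFinite ν] (hν : ν ≠ 0) {A : E → F} (hA : Measurable A)
    (hAF : ∀ w, A w ∈ F₀) {p : F → Prop} (hp : MeasurableSet {x | p x})
    (hpν : ∀ᵐ x ∂μ, ∀ᵐ w ∂ν, p (x + A w)) : ∀ᵐ x ∂μ, p x := by
  refine h.measure_eq_zero_of_ae_translate hν hA hAF hp.compl ?_
  filter_upwards [hpν] with x hx
  filter_upwards [hx] with w hw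
  exact fun h => h hw

end QuasiInvariance

/-! ### Gateaux differentiability of Lipschitz functions -/

section Gateaux

variable {F : Type*} [NormedAddCommGroup F] [NormedSpace ℝ F]

theorem lineDeriv_sub_le_of_lipschitzWith {f : F → ℝ} {K : ℝ≥0} (hf : LipschitzWith K f) {x u v : F}
    {a b : ℝ} (ha : HasLineDerivAt ℝ f a x u) (hb : HasLineDerivAt ℝ f b x v) :
    |a - b| ≤ K * ‖u - v‖ := by
  have h := (ha.tendsto_slope_zero_right.sub hb.tendsto_slope_zero_right).norm
  refine le_of_tendsto h ?_
  filter_upwards [self_mem_nhdsWithin] with t ht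
  have ht' : (0 : ℝ) < t := ht
  rw [← smul_sub, sub_sub_sub_cancel_right, norm_smul, norm_inv, Real.norm_of_nonneg ht'.le,
    inv_mul_le_iff₀ ht']
  refine (hf.norm_sub_le _ _).trans (le_of_eq ?_)
  rw [add_sub_add_left_eq_sub, ← smul_sub, norm_smul, Real.norm_of_nonneg ht'.le]
  ring

/-- The directions in which a Lipschitz function is differentiable at a point form a closed set. -/
theorem lineDifferentiableAt_of_mem_closure {f : F → ℝ} {K : ℝ≥0} (hf : LipschitzWith K f) {x : F}
    {s : Set F} (hs : ∀ v ∈ s, LineDifferentiableAt ℝ f x v) {v : F} (hv : v ∈ closure s) :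
    LineDifferentiableAt ℝ f x v := by
  obtain ⟨u, hus, hu⟩ := mem_closure_iff_seq_limit.1 hv
  have hd := fun n => (hs _ (hus n)).hasLineDerivAt
  have hcau : CauchySeq fun n => lineDeriv ℝ f x (u n) := by
    rw [Metric.cauchySeq_iff]
    intro ε hε
    obtain ⟨N, hN⟩ := Metric.cauchySeq_iff.1 hu.cauchySeq (ε / (K + 1)) (by positivity)
    refine ⟨N, fun m hm n hn => ?_⟩
    refine (lineDeriv_sub_le_of_lipschitzWith hf (hd m) (hd n)).trans_lt ?_
    have h1 := hN m hm n hn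
    rw [dist_eq_norm, lt_div_iff₀ (by positivity)] at h1
    nlinarith [norm_nonneg (u m - u n)]
  obtain ⟨a, ha⟩ := cauchySeq_tendsto_of_complete hcau
  suffices HasLineDerivAt ℝ f a x v from this.lineDifferentiableAt
  rw [hasLineDerivAt_iff_tendsto_slope_zero]
  have hlim : ∀ n, Tendsto (fun t : ℝ => t⁻¹ • (f (x + t • u n) - f x)) (𝓝[≠] 0)
      (𝓝 (lineDeriv ℝ f x (u n))) := fun n => hasLineDerivAt_iff_tendsto_slope_zero.1 (hd n)
  -- The slopes along `u n` converge to those along `v` uniformly in `t`, with error at most `K ‖u n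
  -- - v‖`, so the two limits may be interchanged.
  refine TendstoUniformlyOnFilter.tendsto_of_eventually_tendsto
    (F := fun n (t : ℝ) => t⁻¹ • (f (x + t • u n) - f x)) (p := atTop)
    (L := fun n => lineDeriv ℝ f x (u n)) ?_
    (.of_forall hlim) ha
  rw [Metric.tendstoUniformlyOnFilter_iff]
  intro ε hε
  have h1 : ∀ᶠ n in atTop, dist (u n) v < ε / (K + 1) :=
    hu.eventually (Metric.ball_mem_nhds v (by positivity))
  filter_upwards [h1.prod_mk (self_mem_nhdsWithin (a := (0 : ℝ)) (s := {0}ᶜ))] with z hz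
  have hz2 : z.2 ≠ 0 := hz.2
  rw [dist_eq_norm, ← smul_sub, sub_sub_sub_cancel_right, norm_smul, norm_inv,
    inv_mul_lt_iff₀ (norm_pos_iff.2 hz2)]
  refine (hf.norm_sub_le _ _).trans_lt ?_
  rw [add_sub_add_left_eq_sub, ← smul_sub, norm_smul]
  have h2 := hz.1
  rw [dist_comm, dist_eq_norm, lt_div_iff₀ (by positivity)] at h2
  have h3 := norm_pos_iff.2 hz2
  nlinarith [mul_lt_mul_of_pos_left h2 h3, norm_nonneg (v - u z.1),
    mul_nonneg h3.le (norm_nonneg (v - u z.1))]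

/-- The line derivative is `K`-Lipschitz in the direction, so additivity passes from the dense set
`s` to the whole space. Homogeneity always holds for line derivatives. -/
theorem exists_clm_hasLineDerivAt {f : F → ℝ} {K : ℝ≥0} (hf : LipschitzWith K f) {x : F}
    {s : Set F} (hs : Dense s) (hd : ∀ v ∈ s, LineDifferentiableAt ℝ f x v)
    (hadd : ∀ u ∈ s, ∀ v ∈ s, lineDeriv ℝ f x (u + v) = lineDeriv ℝ f x u + lineDeriv ℝ f x v) :
    ∃ L : F →L[ℝ] ℝ, ∀ v, HasLineDerivAt ℝ f (L v) x v := by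
  have hall : ∀ v, HasLineDerivAt ℝ f (lineDeriv ℝ f x v) x v := fun v =>
    (lineDifferentiableAt_of_mem_closure hf hd (hs v)).hasLineDerivAt
  have hc : Continuous fun v => lineDeriv ℝ f x v := by
    refine LipschitzWith.continuous (K := K) (LipschitzWith.of_dist_le_mul fun u v => ?_)
    rw [dist_eq_norm u v]
    exact lineDeriv_sub_le_of_lipschitzWith hf (hall u) (hall v)
  have hadd' : ∀ u v, lineDeriv ℝ f x (u + v) = lineDeriv ℝ f x u + lineDeriv ℝ f x v := by
    have h1 : Dense (s ×ˢ s) := hs.prod hs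
    have h2 : (fun z : F × F => lineDeriv ℝ f x (z.1 + z.2)) =
        fun z => lineDeriv ℝ f x z.1 + lineDeriv ℝ f x z.2 :=
      Continuous.ext_on h1 (by fun_prop) (by fun_prop) fun z hz => hadd _ hz.1 _ hz.2
    exact fun u v => congrFun h2 (u, v)
  exact ⟨⟨{ toFun := fun v => lineDeriv ℝ f x v
            map_add' := hadd'
            map_smul' := fun c v => by simp [lineDeriv_smul] }, hc⟩, hall⟩

variable [MeasurableSpace F] [BorelSpace F] [TopologicalSpace.SeparableSpace F]
  {μ : Measure F} [SFinite μ] {F₀ : Submodule ℝ F}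

/-- For every `x`, Rademacher's theorem on `ℝ × ℝ` makes `w ↦ f (x + w.1 • u + w.2 • v)`
differentiable at Lebesgue-almost every `w`. `ae_of_ae_translate` turns this into a statement at
`μ`-almost every point. -/
theorem QuasiInvariant.ae_lineDeriv_add (h : QuasiInvariant μ F₀) {f : F → ℝ} {K : ℝ≥0}
    (hf : LipschitzWith K f) {u v : F} (hu : u ∈ F₀) (hv : v ∈ F₀) :
    ∀ᵐ x ∂μ, LineDifferentiableAt ℝ f x u ∧
      lineDeriv ℝ f x (u + v) = lineDeriv ℝ f x u + lineDeriv ℝ f x v := by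
  set A : ℝ × ℝ →L[ℝ] F := (ContinuousLinearMap.fst ℝ ℝ ℝ).smulRight u +
    (ContinuousLinearMap.snd ℝ ℝ ℝ).smulRight v with hA
  have hAapp : ∀ w, A w = w.1 • u + w.2 • v := fun w => rfl
  refine h.ae_of_ae_translate (ν := (volume : Measure (ℝ × ℝ))) (NeZero.ne _)
    A.continuous.measurable (fun w => ?_) ?_ (.of_forall fun x => ?_)
  · exact F₀.add_mem (F₀.smul_mem _ hu) (F₀.smul_mem _ hv)
  · exact (measurableSet_lineDifferentiableAt hf.continuous).inter
      (measurableSet_eq_fun (measurable_lineDeriv hf.continuous)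
        ((measurable_lineDeriv hf.continuous).add (measurable_lineDeriv hf.continuous)))
  · have hlip : LipschitzWith (K * ‖A‖₊) fun w => f (x + A w) := by
      refine hf.comp ?_
      exact LipschitzWith.of_dist_le_mul fun a b => by
        rw [dist_add_left]
        exact A.lipschitz.dist_le_mul a b
    filter_upwards [hlip.ae_differentiableAt (μ := volume)] with w hw
    have key : ∀ e, HasLineDerivAt ℝ f (fderiv ℝ (fun w => f (x + A w)) w e) (x + A w) (A e) := by
      intro e
      have h1 := hw.hasFDerivAt.hasLineDerivAt e
      simpa [HasLineDerivAt, map_add, map_smul, add_assoc] using h1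
    have e1 : A (1, 0) = u := by simp [hAapp]
    have e2 : A (0, 1) = v := by simp [hAapp]
    have e3 : A ((1, 0) + (0, 1)) = u + v := by simp [hAapp]
    have k1 := key (1, 0)
    have k2 := key (0, 1)
    have k3 := key ((1, 0) + (0, 1))
    rw [e1] at k1
    rw [e2] at k2
    rw [e3, map_add] at k3
    exact ⟨k1.lineDifferentiableAt, by rw [k1.lineDeriv, k2.lineDeriv, k3.lineDeriv]⟩

/-- A Lipschitz function is Gateaux differentiable almost everywhere. -/
theorem QuasiInvariant.ae_exists_clm_hasLineDerivAt (h : QuasiInvariant μ F₀)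
    (hd : Dense (F₀ : Set F)) {f : F → ℝ} {K : ℝ≥0} (hf : LipschitzWith K f) :
    ∀ᵐ x ∂μ, ∃ L : F →L[ℝ] ℝ, ∀ v, HasLineDerivAt ℝ f (L v) x v := by
  have := UniformSpace.secondCountable_of_separable F
  obtain ⟨s, hsF, hsc, hsd⟩ := Dense.exists_countable_dense_subset hd
  have h1 : ∀ᵐ x ∂μ, ∀ u ∈ s, ∀ v ∈ s, LineDifferentiableAt ℝ f x u ∧
      lineDeriv ℝ f x (u + v) = lineDeriv ℝ f x u + lineDeriv ℝ f x v :=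
    (ae_ball_iff hsc).2 fun u hu => (ae_ball_iff hsc).2 fun v hv =>
      h.ae_lineDeriv_add hf (hsF hu) (hsF hv)
  filter_upwards [h1] with x hx
  exact exists_clm_hasLineDerivAt hf hsd (fun v hv => (hx v hv v hv).1)
    fun u hu v hv => (hx u hu v hv).2

end Gateaux

/-! ### Weak* continuity of differentiation in a fixed direction -/

section LineDerivConvergence

/-- The family is equicontinuous. This allows the later convergence statements to be checked on
dense sets of test functions, directions or fields. -/
theorem isClosed_setOf_tendsto_of_lipschitz {X ι : Type*} [PseudoMetricSpace X] {l : Filter ι}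
    {Λ : ι → X → ℝ} {Λ₀ : X → ℝ} {K : ℝ} (h : ∀ i x y, |Λ i x - Λ i y| ≤ K * dist x y)
    (h₀ : ∀ x y, |Λ₀ x - Λ₀ y| ≤ K * dist x y) :
    IsClosed {x | Tendsto (fun i => Λ i x) l (𝓝 (Λ₀ x))} := by
  have key : ∀ u : X → ℝ, (∀ x y, |u x - u y| ≤ K * dist x y) → LipschitzWith K.toNNReal u :=
    fun u hu => LipschitzWith.of_dist_le_mul fun x y => by
      rw [Real.dist_eq]
      exact (hu x y).trans (by gcongr; exact Real.le_coe_toNNReal K)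
  exact ((LipschitzWith.uniformEquicontinuous Λ K.toNNReal
    fun i => key _ (h i)).equicontinuous).isClosed_setOfPred_tendsto (key _ h₀).continuous

theorem integrable_deriv_mul {α : Type*} [MeasurableSpace α] {μ : Measure α} {w g : α → ℝ} {K : ℝ}
    (hw : AEStronglyMeasurable w μ) (hK : ∀ x, |w x| ≤ K) (hg : Integrable g μ) :
    Integrable (fun x => w x * g x) μ :=
  hg.bdd_mul hw (.of_forall hK)

/-- The derivatives of a bounded, pointwise convergent sequence of Lipschitz functions on `ℝ`
converge in the weak* topology. -/
theorem tendsto_integral_deriv_mul {u : ℕ → ℝ → ℝ} {f : ℝ → ℝ} {K : ℝ≥0} {C : ℝ}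
    (hu : ∀ k, LipschitzWith K (u k)) (hf : LipschitzWith K f) (hC : ∀ k x, |u k x| ≤ C)
    (h : ∀ x, Tendsto (fun k => u k x) atTop (𝓝 (f x))) {g : ℝ → ℝ} (hg : Integrable g) :
    Tendsto (fun k => ∫ x, deriv (u k) x * g x) atTop (𝓝 (∫ x, deriv f x * g x)) := by
  have hm : ∀ w : ℝ → ℝ, AEStronglyMeasurable (deriv w) volume :=
    fun w => (measurable_deriv w).aestronglyMeasurable
  have hb : ∀ w : ℝ → ℝ, LipschitzWith K w → ∀ x, |deriv w x| ≤ K :=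
    fun w hw x => norm_deriv_le_of_lipschitz hw
  have hclosed : IsClosed {g : Lp ℝ 1 (volume : Measure ℝ) |
      Tendsto (fun k => ∫ x, deriv (u k) x * g x) atTop (𝓝 (∫ x, deriv f x * g x))} := by
    have key : ∀ w : ℝ → ℝ, LipschitzWith K w → ∀ a b : Lp ℝ 1 (volume : Measure ℝ),
        |(∫ x, deriv w x * a x) - ∫ x, deriv w x * b x| ≤ K * dist a b := by
      intro w hw a b
      rw [← integral_sub (integrable_deriv_mul (hm w) (hb w hw) (L1.integrable_coeFn a))
        (integrable_deriv_mul (hm w) (hb w hw) (L1.integrable_coeFn b)), L1.dist_eq_integral_dist,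
        ← integral_const_mul, ← Real.norm_eq_abs]
      refine norm_integral_le_of_norm_le ?_ (.of_forall fun x => ?_)
      · simp only [dist_eq_norm]
        exact (((L1.integrable_coeFn a).sub (L1.integrable_coeFn b)).norm.const_mul _)
      · rw [← mul_sub, norm_mul, dist_eq_norm]
        gcongr
        exact hb w hw x
    exact isClosed_setOf_tendsto_of_lipschitz (fun k => key _ (hu k)) (key _ hf)
  have hdense : {g : Lp ℝ 1 (volume : Measure ℝ) | ∃ s : ℝ → ℝ, g =ᵐ[volume] s ∧
      HasCompactSupport s ∧ ContDiff ℝ ((⊤ : ℕ∞) : WithTop ℕ∞) s} ⊆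
      {g : Lp ℝ 1 (volume : Measure ℝ) |
      Tendsto (fun k => ∫ x, deriv (u k) x * g x) atTop (𝓝 (∫ x, deriv f x * g x))} := by
    rintro g ⟨s, hgs, hsc, hss⟩
    rw [mem_ofPred_eq]
    obtain ⟨D, hD⟩ := hss.lipschitzWith_of_hasCompactSupport hsc (by simp)
    have hint : Integrable (deriv s) :=
      (hss.continuous_deriv (by simp)).integrable_of_hasCompactSupport hsc.deriv
    have key : ∀ w : ℝ → ℝ, LipschitzWith K w →
        ∫ x, deriv w x * g x = ∫ x, -deriv s x * w x := by
      intro w hw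
      -- Integration by parts moves the derivative onto the smooth test function, after which
      -- pointwise convergence of the `u k` and domination are enough.
      have h1 := hw.integral_lineDeriv_mul_eq (μ := volume) hD hsc 1
      have h2 : ∀ (w : ℝ → ℝ) x, lineDeriv ℝ w x 1 = deriv w x := fun w x => by
        simp [lineDeriv, deriv_comp_const_add]
      have h3 : ∀ (w : ℝ → ℝ) x, lineDeriv ℝ w x (-1) = -deriv w x := fun w x => by
        rw [lineDeriv_neg, h2]
      simp only [h2, h3] at h1
      rw [← h1]
      refine integral_congr_ae ?_
      filter_upwards [hgs] with x hx
      rw [hx]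
    simp only [key _ (hu _), key _ hf]
    refine tendsto_integral_of_dominated_convergence (fun x => |deriv s x| * C)
      (fun k => ?_) (hint.abs.mul_const C) (fun k => .of_forall fun x => ?_)
      (.of_forall fun x => (h x).const_mul _)
    · exact (hm s).neg.mul (hu k).continuous.aestronglyMeasurable
    · rw [norm_mul, norm_neg, Real.norm_eq_abs, Real.norm_eq_abs]
      gcongr
      exact hC k x
  have hall := hclosed.closure_subset_iff.2 hdense
  have hmem := hall (Lp.dense_hasCompactSupport_contDiff (F := ℝ) (μ := (volume : Measure ℝ))
    ENNReal.one_ne_top ((memLp_one_iff_integrable.2 hg).toLp g))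
  rw [mem_ofPred_eq] at hmem
  have hcoe : ∀ w : ℝ → ℝ, ∫ x, deriv w x * ((memLp_one_iff_integrable.2 hg).toLp g : ℝ → ℝ) x =
      ∫ x, deriv w x * g x := fun w => by
    refine integral_congr_ae ?_
    filter_upwards [(memLp_one_iff_integrable.2 hg).coeFn_toLp] with x hx
    rw [hx]
  simpa only [hcoe] using hmem

variable {F : Type*} [NormedAddCommGroup F] [NormedSpace ℝ F] [MeasurableSpace F] [BorelSpace F]
  [TopologicalSpace.SeparableSpace F] {μ : Measure F} [SigmaFinite μ] {F₀ : Submodule ℝ F}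

/-- Integrals against `μ` disintegrate along the lines in a direction `v ∈ F₀`. -/
theorem QuasiInvariant.exists_integral_eq_integral_line (h : QuasiInvariant μ F₀) {v : F}
    (hv : v ∈ F₀) {g : F → ℝ} (hg : Integrable g μ) :
    ∃ ρ : F → ℝ, Integrable (fun z : F × ℝ => ρ (z.1 + z.2 • v))
        (μ.toFinite.prod (volume.restrict (Icc (0 : ℝ) 1))) ∧
      ∀ (w : F → ℝ) (K : ℝ), Measurable w → (∀ x, |w x| ≤ K) → ∫ x, w x * g x ∂μ =
        ∫ z, w (z.1 + z.2 • v) * ρ (z.1 + z.2 • v)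
          ∂(μ.toFinite.prod (volume.restrict (Icc (0 : ℝ) 1))) := by
  have := UniformSpace.secondCountable_of_separable F
  set ν₀ := μ.toFinite.prod (volume.restrict (Icc (0 : ℝ) 1)) with hν₀
  have hA : Measurable fun z : F × ℝ => z.1 + z.2 • v := by fun_prop
  -- `ν` averages a finite measure equivalent to `μ` over the translates by `t • v`, `t ∈ [0, 1]`.
  -- Quasi-invariance gives `μ ≪ ν`, so `g` times the density of `μ` can serve as `ρ`.
  set ν := ν₀.map fun z => z.1 + z.2 • v with hν
  have hac : μ ≪ ν := by
    refine Measure.AbsolutelyContinuous.mk fun s hs hs0 => ?_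
    rw [hν, Measure.map_apply hA hs, hν₀, Measure.measure_prod_null (hA hs)] at hs0
    refine h.measure_eq_zero_of_ae_translate (ν := volume.restrict (Icc (0 : ℝ) 1)) ?_
      (A := fun t => t • v) (by fun_prop) (fun t => F₀.smul_mem t hv) hs ?_
    · rw [Ne, Measure.restrict_eq_zero]
      simp
    · rw [Filter.EventuallyEq, ae_toFinite] at hs0
      filter_upwards [hs0] with x hx
      rw [ae_iff]
      simpa [preimage] using hx
  have hρ : Integrable (fun x => (μ.rnDeriv ν x).toReal * g x) ν :=
    (integrable_rnDeriv_smul_iff hac).2 hg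
  refine ⟨fun x => (μ.rnDeriv ν x).toReal * g x, hρ.comp_measurable hA, fun w K hw hK => ?_⟩
  rw [← integral_rnDeriv_smul hac]
  have hm : AEStronglyMeasurable (fun x => w x * ((μ.rnDeriv ν x).toReal * g x)) ν :=
    hw.aestronglyMeasurable.mul hρ.aestronglyMeasurable
  rw [← integral_map (f := fun x => w x * ((μ.rnDeriv ν x).toReal * g x)) hA.aemeasurable hm]
  refine integral_congr_ae (.of_forall fun x => ?_)
  simp only [smul_eq_mul]
  ring

/-- After disintegration along the lines `x + ℝ v`, the inner integrals converge by the
one-dimensional case, and dominated convergence handles the integral over `x`. -/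
theorem QuasiInvariant.tendsto_integral_lineDeriv_mul (h : QuasiInvariant μ F₀) {v : F}
    (hv : v ∈ F₀) {u : ℕ → F → ℝ} {f : F → ℝ} {K : ℝ≥0} {C : ℝ}
    (hu : ∀ k, LipschitzWith K (u k)) (hf : LipschitzWith K f) (hC : ∀ k x, |u k x| ≤ C)
    (hlim : ∀ x, Tendsto (fun k => u k x) atTop (𝓝 (f x))) {g : F → ℝ} (hg : Integrable g μ) :
    Tendsto (fun k => ∫ x, lineDeriv ℝ (u k) x v * g x ∂μ) atTop
      (𝓝 (∫ x, lineDeriv ℝ f x v * g x ∂μ)) := by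
  have := UniformSpace.secondCountable_of_separable F
  obtain ⟨ρ, hρ, hint⟩ := h.exists_integral_eq_integral_line hv hg
  have hb : ∀ w : F → ℝ, LipschitzWith K w → ∀ x, |lineDeriv ℝ w x v| ≤ K * ‖v‖ :=
    fun w hw x => norm_lineDeriv_le_of_lipschitz ℝ hw
  have hmeas : ∀ w : F → ℝ, LipschitzWith K w →
      Measurable fun z : F × ℝ => lineDeriv ℝ w (z.1 + z.2 • v) v := fun w hw =>
    (measurable_lineDeriv hw.continuous).comp (by fun_prop)
  have hi : ∀ w : F → ℝ, LipschitzWith K w → ∫ x, lineDeriv ℝ w x v * g x ∂μ =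
      ∫ x, (∫ t in Icc (0 : ℝ) 1, lineDeriv ℝ w (x + t • v) v * ρ (x + t • v)) ∂μ.toFinite := by
    intro w hw
    rw [hint _ _ (measurable_lineDeriv hw.continuous) (hb w hw)]
    exact integral_prod (fun z : F × ℝ => lineDeriv ℝ w (z.1 + z.2 • v) v * ρ (z.1 + z.2 • v))
      (integrable_deriv_mul (hmeas w hw).aestronglyMeasurable (fun z => hb w hw _) hρ)
  simp only [hi _ (hu _), hi _ hf]
  refine tendsto_integral_of_dominated_convergence
    (fun x => K * ‖v‖ * ∫ t in Icc (0 : ℝ) 1, ‖ρ (x + t • v)‖) (fun k => ?_) ?_ (fun k => ?_) ?_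
  · exact (integrable_deriv_mul (hmeas _ (hu k)).aestronglyMeasurable
      (fun z => hb _ (hu k) _) hρ).aestronglyMeasurable.integral_prod_right'
  · exact hρ.integral_norm_prod_left.const_mul _
  · filter_upwards [hρ.prod_right_ae] with x hx
    rw [← integral_const_mul]
    refine norm_integral_le_of_norm_le (hx.norm.const_mul _) (.of_forall fun t => ?_)
    rw [norm_mul]
    gcongr
    exact hb _ (hu k) _
  · filter_upwards [hρ.prod_right_ae] with x hx
    have hline : ∀ w : F → ℝ, LipschitzWith K w →
        LipschitzWith (K * ‖v‖₊) fun t : ℝ => w (x + t • v) := by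
      intro w hw
      refine hw.comp (LipschitzWith.of_dist_le_mul fun a b => ?_)
      rw [dist_add_left, dist_eq_norm, ← sub_smul, norm_smul, dist_eq_norm, mul_comm]
      rfl
    have hder : ∀ (w : F → ℝ) (t : ℝ), deriv (fun t : ℝ => w (x + t • v)) t =
        lineDeriv ℝ w (x + t • v) v := by
      intro w t
      have h1 := deriv_comp_const_add (fun t : ℝ => w (x + t • v)) t 0
      rw [add_zero] at h1
      rw [← h1, lineDeriv]
      simp only [add_smul, add_assoc]
    have hg' : Integrable ((Icc (0 : ℝ) 1).indicator fun t => ρ (x + t • v)) :=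
      (integrable_indicator_iff measurableSet_Icc).2 hx
    have key := tendsto_integral_deriv_mul (fun k => hline _ (hu k)) (hline _ hf)
      (fun k t => hC k _) (fun t => hlim _) hg'
    have hind : ∀ w : F → ℝ, ∫ t, deriv (fun t : ℝ => w (x + t • v)) t *
        (Icc (0 : ℝ) 1).indicator (fun t => ρ (x + t • v)) t =
        ∫ t in Icc (0 : ℝ) 1, lineDeriv ℝ w (x + t • v) v * ρ (x + t • v) := by
      intro w
      rw [← integral_indicator measurableSet_Icc]
      refine integral_congr_ae (.of_forall fun t => ?_)
      by_cases ht : t ∈ Icc (0 : ℝ) 1 <;>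
        simp only [indicator_of_mem, indicator_of_notMem, ht, not_false_eq_true, hder, mul_zero]
    simpa only [hind] using key

end LineDerivConvergence

/-! ### Differentiation along integrable vector fields -/

section FieldDerivative

variable {F : Type*} [NormedAddCommGroup F] [NormedSpace ℝ F] [MeasurableSpace F] [BorelSpace F]
  [TopologicalSpace.SeparableSpace F] {μ : Measure F} [SigmaFinite μ] {F₀ : Submodule ℝ F}

/-- Because the direction varies with `x`, measurability is obtained from difference quotients with
step `1 / (n + 1)`, which converge almost everywhere by Gateaux differentiability. -/
theorem QuasiInvariant.aestronglyMeasurable_lineDeriv_field (h : QuasiInvariant μ F₀)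
    (hd : Dense (F₀ : Set F)) {f : F → ℝ} {K : ℝ≥0} (hf : LipschitzWith K f) {Ψ : F → F}
    (hΨ : AEStronglyMeasurable Ψ μ) :
    AEStronglyMeasurable (fun x => lineDeriv ℝ f x (Ψ x)) μ := by
  have := UniformSpace.secondCountable_of_separable F
  refine aestronglyMeasurable_of_tendsto_ae atTop
    (f := fun (n : ℕ) x => ((1 : ℝ) / ((n : ℝ) + 1))⁻¹ •
      (f (x + ((1 : ℝ) / ((n : ℝ) + 1)) • Ψ x) - f x)) (fun n => ?_) ?_
  · have h1 : AEStronglyMeasurable (fun x => f (x + ((1 : ℝ) / ((n : ℝ) + 1)) • Ψ x)) μ :=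
      hf.continuous.comp_aestronglyMeasurable
        (continuous_id.aestronglyMeasurable.add (hΨ.const_smul ((1 : ℝ) / ((n : ℝ) + 1))))
    exact (h1.sub hf.continuous.aestronglyMeasurable).const_smul (((1 : ℝ) / ((n : ℝ) + 1))⁻¹)
  · filter_upwards [h.ae_exists_clm_hasLineDerivAt hd hf] with x ⟨L, hL⟩
    have h1 := hasLineDerivAt_iff_tendsto_slope_zero.1 (hL (Ψ x))
    rw [(hL (Ψ x)).lineDeriv]
    refine h1.comp (tendsto_nhdsWithin_iff.2 ⟨tendsto_one_div_add_atTop_nhds_zero_nat,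
      .of_forall fun n => ?_⟩)
    exact (by positivity : (0 : ℝ) < 1 / ((n : ℝ) + 1)).ne'

theorem QuasiInvariant.integrable_lineDeriv_field (h : QuasiInvariant μ F₀)
    (hd : Dense (F₀ : Set F)) {f : F → ℝ} {K : ℝ≥0} (hf : LipschitzWith K f) {Ψ : F → F}
    (hΨ : Integrable Ψ μ) : Integrable (fun x => lineDeriv ℝ f x (Ψ x)) μ :=
  (hΨ.norm.const_mul (K : ℝ)).mono' (h.aestronglyMeasurable_lineDeriv_field hd hf
    hΨ.aestronglyMeasurable) (.of_forall fun _ => norm_lineDeriv_le_of_lipschitz ℝ hf)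

theorem QuasiInvariant.abs_integral_lineDeriv_field_sub_le (h : QuasiInvariant μ F₀)
    (hd : Dense (F₀ : Set F)) {f : F → ℝ} {K : ℝ≥0} (hf : LipschitzWith K f) {Ψ Θ : F → F}
    (hΨ : Integrable Ψ μ) (hΘ : Integrable Θ μ) :
    |(∫ x, lineDeriv ℝ f x (Ψ x) ∂μ) - ∫ x, lineDeriv ℝ f x (Θ x) ∂μ| ≤
      K * ∫ x, ‖Ψ x - Θ x‖ ∂μ := by
  rw [← integral_sub (h.integrable_lineDeriv_field hd hf hΨ)
      (h.integrable_lineDeriv_field hd hf hΘ),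
    ← integral_const_mul, ← Real.norm_eq_abs]
  refine norm_integral_le_of_norm_le ((hΨ.sub hΘ).norm.const_mul _) ?_
  filter_upwards [h.ae_exists_clm_hasLineDerivAt hd hf] with x ⟨L, hL⟩
  rw [(hL _).lineDeriv, (hL _).lineDeriv]
  exact lineDeriv_sub_le_of_lipschitzWith hf (hL _) (hL _)

/-- Differentiation along an integrable vector field is continuous along bounded, pointwise
convergent sequences of Lipschitz functions. -/
theorem QuasiInvariant.tendsto_integral_lineDeriv_field (h : QuasiInvariant μ F₀)
    (hd : Dense (F₀ : Set F)) {u : ℕ → F → ℝ} {f : F → ℝ} {K : ℝ≥0} {C : ℝ}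
    (hu : ∀ k, LipschitzWith K (u k)) (hf : LipschitzWith K f) (hC : ∀ k x, |u k x| ≤ C)
    (hlim : ∀ x, Tendsto (fun k => u k x) atTop (𝓝 (f x))) {Ψ : F → F} (hΨ : Integrable Ψ μ) :
    Tendsto (fun k => ∫ x, lineDeriv ℝ (u k) x (Ψ x) ∂μ) atTop
      (𝓝 (∫ x, lineDeriv ℝ f x (Ψ x) ∂μ)) := by
  have := UniformSpace.secondCountable_of_separable F
  refine Integrable.induction (P := fun Ψ : F → F =>
    Tendsto (fun k => ∫ x, lineDeriv ℝ (u k) x (Ψ x) ∂μ) atTop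
      (𝓝 (∫ x, lineDeriv ℝ f x (Ψ x) ∂μ))) ?_ ?_ ?_ ?_ hΨ
  · intro c s hs hsμ
    -- For an indicator field the admissible values `c` form a closed set, so it suffices to treat
    -- `c ∈ F₀`, where the fixed-direction result applies.
    have hclosed : IsClosed {c : F |
        Tendsto (fun k => ∫ x, lineDeriv ℝ (u k) x (s.indicator (fun _ => c) x) ∂μ) atTop
          (𝓝 (∫ x, lineDeriv ℝ f x (s.indicator (fun _ => c) x) ∂μ))} := by
      have key : ∀ w : F → ℝ, LipschitzWith K w → ∀ a b : F,
          |(∫ x, lineDeriv ℝ w x (s.indicator (fun _ => a) x) ∂μ) -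
            ∫ x, lineDeriv ℝ w x (s.indicator (fun _ => b) x) ∂μ| ≤ K * μ.real s * dist a b := by
        intro w hw a b
        refine (h.abs_integral_lineDeriv_field_sub_le hd hw
          ((integrable_indicator_iff hs).2 (integrableOn_const hsμ.ne))
          ((integrable_indicator_iff hs).2 (integrableOn_const hsμ.ne))).trans (le_of_eq ?_)
        have : ∀ x, ‖s.indicator (fun _ => a) x - s.indicator (fun _ => b) x‖ =
            s.indicator (fun _ => ‖a - b‖) x := fun x => by
          by_cases hx : x ∈ s <;> simp [hx]
        simp only [this]
        rw [integral_indicator hs, setIntegral_const, smul_eq_mul, dist_eq_norm, mul_assoc]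
      exact isClosed_setOf_tendsto_of_lipschitz (fun k => key _ (hu k)) (key _ hf)
    have hsub : (F₀ : Set F) ⊆ {c : F |
        Tendsto (fun k => ∫ x, lineDeriv ℝ (u k) x (s.indicator (fun _ => c) x) ∂μ) atTop
          (𝓝 (∫ x, lineDeriv ℝ f x (s.indicator (fun _ => c) x) ∂μ))} := by
      intro v hv
      have h1 := h.tendsto_integral_lineDeriv_mul hv hu hf hC hlim (g := s.indicator fun _ => 1)
        ((integrable_indicator_iff hs).2 (integrableOn_const hsμ.ne))
      have h2 : ∀ (w : F → ℝ) x, lineDeriv ℝ w x v * s.indicator (fun _ => (1 : ℝ)) x =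
          lineDeriv ℝ w x (s.indicator (fun _ => v) x) := fun w x => by
        by_cases hx : x ∈ s <;> simp [hx, lineDeriv_zero]
      simp only [h2] at h1
      exact h1
    exact (hclosed.closure_subset_iff.2 hsub) (hd c)
  · intro Ψ Θ _ hΨ hΘ h1 h2
    have key : ∀ w : F → ℝ, LipschitzWith K w → ∫ x, lineDeriv ℝ w x ((Ψ + Θ) x) ∂μ =
        (∫ x, lineDeriv ℝ w x (Ψ x) ∂μ) + ∫ x, lineDeriv ℝ w x (Θ x) ∂μ := by
      intro w hw
      rw [← integral_add (h.integrable_lineDeriv_field hd hw hΨ)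
        (h.integrable_lineDeriv_field hd hw hΘ)]
      refine integral_congr_ae ?_
      filter_upwards [h.ae_exists_clm_hasLineDerivAt hd hw] with x ⟨L, hL⟩
      rw [(hL _).lineDeriv, (hL _).lineDeriv, (hL _).lineDeriv, Pi.add_apply, map_add]
    simp only [key _ (hu _), key _ hf]
    exact h1.add h2
  · have key : ∀ w : F → ℝ, LipschitzWith K w → ∀ a b : Lp F 1 μ,
        |(∫ x, lineDeriv ℝ w x (a x) ∂μ) - ∫ x, lineDeriv ℝ w x (b x) ∂μ| ≤ K * dist a b := by
      intro w hw a b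
      rw [L1.dist_eq_integral_dist]
      simp only [dist_eq_norm]
      exact h.abs_integral_lineDeriv_field_sub_le hd hw (L1.integrable_coeFn a)
        (L1.integrable_coeFn b)
    exact isClosed_setOf_tendsto_of_lipschitz (fun k => key _ (hu k)) (key _ hf)
  · intro Ψ Θ hΨΘ _ h1
    have key : ∀ w : F → ℝ, ∫ x, lineDeriv ℝ w x (Ψ x) ∂μ = ∫ x, lineDeriv ℝ w x (Θ x) ∂μ :=
      fun w => integral_congr_ae (by filter_upwards [hΨΘ] with x hx; rw [hx])
    simpa only [key] using h1

end FieldDerivative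

/-! ### The pairing of `L^1` with `L^∞` -/

section Pairing

variable {M : Type*} [MetricSpace M] [MeasurableSpace M] [TopologicalSpace.SeparableSpace M]
  [OpensMeasurableSpace M] {μ : Measure M}

/-- Integration against an integrable function, as a bounded functional on `L^∞`. -/
def pairing (g : Lp ℝ 1 μ) : Lp ℝ ∞ μ →L[ℝ] ℝ :=
  LinearMap.mkContinuous
    { toFun := fun f => ∫ x, f x * g x ∂μ
      map_add' := fun f₁ f₂ => by
        rw [← integral_add (integrable_mul _ _) (integrable_mul _ _)]
        refine integral_congr_ae ?_
        filter_upwards [Lp.coeFn_add f₁ f₂] with x hx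
        rw [hx, Pi.add_apply]
        ring
      map_smul' := fun c f => by
        rw [RingHom.id_apply, smul_eq_mul, ← integral_const_mul]
        refine integral_congr_ae ?_
        filter_upwards [Lp.coeFn_smul c f] with x hx
        rw [hx, Pi.smul_apply, smul_eq_mul]
        ring } ‖g‖ fun f => by
    change ‖∫ x, f x * g x ∂μ‖ ≤ _
    rw [L1.norm_eq_integral_norm, mul_comm, ← integral_const_mul]
    refine norm_integral_le_of_norm_le ((L1.integrable_coeFn g).norm.const_mul _) ?_
    filter_upwards [ae_norm_le_norm f] with x hx
    rw [norm_mul]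
    gcongr

theorem pairing_apply (g : Lp ℝ 1 μ) (f : Lp ℝ ∞ μ) : pairing g f = ∫ x, f x * g x ∂μ := rfl

end Pairing

theorem continuous_lipWeakStar_of_mem {M : Type*} [MetricSpace M] [MeasurableSpace M]
    [TopologicalSpace.SeparableSpace M] [OpensMeasurableSpace M] {μ : Measure M}
    {l : Lip μ →L[ℝ] ℝ} (hl : l ∈ lipPredual μ) :
    @Continuous _ _ (lipWeakStar μ) _ fun f : Lip μ => l f :=
  continuous_iInf_dom (i := l) (continuous_iInf_dom (i := hl) continuous_induced_dom)

/-! ### The derivation attached to a bounded vector field -/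

section FieldDerivation

variable {F : Type*} [NormedAddCommGroup F] [NormedSpace ℝ F] [MeasurableSpace F] [BorelSpace F]
  [TopologicalSpace.SeparableSpace F] {μ : Measure F} [SigmaFinite μ] {F₀ : Submodule ℝ F}

theorem norm_lineDeriv_rep_le (f : Lip μ) (x v : F) : ‖lineDeriv ℝ f.rep x v‖ ≤ ‖f‖ * ‖v‖ :=
  norm_lineDeriv_le_of_lipschitz ℝ (f.lipschitzWith_rep_of_norm_le (C := ‖f‖₊) le_rfl)

theorem QuasiInvariant.memLp_lineDeriv_rep (h : QuasiInvariant μ F₀) (hd : Dense (F₀ : Set F))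
    (Φ : Lp F ∞ μ) (f : Lip μ) : MemLp (fun x => lineDeriv ℝ f.rep x (Φ x)) ∞ μ := by
  refine memLp_top_of_bound (h.aestronglyMeasurable_lineDeriv_field hd f.lipschitzWith_rep
    (Lp.aestronglyMeasurable Φ)) (‖f‖ * ‖Φ‖) ?_
  filter_upwards [Lp_top_ae_norm_le Φ] with x hx
  exact (norm_lineDeriv_rep_le f x _).trans (by gcongr)

theorem QuasiInvariant.ae_hasLineDerivAt_rep (h : QuasiInvariant μ F₀) (hd : Dense (F₀ : Set F))
    (f : Lip μ) : ∀ᵐ x ∂μ, ∃ L : F →L[ℝ] ℝ, ∀ v, HasLineDerivAt ℝ f.rep (L v) x v :=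
  h.ae_exists_clm_hasLineDerivAt hd f.lipschitzWith_rep

variable [μ.IsOpenPosMeasure]

/-- Differentiation along a bounded measurable vector field. -/
def fieldDerivation (h : QuasiInvariant μ F₀) (hd : Dense (F₀ : Set F)) (Φ : Lp F ∞ μ) :
    Lip μ →L[ℝ] Lp ℝ ∞ μ :=
  LinearMap.mkContinuous
    { toFun := fun f => (h.memLp_lineDeriv_rep hd Φ f).toLp _
      map_add' := fun f g => by
        rw [← MemLp.toLp_add]
        refine MemLp.toLp_congr _ _ ?_
        filter_upwards [h.ae_hasLineDerivAt_rep hd f, h.ae_hasLineDerivAt_rep hd g]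
          with x ⟨L, hL⟩ ⟨L', hL'⟩
        rw [Pi.add_apply, (hL _).lineDeriv, (hL' _).lineDeriv, Lip.rep_add]
        exact HasLineDerivAt.lineDeriv (HasDerivAt.add (hL (Φ x)) (hL' (Φ x)))
      map_smul' := fun c f => by
        rw [RingHom.id_apply, ← MemLp.toLp_const_smul]
        refine MemLp.toLp_congr _ _ ?_
        filter_upwards [h.ae_hasLineDerivAt_rep hd f] with x ⟨L, hL⟩
        rw [Pi.smul_apply, (hL _).lineDeriv, Lip.rep_smul]
        exact HasLineDerivAt.lineDeriv (HasDerivAt.const_smul c (hL (Φ x))) } ‖Φ‖ fun f => by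
    refine Lp_top_norm_le (by positivity) ?_
    filter_upwards [(h.memLp_lineDeriv_rep hd Φ f).coeFn_toLp, Lp_top_ae_norm_le Φ] with x h1 h2
    change ‖((h.memLp_lineDeriv_rep hd Φ f).toLp _ : F → ℝ) x‖ ≤ _
    rw [h1, mul_comm]
    exact (norm_lineDeriv_rep_le f x _).trans (by gcongr)

theorem fieldDerivation_ae_eq (h : QuasiInvariant μ F₀) (hd : Dense (F₀ : Set F)) (Φ : Lp F ∞ μ)
    (f : Lip μ) : (fieldDerivation h hd Φ f : F → ℝ) =ᵐ[μ] fun x => lineDeriv ℝ f.rep x (Φ x) :=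
  (h.memLp_lineDeriv_rep hd Φ f).coeFn_toLp

theorem norm_fieldDerivation_le (h : QuasiInvariant μ F₀) (hd : Dense (F₀ : Set F))
    (Φ : Lp F ∞ μ) : ‖fieldDerivation h hd Φ‖ ≤ ‖Φ‖ :=
  LinearMap.mkContinuous_norm_le _ (norm_nonneg _) _

/-- The weight `g` is absorbed into the field: `g x • Φ x` is integrable, and differentiation along
an integrable field is continuous along bounded pointwise convergent sequences. -/
theorem pairing_comp_fieldDerivation_mem (h : QuasiInvariant μ F₀) (hd : Dense (F₀ : Set F))
    (Φ : Lp F ∞ μ) (g : Lp ℝ 1 μ) : (pairing g).comp (fieldDerivation h hd Φ) ∈ lipPredual μ := by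
  have := UniformSpace.secondCountable_of_separable F
  have hΨ : Integrable (fun x => g x • Φ x) μ := by
    refine ((L1.integrable_coeFn g).norm.mul_const ‖Φ‖).mono'
      ((L1.integrable_coeFn g).aestronglyMeasurable.smul (Lp.aestronglyMeasurable Φ)) ?_
    filter_upwards [Lp_top_ae_norm_le Φ] with x hx
    rw [norm_smul]
    gcongr
  have key : ∀ f : Lip μ, (pairing g).comp (fieldDerivation h hd Φ) f =
      ∫ x, lineDeriv ℝ f.rep x (g x • Φ x) ∂μ := by
    intro f
    rw [ContinuousLinearMap.comp_apply, pairing_apply]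
    refine integral_congr_ae ?_
    filter_upwards [fieldDerivation_ae_eq h hd Φ f] with x hx
    rw [hx, lineDeriv_smul, smul_eq_mul, mul_comm]
  refine mem_lipPredual_of_tendsto fun u f hu hf hlim => ?_
  simp only [key]
  exact h.tendsto_integral_lineDeriv_field hd (K := 1) (C := 1)
    (fun k => Lip.lipschitzWith_rep_of_norm_le (by simpa using hu k))
    (Lip.lipschitzWith_rep_of_norm_le (by simpa using hf))
    (fun k x => (Lip.abs_rep_le _ x).trans (hu k)) hlim hΨ

theorem smul_ae_eq (a f : Lp ℝ ∞ μ) : (a • f : Lp ℝ ∞ μ) =ᵐ[μ] fun x => a x * f x :=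
  Lp.coeFn_lpSMul a f

theorem isMetricDerivation_fieldDerivation (h : QuasiInvariant μ F₀) (hd : Dense (F₀ : Set F))
    (Φ : Lp F ∞ μ) : IsMetricDerivation (fieldDerivation h hd Φ) := by
  refine ⟨continuous_weakStar_iff.2 fun g => ?_, fun f g => ?_⟩
  · exact continuous_lipWeakStar_of_mem (pairing_comp_fieldDerivation_mem h hd Φ g)
  · refine Lp.ext ?_
    filter_upwards [fieldDerivation_ae_eq h hd Φ (f * g), fieldDerivation_ae_eq h hd Φ f,
      fieldDerivation_ae_eq h hd Φ g, h.ae_hasLineDerivAt_rep hd f, h.ae_hasLineDerivAt_rep hd g,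
      f.rep_ae_eq, g.rep_ae_eq, Lp.coeFn_add (Lip.toLinf f • fieldDerivation h hd Φ g : Lp ℝ ∞ μ)
        (fieldDerivation h hd Φ f • Lip.toLinf g : Lp ℝ ∞ μ),
      smul_ae_eq (Lip.toLinf f) (fieldDerivation h hd Φ g),
      smul_ae_eq (fieldDerivation h hd Φ f) (Lip.toLinf g)]
      with x h1 h2 h3 ⟨L, hL⟩ ⟨L', hL'⟩ h4 h5 h6 h7 h8
    rw [h6, Pi.add_apply, h7, h8, h1, h2, h3, h4, h5, Lip.rep_mul, (hL _).lineDeriv,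
      (hL' _).lineDeriv]
    have h9 : HasLineDerivAt ℝ (f.rep * g.rep)
        (f.rep x * L' (Φ x) + L (Φ x) * g.rep x) x (Φ x) := by
      have := HasDerivAt.mul (hL (Φ x)) (hL' (Φ x))
      rw [zero_smul, add_zero, add_comm] at this
      exact this
    exact h9.lineDeriv

/-- The map from bounded measurable vector fields to metric derivations. -/
def fieldDerivationLinearMap (h : QuasiInvariant μ F₀) (hd : Dense (F₀ : Set F)) :
    Lp F ∞ μ →ₗ[ℝ] VectorFields μ where
  toFun Φ := ⟨fieldDerivation h hd Φ, isMetricDerivation_fieldDerivation h hd Φ⟩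
  map_add' Φ Ψ := by
    refine Subtype.ext (ContinuousLinearMap.ext fun f => Lp.ext ?_)
    change (fieldDerivation h hd (Φ + Ψ) f : F → ℝ) =ᵐ[μ]
      (fieldDerivation h hd Φ f + fieldDerivation h hd Ψ f : Lp ℝ ∞ μ)
    filter_upwards [fieldDerivation_ae_eq h hd (Φ + Ψ) f, fieldDerivation_ae_eq h hd Φ f,
      fieldDerivation_ae_eq h hd Ψ f, h.ae_hasLineDerivAt_rep hd f, Lp.coeFn_add Φ Ψ,
      Lp.coeFn_add (fieldDerivation h hd Φ f) (fieldDerivation h hd Ψ f)]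
      with x h1 h2 h3 ⟨L, hL⟩ h4 h5
    rw [h5, Pi.add_apply, h1, h2, h3, h4, Pi.add_apply, (hL _).lineDeriv, (hL _).lineDeriv,
      (hL _).lineDeriv, map_add]
  map_smul' c Φ := by
    refine Subtype.ext (ContinuousLinearMap.ext fun f => Lp.ext ?_)
    change (fieldDerivation h hd (c • Φ) f : F → ℝ) =ᵐ[μ]
      (c • fieldDerivation h hd Φ f : Lp ℝ ∞ μ)
    filter_upwards [fieldDerivation_ae_eq h hd (c • Φ) f, fieldDerivation_ae_eq h hd Φ f,
      Lp.coeFn_smul c Φ, Lp.coeFn_smul c (fieldDerivation h hd Φ f)] with x h1 h2 h3 h4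
    rw [h4, Pi.smul_apply, h1, h2, h3, Pi.smul_apply, lineDeriv_smul]

theorem fieldDerivationLinearMap_apply (h : QuasiInvariant μ F₀) (hd : Dense (F₀ : Set F))
    (Φ : Lp F ∞ μ) : (fieldDerivationLinearMap h hd Φ).1 = fieldDerivation h hd Φ := rfl

theorem fieldDerivationLinearMap_smul (h : QuasiInvariant μ F₀) (hd : Dense (F₀ : Set F))
    (a : Lp ℝ ∞ μ) (Φ : Lp F ∞ μ) : fieldDerivationLinearMap h hd (a • Φ : Lp F ∞ μ) =
      a • fieldDerivationLinearMap h hd Φ := by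
  refine Subtype.ext (ContinuousLinearMap.ext fun f => Lp.ext ?_)
  rw [vectorFields_smul_apply, fieldDerivationLinearMap_apply, fieldDerivationLinearMap_apply]
  have h0 : (a • Φ : Lp F ∞ μ) =ᵐ[μ] (a : F → ℝ) • (Φ : F → F) := Lp.coeFn_lpSMul a Φ
  filter_upwards [h0, fieldDerivation_ae_eq h hd (a • Φ : Lp F ∞ μ) f,
    fieldDerivation_ae_eq h hd Φ f, smul_ae_eq a (fieldDerivation h hd Φ f)] with x h1 h2 h3 h4
  rw [h4, h2, h3, h1, Pi.smul_apply', lineDeriv_smul, smul_eq_mul]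

/-- The quotients are bounded by `‖f‖ * ‖v‖` and converge almost everywhere, so dominated
convergence against each `g` in `L^1` applies. -/
theorem isGeneratorValue_fieldDerivation (h : QuasiInvariant μ F₀) (hd : Dense (F₀ : Set F))
    (v : F₀) (f : Lip μ) : IsGeneratorValue h v (Lip.toLinf f)
      (fieldDerivation h hd (constField μ (v : F)) f) := by
  refine tendsto_nhds_weakStar.2 fun g => ?_
  have hlip : LipschitzWith ‖f‖₊ f.rep := f.lipschitzWith_rep_of_norm_le le_rfl
  have htr : ∀ t : ℝ, ((t⁻¹ • (Lip.toLinf f - translate h (t • v) (Lip.toLinf f)) : Lp ℝ ∞ μ) :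
      F → ℝ) =ᵐ[μ] fun x => t⁻¹ * (f.rep x - f.rep (x - t • (v : F))) := by
    intro t
    have hq := (h.quasiMeasurePreserving_sub (t • v)).ae f.rep_ae_eq
    have ht : (translate h (t • v) (Lip.toLinf f) : F → ℝ) =ᵐ[μ]
        fun x => Lip.toLinf f (x - ((t • v : F₀) : F)) := MemLp.coeFn_toLp _
    filter_upwards [Lp.coeFn_smul t⁻¹ (Lip.toLinf f - translate h (t • v) (Lip.toLinf f)),
      Lp.coeFn_sub (Lip.toLinf f) (translate h (t • v) (Lip.toLinf f)), ht, hq, f.rep_ae_eq]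
      with x h1 h2 h3 h4 h5
    rw [h1, Pi.smul_apply, h2, Pi.sub_apply, h3, h4, h5, smul_eq_mul]
    rfl
  have hint : ∀ t : ℝ, ∫ x, (t⁻¹ • (Lip.toLinf f - translate h (t • v) (Lip.toLinf f)) :
      Lp ℝ ∞ μ) x * g x ∂μ = ∫ x, t⁻¹ * (f.rep x - f.rep (x - t • (v : F))) * g x ∂μ := by
    intro t
    refine integral_congr_ae ?_
    filter_upwards [htr t] with x hx
    rw [hx]
  simp only [hint]
  refine tendsto_integral_filter_of_dominated_convergence (fun x => ‖f‖ * ‖(v : F)‖ * ‖g x‖)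
    (.of_forall fun t => ?_) ?_ ((L1.integrable_coeFn g).norm.const_mul _) ?_
  · refine (integrable_mul (t⁻¹ • (Lip.toLinf f - translate h (t • v) (Lip.toLinf f)) :
      Lp ℝ ∞ μ) g).aestronglyMeasurable.congr ?_
    filter_upwards [htr t] with x hx
    rw [hx]
  · filter_upwards [self_mem_nhdsWithin] with t ht
    have ht0 : 0 < ‖t‖ := norm_pos_iff.2 ht
    refine .of_forall fun x => ?_
    rw [norm_mul, norm_mul, norm_inv]
    refine mul_le_mul_of_nonneg_right ?_ (norm_nonneg _)
    rw [inv_mul_le_iff₀ ht0]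
    refine (hlip.norm_sub_le _ _).trans (le_of_eq ?_)
    rw [sub_sub_cancel, norm_smul, coe_nnnorm]
    ring
  · have hv : (constField μ (v : F) : F → F) =ᵐ[μ] fun _ => (v : F) := MemLp.coeFn_toLp _
    filter_upwards [fieldDerivation_ae_eq h hd (constField μ (v : F)) f, hv,
      h.ae_hasLineDerivAt_rep hd f] with x h1 h2 ⟨L, hL⟩
    rw [h1, h2, (hL _).lineDeriv]
    -- The backward quotient along `v` is minus the slope in direction `-v`; linearity of `L`
    -- identifies its limit as `L v`.
    have h3 := (hasLineDerivAt_iff_tendsto_slope_zero.1 (hL (-(v : F)))).neg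
    rw [map_neg, neg_neg] at h3
    refine (h3.congr fun t => ?_).mul_const _
    rw [smul_neg, ← sub_eq_add_neg, smul_eq_mul]
    ring

end FieldDerivation

/-! ### Truncation of real-valued functions -/

section Clamp

/-- Truncation of a real number to `[-R, R]`. -/
def clamp (R t : ℝ) : ℝ := max (-R) (min R t)

theorem abs_clamp_le {R : ℝ} (hR : 0 ≤ R) (t : ℝ) : |clamp R t| ≤ R :=
  abs_le.2 ⟨le_max_left _ _, max_le (by linarith) (min_le_left _ _)⟩

theorem clamp_of_abs_le {R t : ℝ} (h : |t| ≤ R) : clamp R t = t := by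
  rw [clamp, min_eq_right (abs_le.1 h).2, max_eq_right (abs_le.1 h).1]

theorem clamp_mono (R : ℝ) : Monotone (clamp R) :=
  fun _ _ h => max_le_max le_rfl (min_le_min le_rfl h)

theorem lipschitzWith_clamp (R : ℝ) : LipschitzWith 1 (clamp R) :=
  (LipschitzWith.id.const_min R).const_max (-R)

theorem lipschitzWith_clamp_comp {M : Type*} [PseudoMetricSpace M] {g : M → ℝ} {K : ℝ≥0}
    (hg : LipschitzWith K g) (R : ℝ) : LipschitzWith K fun x => clamp R (g x) := by
  simpa [Function.comp_def] using (lipschitzWith_clamp R).comp hg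

end Clamp

/-! ### Locality of metric derivations -/

section Locality

variable {M : Type*} [MetricSpace M] [MeasurableSpace M] [TopologicalSpace.SeparableSpace M]
  [OpensMeasurableSpace M] {μ : Measure M}

theorem Lip.norm_mk_le (g : M → ℝ) {K : ℝ≥0} (hg : LipschitzWith K g) {R : ℝ}
    (hR : ∀ x, |g x| ≤ R) (hR0 : 0 ≤ R) : ‖(Lip.mk g hg hR : Lip μ)‖ ≤ max (K : ℝ) R :=
  Lip.norm_le_of_ae hg (Lip.toLinf_mk_ae_eq g hg hR) hR hR0

/-- The truncation of a Lipschitz function to `[-R, R]`, as an element of `Lip(M)`. -/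
def clampLip (R : ℝ≥0) (g : M → ℝ) {K : ℝ≥0} (hg : LipschitzWith K g) : Lip μ :=
  Lip.mk (fun x => clamp R (g x)) (lipschitzWith_clamp_comp hg R) fun _ => abs_clamp_le R.2 _

variable [μ.IsOpenPosMeasure]

theorem rep_clampLip (R : ℝ≥0) (g : M → ℝ) {K : ℝ≥0} (hg : LipschitzWith K g) :
    (clampLip R g hg : Lip μ).rep = fun x => clamp R (g x) := Lip.rep_mk _ _ _

theorem norm_clampLip_le (R : ℝ≥0) (g : M → ℝ) {K : ℝ≥0} (hg : LipschitzWith K g) :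
    ‖(clampLip R g hg : Lip μ)‖ ≤ max (K : ℝ) R :=
  Lip.norm_mk_le _ _ _ R.2

variable {δ : Lip μ →L[ℝ] Lp ℝ ∞ μ}

theorem IsMetricDerivation.mul_ae_eq (hδ : IsMetricDerivation δ) (f g : Lip μ) :
    ∀ᵐ x ∂μ, δ (f * g) x = f.rep x * δ g x + δ f x * g.rep x := by
  have key : ∀ u v : Lp ℝ ∞ μ, (u • v : Lp ℝ ∞ μ) =ᵐ[μ] (u : M → ℝ) • (v : M → ℝ) :=
    fun u v => Lp.coeFn_lpSMul u v
  rw [hδ.2]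
  filter_upwards [Lp.coeFn_add (Lip.toLinf f • δ g : Lp ℝ ∞ μ) (δ f • Lip.toLinf g : Lp ℝ ∞ μ),
    key (Lip.toLinf f) (δ g), key (δ f) (Lip.toLinf g), f.rep_ae_eq, g.rep_ae_eq]
    with x h1 h2 h3 h4 h5
  rw [h1, Pi.add_apply, h2, h3, Pi.smul_apply', Pi.smul_apply', h4, h5, smul_eq_mul, smul_eq_mul]

theorem map_add_ae_eq (δ : Lip μ →L[ℝ] Lp ℝ ∞ μ) (f g : Lip μ) :
    ∀ᵐ x ∂μ, δ (f + g) x = δ f x + δ g x := by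
  rw [map_add]
  exact Lp.coeFn_add _ _

theorem map_sub_ae_eq (δ : Lip μ →L[ℝ] Lp ℝ ∞ μ) (f g : Lip μ) :
    ∀ᵐ x ∂μ, δ (f - g) x = δ f x - δ g x := by
  rw [map_sub]
  exact Lp.coeFn_sub _ _

theorem map_smul_ae_eq (δ : Lip μ →L[ℝ] Lp ℝ ∞ μ) (c : ℝ) (f : Lip μ) :
    ∀ᵐ x ∂μ, δ (c • f) x = c * δ f x := by
  rw [map_smul]
  exact Lp.coeFn_smul _ _

/-- Since `f * f = c • f`, the product rule gives `2 c δ f = c δ f`. For `c = 0` linearity suffices.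
-/
theorem IsMetricDerivation.const_ae_eq_zero (hδ : IsMetricDerivation δ) {f : Lip μ} {c : ℝ}
    (hf : ∀ x, f.rep x = c) : ∀ᵐ x ∂μ, δ f x = 0 := by
  rcases eq_or_ne c 0 with rfl | hc
  · have h0 : f = 0 := by
      refine Lip.ext_rep (funext fun x => ?_)
      have h1 := Lip.rep_smul 0 f
      rw [zero_smul, zero_smul] at h1
      rw [hf, h1, Pi.zero_apply]
    rw [h0, map_zero]
    exact Lp.coeFn_zero _ _ _
  · have h1 : f * f = c • f := Lip.ext_rep (funext fun x => by
      rw [Lip.rep_mul, Lip.rep_smul, Pi.mul_apply, Pi.smul_apply, hf, smul_eq_mul])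
    filter_upwards [hδ.mul_ae_eq f f, map_smul_ae_eq δ c f] with x h2 h3
    rw [h1, h3, hf] at h2
    have : c * δ f x = 0 := by linarith
    exact (mul_eq_zero.1 this).resolve_left hc

/-- This is the reverse triangle inequality for the complex numbers `a + ε i` and `b + ε i`. -/
theorem abs_sqrt_sq_add_sub_le (ε a b : ℝ) :
    |√(a ^ 2 + ε ^ 2) - √(b ^ 2 + ε ^ 2)| ≤ |a - b| := by
  have h := abs_norm_sub_norm_le (a + ε * Complex.I) (b + ε * Complex.I)
  rw [Complex.norm_add_mul_I, Complex.norm_add_mul_I, add_sub_add_right_eq_sub,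
    ← Complex.ofReal_sub, Complex.norm_real] at h
  exact h

/-- A Lipschitz regularization of `|f|`. -/
def regAbs (ε : ℝ) (f : Lip μ) : Lip μ :=
  Lip.mk (fun x => √(f.rep x ^ 2 + ε ^ 2)) (K := ‖f‖₊) (R := ‖f‖ + |ε|)
    (LipschitzWith.of_dist_le_mul fun x y =>
      (abs_sqrt_sq_add_sub_le ε _ _).trans
        ((f.lipschitzWith_rep_of_norm_le (C := ‖f‖₊) le_rfl).dist_le_mul x y))
    fun x => by
      rw [abs_of_nonneg (Real.sqrt_nonneg _)]
      refine Real.sqrt_le_iff.2 ⟨by positivity, ?_⟩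
      have h1 : f.rep x ^ 2 ≤ ‖f‖ ^ 2 := sq_le_sq.2 (by
        rw [abs_of_nonneg (norm_nonneg f)]; exact f.abs_rep_le x)
      nlinarith [sq_abs ε, mul_nonneg (norm_nonneg f) (abs_nonneg ε)]

theorem rep_regAbs (ε : ℝ) (f : Lip μ) : (regAbs ε f).rep = fun x => √(f.rep x ^ 2 + ε ^ 2) :=
  Lip.rep_mk _ _ _

theorem norm_regAbs_le (ε : ℝ) (f : Lip μ) : ‖regAbs ε f‖ ≤ ‖f‖ + |ε| := by
  refine (Lip.norm_mk_le _ _ _ (by positivity)).trans (max_le ?_ le_rfl)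
  rw [coe_nnnorm]
  linarith [abs_nonneg ε]

/-- With `r = regAbs ε f`, the function `r * r - f * f` is the constant `ε ^ 2`, so `2 r δ r = 2 f δ
f`; division by `r > 0` is allowed. -/
theorem IsMetricDerivation.regAbs_ae_eq (hδ : IsMetricDerivation δ) {ε : ℝ} (hε : ε ≠ 0)
    (f : Lip μ) : ∀ᵐ x ∂μ, δ (regAbs ε f) x = f.rep x / √(f.rep x ^ 2 + ε ^ 2) * δ f x := by
  have hc : ∀ x, (regAbs ε f * regAbs ε f - f * f).rep x = ε ^ 2 := fun x => by
    rw [Lip.rep_sub, Pi.sub_apply, Lip.rep_mul, Lip.rep_mul, Pi.mul_apply, Pi.mul_apply, rep_regAbs,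
      Real.mul_self_sqrt (by positivity)]
    ring
  filter_upwards [hδ.mul_ae_eq (regAbs ε f) (regAbs ε f), hδ.mul_ae_eq f f,
    hδ.const_ae_eq_zero hc, map_sub_ae_eq δ (regAbs ε f * regAbs ε f) (f * f)] with x h1 h2 h3 h4
  rw [h3, h1, h2, rep_regAbs] at h4
  have hpos : 0 < √(f.rep x ^ 2 + ε ^ 2) := Real.sqrt_pos.2 (by positivity)
  field_simp
  linarith

theorem tendsto_div_sqrt_sq_add (t : ℝ) :
    Tendsto (fun k : ℕ => t / √(t ^ 2 + (1 / ((k : ℝ) + 1)) ^ 2)) atTop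
      (𝓝 (SignType.sign t : ℝ)) := by
  rcases eq_or_ne t 0 with rfl | ht
  · simp
  have h1 : Tendsto (fun k : ℕ => t / √(t ^ 2 + (1 / ((k : ℝ) + 1)) ^ 2)) atTop
      (𝓝 (t / √(t ^ 2 + 0 ^ 2))) := by
    refine Tendsto.div tendsto_const_nhds ?_ ?_
    · exact (tendsto_const_nhds.add (tendsto_one_div_add_atTop_nhds_zero_nat.pow 2)).sqrt
    · positivity
  have h2 : t / √(t ^ 2 + 0 ^ 2) = (SignType.sign t : ℝ) := by
    rw [zero_pow two_ne_zero, add_zero, Real.sqrt_sq_eq_abs, div_eq_iff (abs_ne_zero.2 ht),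
      sign_mul_abs]
  rwa [h2] at h1

variable [SigmaFinite μ]

/-- Let `ε → 0` in `regAbs_ae_eq`: the left side converges weak* by continuity of `δ`, while on the
right the coefficients tend to the sign of `f`, which is `0` at zeros. -/
theorem IsMetricDerivation.abs_ae_eq (hδ : IsMetricDerivation δ) {f a : Lip μ}
    (ha : ∀ x, a.rep x = |f.rep x|) :
    ∀ᵐ x ∂μ, δ a x = (SignType.sign (f.rep x) : ℝ) * δ f x := by
  have := UniformSpace.secondCountable_of_separable M
  have hmem : MemLp (fun x => (SignType.sign (f.rep x) : ℝ) * δ f x) ∞ μ := by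
    refine memLp_top_of_bound ?_ ‖δ f‖ ?_
    · refine aestronglyMeasurable_of_tendsto_ae atTop
        (f := fun (k : ℕ) x => f.rep x / √(f.rep x ^ 2 + (1 / ((k : ℝ) + 1)) ^ 2) * δ f x)
        (fun k => ?_) (.of_forall fun x => (tendsto_div_sqrt_sq_add _).mul_const _)
      have hm := f.continuous_rep.measurable
      exact ((hm.div ((hm.pow_const 2).add_const _).sqrt).aestronglyMeasurable).mul
        (Lp.aestronglyMeasurable _)
    · filter_upwards [ae_norm_le_norm (δ f)] with x hx
      rw [norm_mul]
      refine (mul_le_of_le_one_left (norm_nonneg _) ?_).trans hx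
      rcases lt_trichotomy (f.rep x) 0 with h | h | h <;> simp [h]
  suffices δ a = hmem.toLp _ by
    rw [this]
    exact hmem.coeFn_toLp
  refine eq_of_forall_integral_mul_eq fun g => ?_
  have hε : ∀ k : ℕ, |(1 : ℝ) / ((k : ℝ) + 1)| ≤ 1 := fun k => by
    rw [abs_of_nonneg (by positivity), div_le_one (by positivity)]
    linarith [(Nat.cast_nonneg k : (0 : ℝ) ≤ k)]
  have h1 := hδ.tendsto_integral_mul (u := fun k : ℕ => regAbs (1 / ((k : ℝ) + 1)) f) (f := a)
    (C := ‖f‖ + 1) (fun k => (norm_regAbs_le _ f).trans (by linarith [hε k])) (fun x => by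
      simp only [rep_regAbs]
      rw [ha, ← Real.sqrt_sq_eq_abs]
      have := (tendsto_const_nhds (x := f.rep x ^ 2)).add
        (tendsto_one_div_add_atTop_nhds_zero_nat (𝕜 := ℝ).pow 2)
      rw [zero_pow two_ne_zero, add_zero] at this
      exact this.sqrt) g
  refine tendsto_nhds_unique h1 ?_
  refine tendsto_integral_of_dominated_convergence (fun x => ‖δ f‖ * ‖g x‖)
    (fun k => (integrable_mul _ g).aestronglyMeasurable)
    ((L1.integrable_coeFn g).norm.const_mul _) (fun k => ?_) ?_
  · filter_upwards [hδ.regAbs_ae_eq (ε := 1 / ((k : ℝ) + 1)) (by positivity) f,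
      ae_norm_le_norm (δ f)] with x h1 h2
    rw [h1, norm_mul, norm_mul]
    refine mul_le_mul_of_nonneg_right ((mul_le_of_le_one_left (norm_nonneg _) ?_).trans h2)
      (norm_nonneg _)
    rw [norm_div, Real.norm_eq_abs, Real.norm_of_nonneg (Real.sqrt_nonneg _)]
    refine div_le_one_of_le₀ ?_ (Real.sqrt_nonneg _)
    rw [← Real.sqrt_sq_eq_abs]
    exact Real.sqrt_le_sqrt (by nlinarith [sq_nonneg ((1 : ℝ) / ((k : ℝ) + 1))])
  · filter_upwards [ae_all_iff.2 fun k : ℕ =>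
      hδ.regAbs_ae_eq (ε := 1 / ((k : ℝ) + 1)) (by positivity) f, hmem.coeFn_toLp] with x h1 h2
    simp only [h1, h2]
    exact ((tendsto_div_sqrt_sq_add _).mul_const _).mul_const _

/-- `|f|`, as an element of `Lip(M)`. -/
def absLip (f : Lip μ) : Lip μ := regAbs 0 f

theorem rep_absLip (f : Lip μ) (x : M) : (absLip f).rep x = |f.rep x| := by
  rw [absLip, rep_regAbs, ← Real.sqrt_sq_eq_abs]
  simp

/-- Metric derivations are local. -/
theorem IsMetricDerivation.ae_eq_zero_of_rep_eq_zero (hδ : IsMetricDerivation δ) (f : Lip μ) :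
    ∀ᵐ x ∂μ, f.rep x = 0 → δ f x = 0 := by
  -- Both `p` and `|f|` are absolute values, of `p` itself and of `f`. Where `f = 0` their sign
  -- factors vanish, so `δ p = δ |f| = 0` there and `δ f` is the difference.
  set p : Lip μ := f + absLip f with hp
  have hprep : ∀ x, p.rep x = f.rep x + |f.rep x| := fun x => by
    rw [hp, Lip.rep_add, Pi.add_apply, rep_absLip]
  have hpabs : ∀ x, p.rep x = |p.rep x| := fun x => by
    rw [abs_of_nonneg]
    rw [hprep]
    linarith [neg_abs_le (f.rep x)]
  filter_upwards [hδ.abs_ae_eq (rep_absLip f), hδ.abs_ae_eq hpabs, map_add_ae_eq δ f (absLip f)]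
    with x h1 h2 h3 h0
  have hp0 : p.rep x = 0 := by rw [hprep, h0]; simp
  rw [hp0] at h2
  rw [h0] at h1
  rw [← hp] at h3
  simp only [sign_zero, SignType.coe_zero, zero_mul] at h1 h2
  rw [h1, h2] at h3
  linarith

theorem IsMetricDerivation.ae_eq_of_rep_eq (hδ : IsMetricDerivation δ) (f g : Lip μ) :
    ∀ᵐ x ∂μ, f.rep x = g.rep x → δ f x = δ g x := by
  filter_upwards [hδ.ae_eq_zero_of_rep_eq_zero (f - g), map_sub_ae_eq δ f g] with x h1 h2 h3
  rw [h2, Lip.rep_sub, Pi.sub_apply, h3, sub_self] at h1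
  exact sub_eq_zero.1 (h1 rfl)

/-- The operator norm alone would also involve the supremum of `|f|`. Subtracting integer multiples
of `K` and truncating at `K` gives countably many elements of norm at most `K`; at each point one of
them differs from `f` by a constant, and locality compares the derivatives. -/
theorem IsMetricDerivation.ae_abs_le (hδ : IsMetricDerivation δ) {f : Lip μ} {K : ℝ≥0}
    (hf : LipschitzWith K f.rep) : ∀ᵐ x ∂μ, |δ f x| ≤ ‖δ‖ * K := by
  rcases eq_or_ne K 0 with rfl | hK
  · rcases isEmpty_or_nonempty M with hM | ⟨⟨x₀⟩⟩
    · exact .of_forall fun x => hM.elim x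
    have hconst : ∀ x, f.rep x = f.rep x₀ := fun x => by
      have := hf.dist_le_mul x x₀
      rw [NNReal.coe_zero, zero_mul] at this
      exact dist_le_zero.1 this
    filter_upwards [hδ.const_ae_eq_zero hconst] with x hx
    simp [hx]
  have hK0 : (0 : ℝ) < K := by positivity
  have hsub : ∀ j : ℤ, LipschitzWith K fun x => f.rep x - j * K := fun j => by
    simpa using hf.sub (LipschitzWith.const (j * K : ℝ))
  set p : ℤ → Lip μ := fun j => clampLip K (fun x => f.rep x - j * K) (hsub j) with hp
  set c : ℤ → Lip μ := fun j => Lip.mk (fun _ => (j * K : ℝ)) (LipschitzWith.const _)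
    (R := |(j * K : ℝ)|) fun _ => le_rfl with hc
  have hcrep : ∀ j x, (c j).rep x = j * K := fun j x => by rw [hc, Lip.rep_mk]
  filter_upwards [ae_all_iff.2 fun j => hδ.ae_eq_of_rep_eq f (p j + c j),
    ae_all_iff.2 fun j => map_add_ae_eq δ (p j) (c j),
    ae_all_iff.2 fun j => hδ.const_ae_eq_zero (hcrep j),
    ae_all_iff.2 fun j => ae_norm_le_norm (δ (p j))] with x h1 h2 h3 h4
  set j : ℤ := ⌊f.rep x / K⌋ with hj
  have hclose : |f.rep x - j * K| ≤ K := by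
    have a1 := Int.floor_le (f.rep x / K)
    have a2 := Int.lt_floor_add_one (f.rep x / K)
    rw [← hj, le_div_iff₀ hK0] at a1
    rw [← hj, div_lt_iff₀ hK0] at a2
    rw [abs_le]
    constructor <;> nlinarith
  have heq : f.rep x = (p j + c j).rep x := by
    simp only [Lip.rep_add, Pi.add_apply, hcrep, hp, rep_clampLip, clamp_of_abs_le hclose]
    ring
  rw [h1 j heq, h2, h3, add_zero]
  refine (h4 j).trans ((δ.le_opNorm _).trans ?_)
  gcongr
  exact (norm_clampLip_le K _ (hsub j)).trans (by simp)

end Locality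

/-! ### The lattice of functions annihilated by a derivation -/

section KillsOn

variable {M : Type*} [MetricSpace M] [MeasurableSpace M] [TopologicalSpace.SeparableSpace M]
  [OpensMeasurableSpace M] {μ : Measure M}

/-- The function `g` is bounded and Lipschitz, and `δ` annihilates it almost everywhere on `A`. -/
def KillsOn (δ : Lip μ →L[ℝ] Lp ℝ ∞ μ) (A : Set M) (g : M → ℝ) : Prop :=
  ∃ f : Lip μ, f.rep = g ∧ ∀ᵐ x ∂μ, x ∈ A → δ f x = 0

variable [μ.IsOpenPosMeasure] {δ : Lip μ →L[ℝ] Lp ℝ ∞ μ} {A : Set M} {g₁ g₂ : M → ℝ}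

theorem KillsOn.add (h₁ : KillsOn δ A g₁) (h₂ : KillsOn δ A g₂) :
    KillsOn δ A fun x => g₁ x + g₂ x := by
  obtain ⟨f₁, rfl, h₁⟩ := h₁
  obtain ⟨f₂, rfl, h₂⟩ := h₂
  refine ⟨f₁ + f₂, Lip.rep_add _ _, ?_⟩
  filter_upwards [h₁, h₂, map_add_ae_eq δ f₁ f₂] with x a b c hx
  rw [c, a hx, b hx, add_zero]

theorem KillsOn.const_mul (c : ℝ) (h₁ : KillsOn δ A g₁) : KillsOn δ A fun x => c * g₁ x := by
  obtain ⟨f₁, rfl, h₁⟩ := h₁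
  refine ⟨c • f₁, Lip.rep_smul _ _, ?_⟩
  filter_upwards [h₁, map_smul_ae_eq δ c f₁] with x a b hx
  rw [b, a hx, mul_zero]

theorem IsMetricDerivation.killsOn_const (hδ : IsMetricDerivation δ) (A : Set M) (c : ℝ) :
    KillsOn δ A fun _ => c := by
  refine ⟨Lip.mk (fun _ => c) (LipschitzWith.const c) (R := |c|) fun _ => le_rfl,
    Lip.rep_mk _ _ _, ?_⟩
  filter_upwards [hδ.const_ae_eq_zero (c := c) fun x => by rw [Lip.rep_mk]] with x hx _
  exact hx

variable [SigmaFinite μ]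

theorem IsMetricDerivation.killsOn_abs (hδ : IsMetricDerivation δ) (h₁ : KillsOn δ A g₁) :
    KillsOn δ A fun x => |g₁ x| := by
  obtain ⟨f₁, rfl, h₁⟩ := h₁
  refine ⟨absLip f₁, funext fun x => rep_absLip _ _, ?_⟩
  filter_upwards [h₁, hδ.abs_ae_eq (rep_absLip f₁)] with x a b hx
  rw [b, a hx, mul_zero]

theorem IsMetricDerivation.killsOn_sup (hδ : IsMetricDerivation δ) (h₁ : KillsOn δ A g₁)
    (h₂ : KillsOn δ A g₂) : KillsOn δ A (g₁ ⊔ g₂) := by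
  have h := ((h₁.add h₂).add (hδ.killsOn_abs (h₁.add (h₂.const_mul (-1))))).const_mul 2⁻¹
  convert h using 1
  funext x
  rw [Pi.sup_apply, neg_one_mul, ← sub_eq_add_neg]
  exact sup_eq_half_smul_add_add_abs_sub' ℝ (g₁ x) (g₂ x) |>.trans
    (by rw [abs_sub_comm, smul_eq_mul])

theorem IsMetricDerivation.killsOn_inf (hδ : IsMetricDerivation δ) (h₁ : KillsOn δ A g₁)
    (h₂ : KillsOn δ A g₂) : KillsOn δ A (g₁ ⊓ g₂) := by
  have h := (hδ.killsOn_sup (h₁.const_mul (-1)) (h₂.const_mul (-1))).const_mul (-1)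
  convert h using 1
  funext x
  rw [Pi.sup_apply, Pi.inf_apply, neg_one_mul, neg_one_mul, neg_one_mul]
  rw [max_neg_neg, neg_neg]

theorem IsMetricDerivation.killsOn_clamp (hδ : IsMetricDerivation δ) (R : ℝ)
    (h₁ : KillsOn δ A g₁) : KillsOn δ A fun x => clamp R (g₁ x) :=
  hδ.killsOn_sup (hδ.killsOn_const A (-R)) (hδ.killsOn_inf (hδ.killsOn_const A R) h₁)

theorem IsMetricDerivation.killsOn_congr (hδ : IsMetricDerivation δ) (h₁ : KillsOn δ A g₁)
    {f : Lip μ} (hf : ∀ x ∈ A, f.rep x = g₁ x) : ∀ᵐ x ∂μ, x ∈ A → δ f x = 0 := by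
  obtain ⟨f₁, rfl, h₁⟩ := h₁
  filter_upwards [h₁, hδ.ae_eq_of_rep_eq f f₁] with x a b hx
  rw [b (hf x hx), a hx]

theorem killsOn_univ_iff {f : Lip μ} : KillsOn δ univ f.rep ↔ δ f = 0 := by
  constructor
  · rintro ⟨f', hf', h⟩
    rw [Lip.ext_rep hf'] at h
    refine Lp.ext ?_
    filter_upwards [h, Lp.coeFn_zero ℝ ∞ μ] with x hx h0
    rw [hx (mem_univ x), h0, Pi.zero_apply]
  · intro h
    refine ⟨f, rfl, ?_⟩
    rw [h]
    filter_upwards [Lp.coeFn_zero ℝ ∞ μ] with x h0 _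
    rw [h0, Pi.zero_apply]

theorem IsMetricDerivation.killsOn_of_tendsto (hδ : IsMetricDerivation δ) {u : ℕ → M → ℝ}
    {g : M → ℝ} {K R : ℝ≥0} (hu : ∀ k, KillsOn δ univ (u k)) (hK : ∀ k, LipschitzWith K (u k))
    (hR : ∀ k x, |u k x| ≤ R) (hlim : ∀ x, Tendsto (fun k => u k x) atTop (𝓝 (g x))) :
    KillsOn δ univ g := by
  have hgK : LipschitzWith K g := LipschitzWith.of_dist_le_mul fun x y =>
    le_of_tendsto ((hlim x).dist (hlim y)) (.of_forall fun k => (hK k).dist_le_mul x y)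
  have hgR : ∀ x, |g x| ≤ R := fun x =>
    le_of_tendsto (hlim x).abs (.of_forall fun k => hR k x)
  set f : Lip μ := Lip.mk g hgK hgR with hf
  have hfg : f.rep = g := Lip.rep_mk _ _ _
  choose v hv hvk using hu
  have hv0 : ∀ k, δ (v k) = 0 := fun k => killsOn_univ_iff.1 ⟨v k, rfl, hvk k⟩
  have hnorm : ∀ k, ‖v k‖ ≤ max (K : ℝ) R := fun k =>
    Lip.norm_le_of_rep (by rw [hv]; exact hK k) (by rw [hv]; exact hR k) R.2
  have key : δ f = 0 := by
    refine eq_of_forall_integral_mul_eq fun k => ?_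
    have h1 := hδ.tendsto_integral_mul hnorm (f := f)
      (fun x => by simp only [hv, hfg]; exact hlim x) k
    simp only [hv0] at h1
    exact tendsto_nhds_unique h1 tendsto_const_nhds
  rw [← hfg]
  exact killsOn_univ_iff.2 key

end KillsOn

/-! ### Norming functionals determine a derivation -/

section Norming

variable {F : Type*} [NormedAddCommGroup F] [NormedSpace ℝ F] [TopologicalSpace.SeparableSpace F]

variable (F) in
theorem exists_norming_sequence : ∃ φ : ℕ → StrongDual ℝ F, (∀ n, ‖φ n‖ ≤ 1) ∧
    ∀ (v : F) (c : ℝ), c < ‖v‖ → ∃ n, c < φ n v := by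
  -- Support functionals at a dense sequence of points; this form gives norm at most 1 and thus also
  -- covers the zero vector.
  choose φ hφ hφx using fun n => exists_dual_vector'' ℝ (TopologicalSpace.denseSeq F n)
  refine ⟨φ, hφ, fun v c hc => ?_⟩
  obtain ⟨n, hn⟩ := (TopologicalSpace.denseRange_denseSeq F).exists_dist_lt v
    (half_pos (sub_pos.2 hc))
  refine ⟨n, ?_⟩
  set y := TopologicalSpace.denseSeq F n
  have h1 : φ n y - φ n v ≤ ‖v - y‖ := by
    rw [← map_sub, norm_sub_rev]
    exact (le_abs_self _).trans (((φ n).le_opNorm _).trans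
      (mul_le_of_le_one_left (norm_nonneg _) (hφ n)))
  have h2 : ‖v‖ ≤ ‖y‖ + ‖v - y‖ := by
    have := norm_add_le y (v - y)
    simpa using this
  have h3 : φ n y = ‖y‖ := hφx n
  rw [dist_eq_norm] at hn
  linarith

theorem lipschitzWith_one_of_norm_le {φ : StrongDual ℝ F} (h : ‖φ‖ ≤ 1) : LipschitzWith 1 φ :=
  φ.lipschitz.weaken (by exact_mod_cast h)

variable [MeasurableSpace F] [BorelSpace F] {μ : Measure F} [SigmaFinite μ] [μ.IsOpenPosMeasure]

/-- On the ball of radius `m` the truncation of `φ` at `m` equals `φ`, so there the function is a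
truncated affine expression in an annihilated one. Locality and the exhaustion by balls finish the
argument. -/
theorem IsMetricDerivation.killsOn_of_locally {δ : Lip μ →L[ℝ] Lp ℝ ∞ μ}
    (hδ : IsMetricDerivation δ) {φ : StrongDual ℝ F} (hφ : ‖φ‖ ≤ 1)
    (h : ∀ m : ℕ, KillsOn δ (Metric.ball 0 m) fun x => clamp m (φ x)) (a : ℝ) (L R : ℝ≥0) :
    KillsOn δ univ fun x => clamp R (a + L * φ x) := by
  have hlip : LipschitzWith L fun x => a + L * φ x := LipschitzWith.of_dist_le_mul fun x y => by
    rw [dist_add_left, Real.dist_eq, ← mul_sub, abs_mul, NNReal.abs_eq, ← Real.dist_eq]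
    gcongr
    simpa using (lipschitzWith_one_of_norm_le hφ).dist_le_mul x y
  refine ⟨clampLip R _ hlip, rep_clampLip _ _ _, ?_⟩
  have hm : ∀ m : ℕ, ∀ᵐ x ∂μ, x ∈ Metric.ball (0 : F) m → δ (clampLip R _ hlip) x = 0 := by
    intro m
    refine hδ.killsOn_congr (hδ.killsOn_clamp R ((hδ.killsOn_const _ a).add
      ((h m).const_mul (L : ℝ)))) fun x hx => ?_
    have hxm : |φ x| ≤ m := by
      refine ((φ.le_opNorm x).trans (mul_le_of_le_one_left (norm_nonneg _) hφ)).trans ?_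
      exact (mem_ball_zero_iff.1 hx).le
    rw [rep_clampLip, clamp_of_abs_le hxm]
  filter_upwards [ae_all_iff.2 hm] with x hx _
  obtain ⟨m, hm⟩ := exists_nat_gt ‖x‖
  exact hx m (mem_ball_zero_iff.2 hm)

/-- A metric derivation which annihilates the truncations of a norming sequence of functionals
vanishes. -/
theorem IsMetricDerivation.eq_zero_of_norming {δ : Lip μ →L[ℝ] Lp ℝ ∞ μ}
    (hδ : IsMetricDerivation δ) {φ : ℕ → StrongDual ℝ F} (hφ : ∀ n, ‖φ n‖ ≤ 1)
    (hnorm : ∀ (v : F) (c : ℝ), c < ‖v‖ → ∃ n, c < φ n v)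
    (h : ∀ n (m : ℕ), KillsOn δ (Metric.ball 0 m) fun x => clamp m (φ n x)) : δ = 0 := by
  ext1 f
  rw [_root_.zero_apply, ← killsOn_univ_iff]
  set K : ℝ≥0 := ‖f‖₊ with hK
  have hφle : ∀ n v, φ n v ≤ ‖v‖ := fun n v =>
    (le_abs_self _).trans (((φ n).le_opNorm v).trans
      (mul_le_of_le_one_left (norm_nonneg _) (hφ n)))
  have hf : LipschitzWith K f.rep := f.lipschitzWith_rep_of_norm_le le_rfl
  have hfK : ∀ x, |f.rep x| ≤ K := f.abs_rep_le
  set y := TopologicalSpace.denseSeq F with hy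
  -- The uniform bounds are carried along because weak* continuity yields stability only under
  -- bounded pointwise limits; suprema and infima preserve them with the same `K`.
  let P : (F → ℝ) → Prop := fun g => KillsOn δ univ g ∧ LipschitzWith K g ∧ ∀ x, |g x| ≤ K
  have hPsup : ∀ g₁, P g₁ → ∀ g₂, P g₂ → P (g₁ ⊔ g₂) := fun g₁ h₁ g₂ h₂ =>
    ⟨hδ.killsOn_sup h₁.1 h₂.1, max_self K ▸ h₁.2.1.max h₂.2.1, fun x =>
      (abs_max_le_max_abs_abs).trans (max_le (h₁.2.2 x) (h₂.2.2 x))⟩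
  have hPinf : ∀ g₁, P g₁ → ∀ g₂, P g₂ → P (g₁ ⊓ g₂) := fun g₁ h₁ g₂ h₂ =>
    ⟨hδ.killsOn_inf h₁.1 h₂.1, max_self K ▸ h₁.2.1.min h₂.2.1, fun x =>
      (abs_min_le_max_abs_abs).trans (max_le (h₁.2.2 x) (h₂.2.2 x))⟩
  have hPlim : ∀ (u : ℕ → F → ℝ) (g : F → ℝ), (∀ k, P (u k)) →
      (∀ x, Tendsto (fun k => u k x) atTop (𝓝 (g x))) → P g := fun u g hu hlim =>
    ⟨hδ.killsOn_of_tendsto (fun k => (hu k).1) (fun k => (hu k).2.1) (fun k => (hu k).2.2) hlim,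
      LipschitzWith.of_dist_le_mul fun x y => le_of_tendsto ((hlim x).dist (hlim y))
        (.of_forall fun k => (hu k).2.1.dist_le_mul x y),
      fun x => le_of_tendsto (hlim x).abs (.of_forall fun k => (hu k).2.2 x)⟩
  have hblock : ∀ i n, P fun x => clamp K (f.rep (y i) + K * φ n (x - y i)) := by
    intro i n
    have hlip : LipschitzWith K fun x => f.rep (y i) + K * φ n (x - y i) :=
      LipschitzWith.of_dist_le_mul fun x z => by
        rw [dist_add_left, Real.dist_eq, ← mul_sub, abs_mul, NNReal.abs_eq, ← map_sub,
          sub_sub_sub_cancel_right, dist_eq_norm]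
        gcongr
        exact ((φ n).le_opNorm _).trans (mul_le_of_le_one_left (norm_nonneg _) (hφ n))
    refine ⟨?_, lipschitzWith_clamp_comp hlip _, fun x => abs_clamp_le K.2 _⟩
    have h1 := hδ.killsOn_of_locally (hφ n) (h n) (f.rep (y i) - K * φ n (y i)) K K
    convert h1 using 3 with x
    rw [map_sub]
    ring
  -- The norm is the supremum of the `φ n`, so finite suprema of the blocks increase to the
  -- truncated cone.
  have hcone : ∀ i, P fun x => clamp K (f.rep (y i) + K * ‖x - y i‖) := by
    intro i
    refine hPlim (fun m => (Finset.range (m + 1)).sup' Finset.nonempty_range_add_one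
      fun n x => clamp K (f.rep (y i) + K * φ n (x - y i))) _
      (fun m => Finset.sup'_induction _ _ hPsup fun n _ => hblock i n) fun x => ?_
    rw [Metric.tendsto_atTop]
    intro ε hε
    obtain ⟨n, hn⟩ := hnorm (x - y i) (‖x - y i‖ - ε / (K + 1)) (by
      have : 0 < ε / ((K : ℝ) + 1) := by positivity
      linarith)
    refine ⟨n, fun m hm => ?_⟩
    rw [Finset.sup'_apply, dist_comm, Real.dist_eq, abs_of_nonneg]
    · have h1 : clamp K (f.rep (y i) + K * φ n (x - y i)) ≤
          (Finset.range (m + 1)).sup' Finset.nonempty_range_add_one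
            (fun n => clamp K (f.rep (y i) + K * φ n (x - y i))) :=
        Finset.le_sup' (fun n => clamp K (f.rep (y i) + K * φ n (x - y i)))
          (Finset.mem_range.2 (by omega))
      have h2 := (lipschitzWith_clamp K).dist_le_mul (f.rep (y i) + K * ‖x - y i‖)
        (f.rep (y i) + K * φ n (x - y i))
      rw [NNReal.coe_one, one_mul, dist_add_left, Real.dist_eq, Real.dist_eq, ← mul_sub, abs_mul,
        NNReal.abs_eq, abs_of_nonneg (sub_nonneg.2 (hφle n _))] at h2
      have h3 : (K : ℝ) * (‖x - y i‖ - φ n (x - y i)) < ε := by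
        have h4 : ‖x - y i‖ - φ n (x - y i) < ε / (K + 1) := by linarith
        rw [lt_div_iff₀ (by positivity)] at h4
        nlinarith [sub_nonneg.2 (hφle n (x - y i))]
      linarith [le_abs_self (clamp K (f.rep (y i) + K * ‖x - y i‖) -
        clamp K (f.rep (y i) + K * φ n (x - y i)))]
    · rw [sub_nonneg]
      refine Finset.sup'_le _ _ fun n _ => clamp_mono _ ?_
      gcongr
      exact hφle n _
  -- By the McShane formula, `f` is the infimum of its cones over a dense set of vertices.
  -- Truncation at `K` does no harm since `|f| ≤ K`.
  refine (hPlim (fun N => (Finset.range (N + 1)).inf' Finset.nonempty_range_add_one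
    fun i x => clamp K (f.rep (y i) + K * ‖x - y i‖)) _
    (fun N => Finset.inf'_induction _ _ hPinf fun i _ => hcone i) fun x => ?_).1
  rw [Metric.tendsto_atTop]
  intro ε hε
  obtain ⟨i, hi⟩ := (TopologicalSpace.denseRange_denseSeq F).exists_dist_lt x
    (by positivity : 0 < ε / (2 * (K + 1)))
  rw [dist_eq_norm, lt_div_iff₀ (by positivity)] at hi
  have hfi : ∀ i, |f.rep x - f.rep (y i)| ≤ K * ‖x - y i‖ := fun i => by
    simpa [dist_eq_norm] using hf.dist_le_mul x (y i)
  refine ⟨i, fun N hN => ?_⟩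
  rw [Finset.inf'_apply, Real.dist_eq, abs_of_nonneg]
  · have h1 : (Finset.range (N + 1)).inf' Finset.nonempty_range_add_one
        (fun i => clamp K (f.rep (y i) + K * ‖x - y i‖)) ≤ clamp K (f.rep (y i) + K * ‖x - y i‖) :=
      Finset.inf'_le (fun i => clamp K (f.rep (y i) + K * ‖x - y i‖))
        (Finset.mem_range.2 (by omega))
    have h2 := (lipschitzWith_clamp K).dist_le_mul (f.rep (y i) + K * ‖x - y i‖) (f.rep x)
    rw [NNReal.coe_one, one_mul, clamp_of_abs_le (hfK x), Real.dist_eq, Real.dist_eq] at h2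
    have h3 : |f.rep (y i) + K * ‖x - y i‖ - f.rep x| ≤ 2 * (K * ‖x - y i‖) := by
      have h4 := abs_le.1 (hfi i)
      have h5 : 0 ≤ K * ‖x - y i‖ := by positivity
      rw [abs_le]
      constructor <;> linarith
    have h6 := le_abs_self (clamp K (f.rep (y i) + K * ‖x - y i‖) - f.rep x)
    nlinarith [norm_nonneg (x - y i)]
  · rw [sub_nonneg]
    refine Finset.le_inf' _ _ fun i _ => ?_
    nth_rw 1 [← clamp_of_abs_le (hfK x)]
    refine clamp_mono _ ?_
    linarith [(abs_le.1 (hfi i)).2]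

end Norming

/-! ### A moment problem solved by Hahn–Banach -/

section MomentProblem

/-- Bounded functionals with prescribed values on a sequence: it is enough to check the norm
inequality for rational linear combinations. -/
theorem exists_strongDual_of_rat_bound {X : Type*} [NormedAddCommGroup X] [NormedSpace ℝ X]
    (φ : ℕ → X) (d : ℕ → ℝ) {C : ℝ} (hC : 0 ≤ C)
    (h : ∀ q : ℕ →₀ ℚ, |q.sum fun i c => (c : ℝ) * d i| ≤ C * ‖q.sum fun i c => (c : ℝ) • φ i‖) :
    ∃ l : StrongDual ℝ X, ‖l‖ ≤ C ∧ ∀ i, l (φ i) = d i := by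
  have hreal : ∀ c : ℕ →₀ ℝ, |Finsupp.linearCombination ℝ d c| ≤
      C * ‖Finsupp.linearCombination ℝ φ c‖ := by
    intro c
    -- Zero must be approximated by zero so that `Finsupp.mapRange` applies to the coefficients.
    have hr : ∀ t : ℝ, ∃ r : ℕ → ℚ, Tendsto (fun k => (r k : ℝ)) atTop (𝓝 t) ∧ (t = 0 → r = 0) := by
      intro t
      rcases eq_or_ne t 0 with rfl | ht
      · exact ⟨0, by simp, fun _ => rfl⟩
      · obtain ⟨r, -, -, hr⟩ := Real.exists_seq_rat_strictMono_tendsto t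
        exact ⟨r, hr, fun h => (ht h).elim⟩
    choose r hr hr0 using hr
    have hr0' : ∀ k, r 0 k = 0 := fun k => congrFun (hr0 0 rfl) k
    have hk := fun k => h (c.mapRange (fun t => r t k) (hr0' k))
    simp only [Finsupp.sum_mapRange_index, Rat.cast_zero, zero_mul, zero_smul, implies_true] at hk
    exact le_of_tendsto_of_tendsto'
      (tendsto_finsetSum _ fun i _ => (hr (c i)).mul_const (d i)).abs
      ((tendsto_finsetSum _ fun i _ => (hr (c i)).smul_const (φ i)).norm.const_mul C) hk
  have huniq : ∀ c c' : ℕ →₀ ℝ, Finsupp.linearCombination ℝ φ c = Finsupp.linearCombination ℝ φ c' →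
      Finsupp.linearCombination ℝ d c = Finsupp.linearCombination ℝ d c' := by
    intro c c' hcc
    have h1 := hreal (c - c')
    rw [map_sub, map_sub, hcc, sub_self, norm_zero, mul_zero] at h1
    exact sub_eq_zero.1 (abs_nonpos_iff.1 h1)
  -- The bound makes `φ i ↦ d i` well defined on the span even when the `φ i` are dependent; the
  -- chosen preimages `s` are then irrelevant.
  set p := LinearMap.range (Finsupp.linearCombination ℝ φ) with hp
  choose s hs using fun x : p => x.2
  let f : p →ₗ[ℝ] ℝ :=
    { toFun := fun x => Finsupp.linearCombination ℝ d (s x)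
      map_add' := fun x y => by
        rw [← map_add]
        exact huniq _ _ (by rw [map_add, hs, hs, hs, Submodule.coe_add])
      map_smul' := fun a x => by
        rw [RingHom.id_apply, ← map_smul]
        exact huniq _ _ (by rw [map_smul, hs, hs, Submodule.coe_smul]) }
  have hf : ∀ x, ‖f x‖ ≤ C * ‖x‖ := fun x => by
    have h1 := hreal (s x)
    rw [hs] at h1
    exact h1
  obtain ⟨l, hl, hln⟩ := exists_extension_norm_eq p (f.mkContinuous C hf)
  refine ⟨l, hln ▸ f.mkContinuous_norm_le hC hf, fun i => ?_⟩
  have hi : Finsupp.linearCombination ℝ φ (Finsupp.single i 1) = φ i := by simp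
  have h1 := hl ⟨φ i, hp ▸ ⟨_, hi⟩⟩
  refine h1.trans ((huniq _ (Finsupp.single i 1) ?_).trans ?_)
  · rw [hs, hi]
  · simp

end MomentProblem

/-! ### The isometry, and recovery of the vector field -/

section Field

theorem measurable_apply_of_countable {α ι β : Type*} [MeasurableSpace α] [MeasurableSpace ι]
    [MeasurableSpace β] [Countable ι] [MeasurableSingletonClass ι] {w : ι → α → β}
    (hw : ∀ i, Measurable (w i)) {k : α → ι} (hk : Measurable k) :
    Measurable fun x => w (k x) x := by
  have h : Measurable fun z : α × ι => w z.2 z.1 := measurable_from_prod_countable_left hw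
  exact h.comp (measurable_id.prodMk hk)

variable {F : Type*} [NormedAddCommGroup F] [NormedSpace ℝ F]

theorem lineDeriv_clamp_sub (φ : StrongDual ℝ F) {R c : ℝ} {x : F} (h : |φ x - c| < R) (v : F) :
    lineDeriv ℝ (fun y => clamp R (φ y - c)) x v = φ v := by
  have h1 : (fun y => clamp R (φ y - c)) =ᶠ[𝓝 x] fun y => φ y - c := by
    have hc : Continuous fun y => |φ y - c| := by fun_prop
    filter_upwards [hc.continuousAt.eventually (gt_mem_nhds h)] with y hy
    exact clamp_of_abs_le hy.le
  rw [h1.lineDeriv_eq]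
  exact ((φ.hasFDerivAt.sub_const c).hasLineDerivAt v).lineDeriv

variable [MeasurableSpace F] [BorelSpace F]
  [TopologicalSpace.SeparableSpace F] {μ : Measure F} [SigmaFinite μ] [μ.IsOpenPosMeasure]
  {F₀ : Submodule ℝ F}

/-- The truncations of `φ n - j` to `[-1, 1]`, with `j` an integer, form a countable family in the
unit ball. At each `x`, taking `j = ⌊φ n x⌋` makes the truncation inactive near `x`, so `φ n (Φ x)`
is bounded by the norm of the derivation. -/
theorem norm_le_norm_fieldDerivation (h : QuasiInvariant μ F₀) (hd : Dense (F₀ : Set F))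
    (Φ : Lp F ∞ μ) : ‖Φ‖ ≤ ‖fieldDerivation h hd Φ‖ := by
  obtain ⟨φ, hφ, hnorm⟩ := exists_norming_sequence F
  have hlip : ∀ n (j : ℤ), LipschitzWith 1 fun x => φ n x - j := fun n j => by
    simpa using (lipschitzWith_one_of_norm_le (hφ n)).sub (LipschitzWith.const (j : ℝ))
  set p : ℕ → ℤ → Lip μ := fun n j => clampLip 1 (fun x => φ n x - j) (hlip n j) with hp
  refine Lp_top_norm_le (norm_nonneg _) ?_
  filter_upwards [ae_all_iff.2 fun n => ae_all_iff.2 fun j => fieldDerivation_ae_eq h hd Φ (p n j),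
    ae_all_iff.2 fun n => ae_all_iff.2 fun j => ae_norm_le_norm (fieldDerivation h hd Φ (p n j))]
    with x h1 h2
  by_contra! hlt
  obtain ⟨n, hn⟩ := hnorm _ _ hlt
  have hj : |φ n x - ⌊φ n x⌋| < ((1 : ℝ≥0) : ℝ) := by
    rw [NNReal.coe_one, abs_lt]
    constructor <;> linarith [Int.floor_le (φ n x), Int.lt_floor_add_one (φ n x)]
  have h3 := h2 n ⌊φ n x⌋
  rw [h1 n ⌊φ n x⌋, hp, rep_clampLip, lineDeriv_clamp_sub (φ n) hj] at h3
  have h4 : ‖fieldDerivation h hd Φ (p n ⌊φ n x⌋)‖ ≤ ‖fieldDerivation h hd Φ‖ := by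
    refine (ContinuousLinearMap.le_opNorm _ _).trans (mul_le_of_le_one_right (norm_nonneg _) ?_)
    exact (norm_clampLip_le 1 _ (hlip n _)).trans (by simp)
  exact absurd ((le_abs_self _).trans (h3.trans h4)) (not_le.2 hn)

/-- On the ball of radius `m` the combination of truncations agrees with a truncation of `ψ`, which
is `‖ψ‖`-Lipschitz, so locality and `ae_abs_le` apply. Rational coefficients keep the number of
exceptional null sets countable. -/
theorem ae_abs_sum_le {δ : Lip μ →L[ℝ] Lp ℝ ∞ μ} (hδ : IsMetricDerivation δ)
    {φ : ℕ → StrongDual ℝ F} (hφ : ∀ n, ‖φ n‖ ≤ 1) (m : ℕ) (q : ℕ →₀ ℚ) :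
    ∀ᵐ x ∂μ, ‖x‖ ≤ m → |q.sum fun i c => (c : ℝ) *
      δ (clampLip m (φ i) (lipschitzWith_one_of_norm_le (hφ i))) x| ≤
        ‖δ‖ * ‖q.sum fun i c => (c : ℝ) • φ i‖ := by
  set p : ℕ → Lip μ := fun i => clampLip m (φ i) (lipschitzWith_one_of_norm_le (hφ i)) with hp
  set ψ : StrongDual ℝ F := q.sum fun i c => (c : ℝ) • φ i with hψ
  set t : Lip μ := clampLip (‖ψ‖₊ * m) ψ ψ.lipschitz with ht
  set w : Lip μ := q.sum fun i c => (c : ℝ) • p i with hw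
  have hwrep : ∀ x, w.rep x = q.sum fun i c => (c : ℝ) * (p i).rep x := by
    intro x
    let ev : Lip μ →ₗ[ℝ] ℝ :=
      { toFun := fun f => f.rep x
        map_add' := fun f g => by rw [Lip.rep_add, Pi.add_apply]
        map_smul' := fun c f => by rw [Lip.rep_smul, Pi.smul_apply, RingHom.id_apply] }
    have h1 : ev w = _ := map_finsuppSum ev q _
    simpa [ev, Lip.rep_smul] using h1
  have hδw : ∀ᵐ x ∂μ, δ w x = q.sum fun i c => (c : ℝ) * δ (p i) x := by
    rw [hw, Finsupp.sum, map_sum]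
    filter_upwards [Lp.coeFn_finsetSum q.support fun i => δ ((q i : ℝ) • p i),
      ae_all_iff.2 fun i => map_smul_ae_eq δ (q i : ℝ) (p i)] with x h1 h2
    rw [h1, Finset.sum_apply, Finsupp.sum]
    exact Finset.sum_congr rfl fun i _ => h2 i
  have htlip : LipschitzWith ‖ψ‖₊ t.rep := by
    rw [ht, rep_clampLip]
    exact lipschitzWith_clamp_comp ψ.lipschitz _
  filter_upwards [hδw, hδ.ae_abs_le htlip, hδ.ae_eq_of_rep_eq w t] with x h1 h2 h3 hx
  rw [← h1, h3]
  · exact h2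
  · have hψx : |ψ x| ≤ ((‖ψ‖₊ * (m : ℝ≥0) : ℝ≥0) : ℝ) := by
      refine (ψ.le_opNorm x).trans ?_
      rw [NNReal.coe_mul, coe_nnnorm, NNReal.coe_natCast]
      gcongr
    rw [hwrep, ht, rep_clampLip]
    beta_reduce
    rw [clamp_of_abs_le hψx, hψ]
    have h4 : (q.sum fun i c => (c : ℝ) • φ i) x = q.sum fun i c => (c : ℝ) * φ i x := by
      rw [Finsupp.sum, _root_.sum_apply]
      rfl
    rw [h4]
    refine Finset.sum_congr rfl fun i _ => ?_
    have hix : |φ i x| ≤ ((m : ℝ≥0) : ℝ) := by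
      rw [NNReal.coe_natCast]
      exact ((φ i).le_opNorm x).trans
        ((mul_le_of_le_one_left (norm_nonneg _) (hφ i)).trans hx)
    simp only [hp, rep_clampLip, clamp_of_abs_le hix]

variable [CompleteSpace F]

/-- A norming sequence separates points, so `v ↦ (φ n v)` is a continuous injection of a Polish
space into `ℕ → ℝ`, hence a measurable embedding (Lusin–Souslin). Measurable coordinates are
therefore enough. -/
theorem aemeasurable_of_norming {φ : ℕ → StrongDual ℝ F}
    (hnorm : ∀ (v : F) (c : ℝ), c < ‖v‖ → ∃ n, c < φ n v) {Φ : F → F} {d : ℕ → F → ℝ}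
    (hdm : ∀ n, Measurable (d n)) (h : ∀ᵐ x ∂μ, ∀ n, φ n (Φ x) = d n x) : AEMeasurable Φ μ := by
  have := UniformSpace.secondCountable_of_separable F
  obtain ⟨G, hG, hGm, hGs⟩ : ∃ G : Set F, G ∈ ae μ ∧ MeasurableSet G ∧
      ∀ x ∈ G, ∀ n, φ n (Φ x) = d n x := by
    obtain ⟨s, hs, hsm, hs0⟩ := exists_measurable_superset_of_null (ae_iff.1 h)
    refine ⟨sᶜ, by rwa [compl_mem_ae_iff], hsm.compl, fun x hx => ?_⟩
    by_contra hcon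
    exact hx (hs hcon)
  let e : F → ℕ → ℝ := fun v n => φ n v
  have hec : Continuous e := continuous_pi fun n => (φ n).continuous
  have hei : Function.Injective e := by
    intro v w hvw
    by_contra hne
    obtain ⟨n, hn⟩ := hnorm (v - w) 0 (norm_pos_iff.2 (sub_ne_zero.2 hne))
    rw [map_sub, show φ n v = φ n w from congrFun hvw n, sub_self] at hn
    exact lt_irrefl _ hn
  have hemb : MeasurableEmbedding e := hec.measurableEmbedding hei
  refine ⟨G.indicator Φ, hemb.measurable_comp_iff.1 ?_, ?_⟩
  · refine measurable_pi_iff.2 fun n => ?_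
    have : (fun x => (e ∘ G.indicator Φ) x n) = G.indicator (d n) := by
      funext x
      by_cases hx : x ∈ G <;> simp [e, hx, hGs x]
    rw [this]
    exact (hdm n).indicator hGm
  · filter_upwards [hG] with x hx
    rw [indicator_of_mem hx]

/-- The values of a metric derivation on the truncations of a functional are the truncations of a
measurable function. -/
theorem IsMetricDerivation.exists_measurable_eq {δ : Lip μ →L[ℝ] Lp ℝ ∞ μ}
    (hδ : IsMetricDerivation δ) {φ : StrongDual ℝ F} (hφ : ‖φ‖ ≤ 1) :
    ∃ d : F → ℝ, Measurable d ∧ ∀ᵐ x ∂μ, ∀ m : ℕ, ‖x‖ ≤ m →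
      δ (clampLip m φ (lipschitzWith_one_of_norm_le hφ)) x = d x := by
  let p : ℕ → Lip μ := fun m => clampLip m φ (lipschitzWith_one_of_norm_le hφ)
  have hrep : ∀ x (m : ℕ), ‖x‖ ≤ m → (p m).rep x = φ x := fun x m hx => by
    have hx' : |φ x| ≤ ((m : ℝ≥0) : ℝ) := by
      rw [NNReal.coe_natCast]
      exact (φ.le_opNorm x).trans ((mul_le_of_le_one_left (norm_nonneg _) hφ).trans hx)
    rw [rep_clampLip]
    exact clamp_of_abs_le hx'
  let w : ℕ → F → ℝ := fun m => δ (p m)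
  refine ⟨fun x => w ⌈‖x‖⌉₊ x, measurable_apply_of_countable (fun m => measurable_coe (δ (p m)))
    measurable_norm.nat_ceil, ?_⟩
  filter_upwards [ae_all_iff.2 fun m => ae_all_iff.2 fun m' => hδ.ae_eq_of_rep_eq (p m) (p m')]
    with x hx m hm
  exact hx m _ ((hrep x m hm).trans (hrep x _ (Nat.le_ceil _)).symm)

/-- Over a reflexive space, the values of a metric derivation on functionals come from a bounded
measurable vector field. -/
theorem IsMetricDerivation.exists_field
    (hrefl : Function.Surjective (NormedSpace.inclusionInDoubleDual ℝ F))
    {δ : Lip μ →L[ℝ] Lp ℝ ∞ μ} (hδ : IsMetricDerivation δ) {φ : ℕ → StrongDual ℝ F}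
    (hφ : ∀ n, ‖φ n‖ ≤ 1) (hnorm : ∀ (v : F) (c : ℝ), c < ‖v‖ → ∃ n, c < φ n v) :
    ∃ Φ : Lp F ∞ μ, ∀ n (m : ℕ), ∀ᵐ x ∂μ, ‖x‖ ≤ m →
      δ (clampLip m (φ n) (lipschitzWith_one_of_norm_le (hφ n))) x = φ n (Φ x) := by
  have := UniformSpace.secondCountable_of_separable F
  choose d hdm hd using fun n => hδ.exists_measurable_eq (hφ n)
  have hex : ∀ᵐ x ∂μ, ∃ w : F, ‖w‖ ≤ ‖δ‖ ∧ ∀ n, φ n w = d n x := by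
    filter_upwards [ae_all_iff.2 fun m => ae_all_iff.2 fun q => ae_abs_sum_le hδ hφ m q,
      ae_all_iff.2 hd] with x hx hdx
    obtain ⟨l, hl, hlφ⟩ := exists_strongDual_of_rat_bound φ (fun n => d n x) (norm_nonneg δ)
      fun q => by
        have h1 := hx ⌈‖x‖⌉₊ q (Nat.le_ceil _)
        simp only [fun i => hdx i _ (Nat.le_ceil ‖x‖)] at h1
        exact h1
    obtain ⟨w, rfl⟩ := hrefl l
    exact ⟨w, ((NormedSpace.inclusionInDoubleDualLi ℝ (E := F)).norm_map w).symm.le.trans hl,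
      fun n => hlφ n⟩
  -- The vectors are chosen pointwise, with value `0` on the exceptional set; no measurable
  -- selection is needed, because the coordinates `d n` determine the vector.
  have hchoice : ∀ x, ∃ v : F, (∃ w : F, ‖w‖ ≤ ‖δ‖ ∧ ∀ n, φ n w = d n x) →
      ‖v‖ ≤ ‖δ‖ ∧ ∀ n, φ n v = d n x := fun x => by
    by_cases h : ∃ w : F, ‖w‖ ≤ ‖δ‖ ∧ ∀ n, φ n w = d n x
    · exact ⟨h.choose, fun _ => h.choose_spec⟩
    · exact ⟨0, fun h' => (h h').elim⟩
  choose Φ hΦ using hchoice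
  have hΦs : ∀ᵐ x ∂μ, ‖Φ x‖ ≤ ‖δ‖ ∧ ∀ n, φ n (Φ x) = d n x := hex.mono fun x hx => hΦ x hx
  have hΦm : AEMeasurable Φ μ := aemeasurable_of_norming hnorm hdm (hΦs.mono fun x hx => hx.2)
  have hmem : MemLp Φ ∞ μ :=
    memLp_top_of_bound hΦm.aestronglyMeasurable ‖δ‖ (hΦs.mono fun x hx => hx.1)
  refine ⟨hmem.toLp Φ, fun n m => ?_⟩
  filter_upwards [hd n, hΦs, hmem.coeFn_toLp] with x h1 h2 h3 hx
  rw [h3, h2.2 n, h1 m hx]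

/-- On the ball of radius `m`, both `δ` and the derivation of the recovered field `Φ` take the
truncated `φ n` to `φ n (Φ x)`, so `eq_zero_of_norming` applies to their difference. -/
theorem surjective_fieldDerivationLinearMap (h : QuasiInvariant μ F₀) (hd : Dense (F₀ : Set F))
    (hrefl : Function.Surjective (NormedSpace.inclusionInDoubleDual ℝ F)) :
    Function.Surjective (fieldDerivationLinearMap h hd) := by
  intro δ
  obtain ⟨φ, hφ, hnorm⟩ := exists_norming_sequence F
  obtain ⟨Φ, hΦ⟩ := IsMetricDerivation.exists_field hrefl δ.2 hφ hnorm
  refine ⟨Φ, (sub_eq_zero.1 ?_).symm⟩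
  refine Subtype.ext (IsMetricDerivation.eq_zero_of_norming (δ - fieldDerivationLinearMap h hd Φ).2
    hφ hnorm fun n m => ?_)
  set p : Lip μ := clampLip m (φ n) (lipschitzWith_one_of_norm_le (hφ n)) with hp
  refine ⟨p, by rw [hp, rep_clampLip, NNReal.coe_natCast], ?_⟩
  change ∀ᵐ x ∂μ, x ∈ Metric.ball (0 : F) m → (δ.1 p - fieldDerivation h hd Φ p : Lp ℝ ∞ μ) x = 0
  filter_upwards [hΦ n m, Lp.coeFn_sub (δ.1 p) (fieldDerivation h hd Φ p),
    fieldDerivation_ae_eq h hd Φ p] with x h1 h2 h3 hx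
  have hxm : ‖x‖ < m := mem_ball_zero_iff.1 hx
  have hφx : |φ n x - 0| < m := by
    rw [sub_zero]
    exact ((φ n).le_opNorm x).trans_lt
      ((mul_le_of_le_one_left (norm_nonneg _) (hφ n)).trans_lt hxm)
  have h4 := lineDeriv_clamp_sub (φ n) hφx (Φ x)
  simp only [sub_zero] at h4
  rw [h2, Pi.sub_apply, h1 hxm.le, h3, hp, rep_clampLip, NNReal.coe_natCast, h4, sub_self]

/-- Bounded measurable vector fields on a reflexive space are the same as metric derivations. -/
def fieldDerivationEquiv (h : QuasiInvariant μ F₀) (hd : Dense (F₀ : Set F))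
    (hrefl : Function.Surjective (NormedSpace.inclusionInDoubleDual ℝ F)) :
    Lp F ∞ μ ≃ₗᵢ[ℝ] VectorFields μ :=
  LinearIsometryEquiv.ofSurjective
    ⟨fieldDerivationLinearMap h hd, fun Φ => le_antisymm (norm_fieldDerivation_le h hd Φ)
      (norm_le_norm_fieldDerivation h hd Φ)⟩
    (surjective_fieldDerivationLinearMap h hd hrefl)

end Field

theorem Lp_subsingleton_of_measure_zero {M E : Type*} [MeasurableSpace M] [NormedAddCommGroup E]
    {p : ℝ≥0∞} (f g : Lp E p (0 : Measure M)) : f = g :=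
  Lp.ext (by simp [Filter.EventuallyEq])

end Weaver

end

theorem theorem47 {F : Type*} [NormedAddCommGroup F] [NormedSpace ℝ F] [CompleteSpace F]
    [TopologicalSpace.SeparableSpace F] [MeasurableSpace F] [BorelSpace F]
    (hrefl : Function.Surjective (NormedSpace.inclusionInDoubleDual ℝ F))
    (μ : MeasureTheory.Measure F) [MeasureTheory.SigmaFinite μ]
    (F₀ : Submodule ℝ F) (hdense : Dense (F₀ : Set F)) (hqi : Weaver.QuasiInvariant μ F₀) :
    ∃ T : MeasureTheory.Lp F ∞ μ ≃ₗᵢ[ℝ] Weaver.VectorFields μ,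
      (∀ (a : MeasureTheory.Lp ℝ ∞ μ) (Φ : MeasureTheory.Lp F ∞ μ),
        T (a • Φ : MeasureTheory.Lp F ∞ μ) = a • T Φ) ∧
      ∀ (v : F₀) (f : Weaver.Lip μ),
        Weaver.IsGeneratorValue hqi v (Weaver.Lip.toLinf f)
          ((T (Weaver.constField μ (v : F))).1 f) := by
  -- For `μ = 0` open sets are not charged, but all the spaces of functions and derivations are
  -- trivial.
  rcases eq_or_ne μ 0 with rfl | hμ
  · have hF : Subsingleton (Lp F ∞ (0 : Measure F)) := ⟨Weaver.Lp_subsingleton_of_measure_zero⟩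
    have hR : Subsingleton (Lp ℝ ∞ (0 : Measure F)) := ⟨Weaver.Lp_subsingleton_of_measure_zero⟩
    have hV : Subsingleton (Weaver.VectorFields (0 : Measure F)) :=
      ⟨fun δ ε => Subtype.ext (ContinuousLinearMap.ext fun f => Subsingleton.elim _ _)⟩
    refine ⟨⟨⟨⟨⟨fun _ => 0, fun _ _ => Subsingleton.elim _ _⟩, fun _ _ => Subsingleton.elim _ _⟩,
      fun _ => 0, fun _ => Subsingleton.elim _ _, fun _ => Subsingleton.elim _ _⟩,
      fun Φ => ?_⟩, fun _ _ => Subsingleton.elim _ _, fun v f => ?_⟩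
    · rw [Subsingleton.elim Φ 0]
      exact norm_zero.trans norm_zero.symm
    · refine Weaver.tendsto_nhds_weakStar.2 fun g => ?_
      simp
  · have := hqi.isOpenPosMeasure hdense hμ
    exact ⟨Weaver.fieldDerivationEquiv hqi hdense hrefl,
      Weaver.fieldDerivationLinearMap_smul hqi hdense,
      Weaver.isGeneratorValue_fieldDerivation hqi hdense⟩
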